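/- Let $K$ be a field and let $R_1, R_2$ be commutative $\mathbb Z$-graded $K$-algebras; put $R = R_1\otimes_K R_2$ with the total grading. All modules are $\mathbb Z$-graded. For graded modules $N, M$ over a graded ring write $\operatorname{Ext}^i(N,M)=\bigoplus_{p\in\mathbb Z}\operatorname{Ext}^i_{\mathrm{gr}}(N,M(p))$, where $\operatorname{Ext}_{\mathrm{gr}}$ is $\operatorname{Ext}$ in the abelian category of graded modules and degree-preserving homomorphisms; this is again a graded module. (a) For all graded $R_i$-modules $M_i, N_i$ $(i=1,2)$ and all $k\ge 0$ there are graded (degree-preserving) $R$-homomorphisms $$\tau_k:\bigoplus_{i+j=k}\operatorname{Ext}^i_{R_1}(N_1,M_1)\otimes_K\operatorname{Ext}^j_{R_2}(N_2,M_2)\longrightarrow \operatorname{Ext}^k_R(N_1\otimes_K N_2,\,M_1\otimes_K M_2),$$ natural in $M_1,M_2,N_1,N_2$. They are the external products: for homogeneous $x\in\operatorname{Ext}^i(N_1,M_1)_p$ and $y\in\operatorname{Ext}^j(N_2,M_2)_q$, $\tau_k(x\otimes y)$ is the Yoneda product of $x\otimes N_2\in\operatorname{Ext}^i_{\mathrm{gr}}(N_1\otimes_K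 N_2,M_1(p)\otimes_K N_2)$ with $M_1(p)\otimes y\in\operatorname{Ext}^j_{\mathrm{gr}}(M_1(p)\otimes_K N_2,M_1(p)\otimes_K M_2(q))$; in particular $\tau_0(f\otimes g)(x\otimes y)=f(x)\otimes g(y)$ for homogeneous homomorphisms $f,g$. (b) Suppose in addition that each $R_i$ is finitely generated as a $K$-algebra, has no nonzero elements of negative degree and satisfies $[R_i]_0=K$. Let $\mathfrak m_1,\mathfrak m_2,\mathfrak m$ be the irrelevant ideals of $R_1,R_2,R$ (generated by the homogeneous elements of positive degree), and let $H^i_{\mathfrak m}(M)=\varinjlim_t\operatorname{Ext}^i_R(R/\mathfrak m^t,M)$ denote local cohomology of graded modules, and similarly over $R_1,R_2$. Then for all graded $R_i$-modules $M_i$ and all $k\ge0$ there are graded $R$-isomorphisms $$\sigma_k:\bigoplus_{i+j=k}H^i_{\mathfrak m_1}(M_1)\otimes_K H^j_{\mathfrak m_2}(M_2)\longrightarrow H^k_{\mathfrak m}(M_1\otimes_K M_2),$$ natural in $M_1,M_2$. They are induced by $\tau_k$: whenever $1\mapsto 1\otimes1$ defines a homomorphism of graded $R$-modules $\pi:R/\mathfrak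 m^s\to R_1/\mathfrak m_1^t\otimes_K R_2/\mathfrak m_2^t$, the composition of $\bigoplus_{i+j=k}\operatorname{Ext}^i(R_1/\mathfrak m_1^t,M_1)\otimes_K\operatorname{Ext}^j(R_2/\mathfrak m_2^t,M_2)\to\bigoplus_{i+j=k}H^i_{\mathfrak m_1}(M_1)\otimes_K H^j_{\mathfrak m_2}(M_2)$ with $\sigma_k$ equals the composition of $\tau_k$, $\operatorname{Ext}^k(\pi,M_1\otimes_K M_2)$ and $\operatorname{Ext}^k_R(R/\mathfrak m^s,M_1\otimes_K M_2)\to H^k_{\mathfrak m}(M_1\otimes_K M_2)$. -/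

import Mathlib

open CategoryTheory CategoryTheory.Limits TensorProduct

universe u

noncomputable section

/-! ### Gradings of vector spaces -/

/-- A family of subspaces is a grading (an internal direct sum decomposition) as soon as it spans
and there are projections onto its members. -/
theorem isInternal_of_projections {K V : Type*} [Field K] [AddCommGroup V] [Module K V]
    (𝓥 : ℤ → Submodule K V) (π : ℤ → V →ₗ[K] V)
    (hsame : ∀ p, ∀ x ∈ 𝓥 p, π p x = x) (hne : ∀ p q, p ≠ q → ∀ x ∈ 𝓥 q, π p x = 0)
    (htop : ∀ x, x ∈ ⨆ p, 𝓥 p) : DirectSum.IsInternal 𝓥 := by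
  rw [DirectSum.isInternal_submodule_iff_iSupIndep_and_iSup_eq_top]
  refine ⟨?_, eq_top_iff.2 fun x _ => htop x⟩
  rw [iSupIndep_def]
  intro p
  rw [Submodule.disjoint_def]
  intro x hx hx'
  have h0 : π p x = 0 := by
    have : (⨆ q, ⨆ (_ : q ≠ p), 𝓥 q) ≤ LinearMap.ker (π p) :=
      iSup_le fun q => iSup_le fun hq y hy => hne p q hq.symm y hy
    exact this hx'
  rw [← hsame p x hx, h0]

/-- A vector space with an action of the algebra `R` given by an algebra homomorphism to the
endomorphism algebra, as an `R`-module. -/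
@[reducible] def moduleOfAlgHom {K R V : Type*} [Field K] [CommRing R] [Algebra K R]
    [AddCommGroup V] [Module K V] (φ : R →ₐ[K] Module.End K V) : Module R V :=
  Module.compHom V φ.toRingHom

theorem moduleOfAlgHom_isScalarTower {K R V : Type*} [Field K] [CommRing R] [Algebra K R]
    [AddCommGroup V] [Module K V] (φ : R →ₐ[K] Module.End K V) :
    letI := moduleOfAlgHom φ
    IsScalarTower K R V :=
  letI := moduleOfAlgHom φ
  ⟨fun k r v => by
    change φ (k • r) v = k • φ r v
    rw [map_smul]; rfl⟩

/-! ### The category of graded modules -/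

/-- A finitely generated graded algebra `R = K ⊕ R_1 ⊕ R_2 ⊕ ⋯` over the field `K`, with
`R_0 = K`. The generators may have arbitrary positive degrees. -/
structure IsConnectedGraded {K R : Type u} [Field K] [CommRing R] [Algebra K R]
    (𝓡 : ℤ → Submodule K R) : Prop where
  grading_neg : ∀ n : ℤ, n < 0 → 𝓡 n = ⊥
  grading_zero : 𝓡 0 = 1
  finiteType : Algebra.FiniteType K R

/-- A `ℤ`-graded module over the algebra `R` over the field `K`, graded by the family `𝓡`. -/
structure GrMod {K R : Type u} [Field K] [CommRing R] [Algebra K R] (𝓡 : ℤ → Submodule K R) where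
  carrier : Type u
  [addCommGroup : AddCommGroup carrier]
  [moduleK : Module K carrier]
  [module : Module R carrier]
  [isScalarTower : IsScalarTower K R carrier]
  /-- the homogeneous components -/
  grading : ℤ → Submodule K carrier
  isInternal : DirectSum.IsInternal grading
  smul_mem' : ∀ {p q : ℤ} {r : R} {x : carrier}, r ∈ 𝓡 p → x ∈ grading q →
    r • x ∈ grading (p + q)

namespace GrMod

variable {K R : Type u} [Field K] [CommRing R] [Algebra K R] {𝓡 : ℤ → Submodule K R}

instance : CoeSort (GrMod 𝓡) (Type u) := ⟨GrMod.carrier⟩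

attribute [instance] GrMod.addCommGroup GrMod.moduleK GrMod.module GrMod.isScalarTower

/-- The decomposition of a graded module into its components. -/
def decomp (M : GrMod 𝓡) : (DirectSum ℤ fun p => M.grading p) ≃ₗ[K] M :=
  LinearEquiv.ofBijective (DirectSum.coeLinearMap M.grading)
    (show Function.Bijective (DirectSum.coeLinearMap M.grading) from M.isInternal)

theorem decomp_lof (M : GrMod 𝓡) (p : ℤ) (x : M.grading p) :
    M.decomp (DirectSum.lof K ℤ (fun p => M.grading p) p x) = x :=
  DirectSum.coeLinearMap_lof M.grading p x

/-- The projection onto the component of degree `p`. -/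
def proj (M : GrMod 𝓡) (p : ℤ) : M →ₗ[K] M :=
  (M.grading p).subtype ∘ₗ DirectSum.component K ℤ (fun p => M.grading p) p ∘ₗ
    M.decomp.symm.toLinearMap

theorem proj_mem (M : GrMod 𝓡) (p : ℤ) (x : M) : M.proj p x ∈ M.grading p := by
  simp [proj]

theorem decomp_of_mem (M : GrMod 𝓡) {p : ℤ} {x : M} (hx : x ∈ M.grading p) :
    M.decomp.symm x = DirectSum.lof K ℤ (fun p => M.grading p) p ⟨x, hx⟩ := by
  rw [LinearEquiv.symm_apply_eq, decomp_lof]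

theorem proj_of_mem (M : GrMod 𝓡) {p : ℤ} {x : M} (hx : x ∈ M.grading p) : M.proj p x = x := by
  simp [proj, decomp_of_mem M hx, DirectSum.component.lof_self]

theorem proj_of_mem_ne (M : GrMod 𝓡) {p q : ℤ} (h : p ≠ q) {x : M} (hx : x ∈ M.grading q) :
    M.proj p x = 0 := by
  simp [proj, decomp_of_mem M hx, DirectSum.component.of, h.symm]

theorem mem_iSup (M : GrMod 𝓡) (x : M) : x ∈ ⨆ p, M.grading p := by
  rw [M.isInternal.submodule_iSup_eq_top]; trivial

theorem hom_induction (M : GrMod 𝓡) {P : M → Prop} (x : M)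
    (mem : ∀ p, ∀ x ∈ M.grading p, P x) (zero : P 0) (add : ∀ x y, P x → P y → P (x + y)) : P x :=
  Submodule.iSup_induction _ (motive := P) (M.mem_iSup x) mem zero add

theorem exists_sum_proj (M : GrMod 𝓡) (x : M) : ∃ s : Finset ℤ, ∀ t, s ⊆ t →
    ∑ p ∈ t, M.proj p x = x := by
  induction x using M.hom_induction with
  | mem p x hx =>
    refine ⟨{p}, fun t ht => ?_⟩
    rw [Finset.sum_eq_single p, M.proj_of_mem hx]
    · intro q _ hq
      exact M.proj_of_mem_ne hq hx
    · intro h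
      exact absurd (ht (Finset.mem_singleton_self p)) h
  | zero => exact ⟨∅, by simp⟩
  | add x y hx hy =>
    obtain ⟨s, hs⟩ := hx
    obtain ⟨t, ht⟩ := hy
    refine ⟨s ∪ t, fun v hv => ?_⟩
    simp only [map_add, Finset.sum_add_distrib]
    rw [hs v (Finset.union_subset_left hv), ht v (Finset.union_subset_right hv)]

/-- Graded homomorphisms (of degree zero): `R`-linear maps that preserve degrees. -/
@[ext] structure Hom (M N : GrMod 𝓡) where
  toLin : M →ₗ[R] N
  map_mem' : ∀ (p : ℤ) (x : M), x ∈ M.grading p → toLin x ∈ N.grading p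

instance : Category (GrMod 𝓡) where
  Hom := Hom
  id M := ⟨LinearMap.id, fun _ _ h => h⟩
  comp f g := ⟨g.toLin ∘ₗ f.toLin, fun p x h => g.map_mem' p _ (f.map_mem' p x h)⟩

/-- The underlying linear map of a morphism of graded modules. -/
def lin {M N : GrMod 𝓡} (f : M ⟶ N) : M →ₗ[R] N := Hom.toLin f

/-- The morphism of graded modules with a given underlying linear map. -/
def ofLin {M N : GrMod 𝓡} (f : M →ₗ[R] N) (hf : ∀ p, ∀ x ∈ M.grading p, f x ∈ N.grading p) :
    M ⟶ N := Hom.mk f hf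

@[simp] theorem lin_ofLin {M N : GrMod 𝓡} (f : M →ₗ[R] N) (hf) :
    lin (ofLin f hf : M ⟶ N) = f := rfl

@[simp] theorem lin_id (M : GrMod 𝓡) : lin (𝟙 M) = LinearMap.id := rfl

@[simp] theorem lin_comp {M N P : GrMod 𝓡} (f : M ⟶ N) (g : N ⟶ P) :
    lin (f ≫ g) = lin g ∘ₗ lin f := rfl

theorem lin_mem {M N : GrMod 𝓡} (f : M ⟶ N) {p : ℤ} {x : M} (hx : x ∈ M.grading p) :
    lin f x ∈ N.grading p := Hom.map_mem' f p x hx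

@[ext] theorem hom_ext {M N : GrMod 𝓡} {f g : M ⟶ N} (h : lin f = lin g) : f = g :=
  Hom.ext h

theorem proj_lin {M N : GrMod 𝓡} (f : M ⟶ N) (p : ℤ) (x : M) :
    N.proj p (lin f x) = lin f (M.proj p x) := by
  induction x using M.hom_induction with
  | mem q x hx =>
    by_cases h : p = q
    · subst h; rw [M.proj_of_mem hx, N.proj_of_mem (lin_mem f hx)]
    · rw [M.proj_of_mem_ne h hx, N.proj_of_mem_ne h (lin_mem f hx), map_zero]
  | zero => simp
  | add x y hx hy => simp [hx, hy]

/-! Morphisms form `K`-vector spaces. -/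

instance (M N : GrMod 𝓡) : Zero (M ⟶ N) := ⟨ofLin 0 fun _ _ _ => zero_mem _⟩
instance (M N : GrMod 𝓡) : Add (M ⟶ N) :=
  ⟨fun f g => ofLin (lin f + lin g) fun _ _ h => add_mem (lin_mem f h) (lin_mem g h)⟩
instance (M N : GrMod 𝓡) : Neg (M ⟶ N) :=
  ⟨fun f => ofLin (-lin f) fun _ _ h => neg_mem (lin_mem f h)⟩
instance (M N : GrMod 𝓡) : Sub (M ⟶ N) :=
  ⟨fun f g => ofLin (lin f - lin g) fun _ _ h => sub_mem (lin_mem f h) (lin_mem g h)⟩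
instance (M N : GrMod 𝓡) : SMul ℕ (M ⟶ N) :=
  ⟨fun n f => ofLin (n • lin f) fun _ _ h => nsmul_mem (lin_mem f h) n⟩
instance (M N : GrMod 𝓡) : SMul ℤ (M ⟶ N) :=
  ⟨fun n f => ofLin (n • lin f) fun _ _ h => zsmul_mem (lin_mem f h) n⟩
instance (M N : GrMod 𝓡) : SMul K (M ⟶ N) :=
  ⟨fun k f => ofLin (algebraMap K R k • lin f) fun _ x h => by
    simpa using Submodule.smul_mem _ k (lin_mem f h)⟩

@[simp] theorem lin_zero (M N : GrMod 𝓡) : lin (0 : M ⟶ N) = 0 := rfl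
@[simp] theorem lin_add {M N : GrMod 𝓡} (f g : M ⟶ N) : lin (f + g) = lin f + lin g := rfl
@[simp] theorem lin_neg {M N : GrMod 𝓡} (f : M ⟶ N) : lin (-f) = -lin f := rfl
@[simp] theorem lin_sub {M N : GrMod 𝓡} (f g : M ⟶ N) : lin (f - g) = lin f - lin g := rfl
@[simp] theorem lin_smul {M N : GrMod 𝓡} (k : K) (f : M ⟶ N) :
    lin (k • f) = algebraMap K R k • lin f := rfl

theorem lin_injective (M N : GrMod 𝓡) : Function.Injective (lin : (M ⟶ N) → (M →ₗ[R] N)) :=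
  fun _ _ h => hom_ext h

instance (M N : GrMod 𝓡) : AddCommGroup (M ⟶ N) :=
  (lin_injective M N).addCommGroup _ rfl (fun _ _ => rfl) (fun _ => rfl) (fun _ _ => rfl)
    (fun _ _ => rfl) (fun _ _ => rfl)

instance : Preadditive (GrMod 𝓡) where
  add_comp _ _ _ f f' g := by ext x; simp
  comp_add _ _ _ f g g' := by ext x; simp

instance : Linear K (GrMod 𝓡) where
  homModule M N :=
    { smul := fun k f => k • f
      one_smul := fun f => by ext x; simp
      mul_smul := fun k l f => by ext x; simp [mul_smul]
      smul_zero := fun k => by ext x; simp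
      smul_add := fun k f g => by ext x; simp
      add_smul := fun k l f => by ext x; simp [add_smul]
      zero_smul := fun f => by ext x; simp }
  smul_comp _ _ _ k f g := by ext x; simp
  comp_smul _ _ _ f k g := by ext x; simp

/-! ### Homogeneous submodules, quotients and direct sums -/

/-- A submodule is homogeneous if it contains the homogeneous components of its elements. -/
def IsHomog (M : GrMod 𝓡) (P : Submodule R M) : Prop := ∀ x ∈ P, ∀ p, M.proj p x ∈ P

/-- A homogeneous submodule, with the induced grading. -/
abbrev sub (M : GrMod 𝓡) (P : Submodule R M) (hP : M.IsHomog P) : GrMod 𝓡 where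
  carrier := P
  grading p := (M.grading p).comap (P.subtype.restrictScalars K)
  isInternal := by
    refine isInternal_of_projections _
      (fun p => ((M.proj p) ∘ₗ P.subtype.restrictScalars K).codRestrict
        (P.restrictScalars K) fun x => hP x x.2 p) ?_ ?_ ?_
    · intro p x hx
      exact Subtype.ext (M.proj_of_mem hx)
    · intro p q h x hx
      exact Subtype.ext (M.proj_of_mem_ne h hx)
    · intro x
      obtain ⟨s, hs⟩ := M.exists_sum_proj x.1
      have : x = ∑ p ∈ s, (⟨M.proj p x.1, hP x.1 x.2 p⟩ : P) := by
        apply Subtype.ext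
        refine (hs s subset_rfl).symm.trans ?_
        exact (map_sum P.subtype (fun p => (⟨M.proj p x.1, hP x.1 x.2 p⟩ : P)) s).symm
      rw [this]
      exact Submodule.sum_mem _ fun p _ => Submodule.mem_iSup_of_mem p (M.proj_mem p x.1)
  smul_mem' hr hx := M.smul_mem' hr hx

/-- The inclusion of a homogeneous submodule. -/
def subι (M : GrMod 𝓡) (P : Submodule R M) (hP : M.IsHomog P) : M.sub P hP ⟶ M :=
  ofLin P.subtype fun _ _ h => h

/-- The quotient by a homogeneous submodule, with the induced grading. -/
abbrev quot (M : GrMod 𝓡) (P : Submodule R M) (hP : M.IsHomog P) : GrMod 𝓡 where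
  carrier := M ⧸ P
  grading p := (M.grading p).map (P.mkQ.restrictScalars K)
  isInternal := by
    refine isInternal_of_projections _
      (fun p => (P.restrictScalars K).liftQ (P.mkQ.restrictScalars K ∘ₗ M.proj p) fun x hx => by
        simpa using hP x hx p) ?_ ?_ ?_
    · rintro p _ ⟨x, hx, rfl⟩
      change P.mkQ (M.proj p x) = P.mkQ x
      rw [M.proj_of_mem hx]
    · rintro p q h _ ⟨x, hx, rfl⟩
      change P.mkQ (M.proj p x) = 0
      rw [M.proj_of_mem_ne h hx, map_zero]
    · intro y
      obtain ⟨x, rfl⟩ := P.mkQ_surjective y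
      obtain ⟨s, hs⟩ := M.exists_sum_proj x
      rw [← hs s subset_rfl, map_sum]
      exact Submodule.sum_mem _ fun p _ =>
        Submodule.mem_iSup_of_mem p ⟨_, M.proj_mem p x, rfl⟩
  smul_mem' := by
    rintro p q r _ hr ⟨x, hx, rfl⟩
    exact ⟨r • x, M.smul_mem' hr hx, by simp⟩

/-- The projection onto the quotient by a homogeneous submodule. -/
def quotπ (M : GrMod 𝓡) (P : Submodule R M) (hP : M.IsHomog P) : M ⟶ M.quot P hP :=
  ofLin P.mkQ fun _ x h => ⟨x, h, rfl⟩

/-- The morphism out of a quotient induced by a morphism that vanishes on the submodule. -/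
def quotDesc (M : GrMod 𝓡) (P : Submodule R M) (hP : M.IsHomog P) {N : GrMod 𝓡} (f : M ⟶ N)
    (hf : P ≤ LinearMap.ker (lin f)) : M.quot P hP ⟶ N :=
  ofLin (P.liftQ (lin f) hf) (by
    rintro p _ ⟨x, hx, rfl⟩
    exact lin_mem f hx)

/-- The direct sum of a family of graded modules. -/
abbrev dsum {J : Type u} (M : J → GrMod 𝓡) : GrMod 𝓡 where
  carrier := DirectSum J fun j => M j
  grading p :=
    { carrier := {x | ∀ j, x j ∈ (M j).grading p}
      add_mem' := fun hx hy j => add_mem (hx j) (hy j)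
      zero_mem' := fun j => zero_mem _
      smul_mem' := fun k x hx j => Submodule.smul_mem _ k (hx j) }
  isInternal := by
    classical
    refine isInternal_of_projections _ (fun p => DirectSum.lmap fun j => (M j).proj p) ?_ ?_ ?_
    · intro p x hx
      refine DFinsupp.ext fun j => ?_
      exact (M j).proj_of_mem (hx j)
    · intro p q h x hx
      refine DFinsupp.ext fun j => ?_
      exact (M j).proj_of_mem_ne h (hx j)
    · intro x
      induction x using DirectSum.induction_on with
      | zero => exact zero_mem _
      | add x y hx hy => exact add_mem hx hy
      | of j x =>
        induction x using (M j).hom_induction with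
        | zero => rw [map_zero]; exact zero_mem _
        | add x y hx hy => rw [map_add]; exact add_mem hx hy
        | mem p x hx =>
          refine Submodule.mem_iSup_of_mem p fun i => ?_
          by_cases h : j = i
          · subst h; rw [DirectSum.of_eq_same]; exact hx
          · rw [DirectSum.of_eq_of_ne _ _ _ (Ne.symm h)]; exact zero_mem _
  smul_mem' hr hx j := (M j).smul_mem' hr (hx j)

/-- The inclusion of a summand. -/
def dsumι {J : Type u} [DecidableEq J] (M : J → GrMod 𝓡) (j : J) : M j ⟶ dsum M :=
  ofLin (DirectSum.lof R J (fun j => M j) j) (by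
    intro p x hx i
    by_cases h : j = i
    · subst h; rw [DirectSum.lof_apply]; exact hx
    · rw [DirectSum.lof_eq_of, DirectSum.of_eq_of_ne _ _ _ (Ne.symm h)]; exact zero_mem _)

/-- The morphism out of a direct sum given by a family of morphisms. -/
def dsumDesc {J : Type u} [DecidableEq J] (M : J → GrMod 𝓡) {N : GrMod 𝓡} (f : ∀ j, M j ⟶ N) :
    dsum M ⟶ N :=
  ofLin (DirectSum.toModule R J N fun j => lin (f j)) (by
    classical
    intro p x hx
    have : DirectSum.toModule R J N (fun j => lin (f j)) x =
        ∑ j ∈ DFinsupp.support x, lin (f j) (x j) := by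
      conv_lhs => rw [← DirectSum.sum_support_of x]
      rw [map_sum]
      refine Finset.sum_congr rfl fun j _ => ?_
      rw [← DirectSum.lof_eq_of R, DirectSum.toModule_lof]
    rw [this]
    exact Submodule.sum_mem _ fun j _ => lin_mem (f j) (hx j))

theorem dsumι_desc {J : Type u} [DecidableEq J] (M : J → GrMod 𝓡) {N : GrMod 𝓡}
    (f : ∀ j, M j ⟶ N) (j : J) : dsumι M j ≫ dsumDesc M f = f j := by
  ext x
  simp [dsumι, dsumDesc]

theorem dsum_hom_ext {J : Type u} [DecidableEq J] (M : J → GrMod 𝓡) {N : GrMod 𝓡}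
    {f g : dsum M ⟶ N} (h : ∀ j, dsumι M j ≫ f = dsumι M j ≫ g) : f = g := by
  ext1
  refine DirectSum.linearMap_ext _ fun j => ?_
  exact congrArg lin (h j)

/-! ### Graded modules form an abelian category -/

theorem ker_isHomog {M N : GrMod 𝓡} (f : M ⟶ N) : M.IsHomog (LinearMap.ker (lin f)) := by
  intro x hx p
  rw [LinearMap.mem_ker] at hx ⊢
  rw [← proj_lin, hx, map_zero]

theorem range_isHomog {M N : GrMod 𝓡} (f : M ⟶ N) : N.IsHomog (LinearMap.range (lin f)) := by
  rintro _ ⟨x, rfl⟩ p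
  exact ⟨M.proj p x, (proj_lin f p x).symm⟩

theorem mono_of_injective {M N : GrMod 𝓡} (f : M ⟶ N) (hf : Function.Injective (lin f)) :
    Mono f :=
  ⟨fun g h e => by
    ext x
    exact hf (LinearMap.congr_fun (congrArg lin e) x)⟩

theorem epi_of_surjective {M N : GrMod 𝓡} (f : M ⟶ N) (hf : Function.Surjective (lin f)) :
    Epi f :=
  ⟨fun g h e => by
    ext y
    obtain ⟨x, rfl⟩ := hf y
    exact LinearMap.congr_fun (congrArg lin e) x⟩

theorem injective_of_mono {M N : GrMod 𝓡} (f : M ⟶ N) [Mono f] : Function.Injective (lin f) := by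
  rw [← LinearMap.ker_eq_bot, eq_bot_iff]
  intro x hx
  have h : M.subι _ (ker_isHomog f) ≫ f = 0 ≫ f := by
    ext y
    rw [zero_comp]
    exact y.2
  rw [cancel_mono] at h
  exact LinearMap.congr_fun (congrArg lin h) (⟨x, hx⟩ : LinearMap.ker (lin f))

theorem surjective_of_epi {M N : GrMod 𝓡} (f : M ⟶ N) [Epi f] : Function.Surjective (lin f) := by
  intro y
  have h : f ≫ N.quotπ _ (range_isHomog f) = f ≫ 0 := by
    ext x
    exact (Submodule.Quotient.mk_eq_zero _).2 ⟨x, rfl⟩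
  rw [cancel_epi] at h
  have := LinearMap.congr_fun (congrArg lin h) y
  exact (Submodule.Quotient.mk_eq_zero _).1 this

/-- An injective morphism whose range is the kernel of `g` is a kernel of `g`. -/
def isKernel {L M N : GrMod 𝓡} (f : L ⟶ M) (g : M ⟶ N) (w : f ≫ g = 0)
    (hf : Function.Injective (lin f)) (hfg : ∀ x, lin g x = 0 → ∃ y, lin f y = x) :
    IsLimit (KernelFork.ofι f w) :=
  KernelFork.IsLimit.ofι f w
    (fun {P} h hh =>
      ofLin ((LinearEquiv.ofInjective (lin f) hf).symm.toLinearMap ∘ₗ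
        (lin h).codRestrict (LinearMap.range (lin f)) fun x =>
          hfg _ (LinearMap.congr_fun (congrArg lin hh) x)) (by
        intro p x hx
        set y := (LinearEquiv.ofInjective (lin f) hf).symm
          ((lin h).codRestrict (LinearMap.range (lin f)) (fun x =>
          hfg _ (LinearMap.congr_fun (congrArg lin hh) x)) x) with hy
        have e : lin f y = lin h x := by
          rw [hy, LinearEquiv.ofInjective_symm_apply]; rfl
        have : L.proj p y = y := by
          apply hf
          rw [← proj_lin, e, M.proj_of_mem (lin_mem h hx)]
        change y ∈ _
        rw [← this]
        exact L.proj_mem p y))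
    (fun {P} h hh => by
      ext x
      change lin f ((LinearEquiv.ofInjective (lin f) hf).symm _) = _
      rw [LinearEquiv.ofInjective_symm_apply]; rfl)
    (fun {P} h hh m hm => by
      have := mono_of_injective f hf
      rw [← cancel_mono f, hm]
      ext x
      symm
      change lin f ((LinearEquiv.ofInjective (lin f) hf).symm _) = _
      rw [LinearEquiv.ofInjective_symm_apply]; rfl)

/-- A surjective morphism whose kernel is the range of `f` is a cokernel of `f`. -/
def isCokernel {L M N : GrMod 𝓡} (f : L ⟶ M) (g : M ⟶ N) (w : f ≫ g = 0)
    (hg : Function.Surjective (lin g)) (hfg : ∀ x, lin g x = 0 → ∃ y, lin f y = x) :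
    IsColimit (CokernelCofork.ofπ g w) :=
  have hker : ∀ {P : GrMod 𝓡} (h : M ⟶ P), f ≫ h = 0 →
      LinearMap.ker (lin g) ≤ LinearMap.ker (lin h) := by
    intro P h hh x hx
    obtain ⟨y, rfl⟩ := hfg x hx
    exact LinearMap.congr_fun (congrArg lin hh) y
  have key : ∀ {P : GrMod 𝓡} (h : M ⟶ P) (hh : f ≫ h = 0) (x : M),
      ((LinearMap.ker (lin g)).liftQ (lin h) (hker h hh) ∘ₗ
        ((lin g).quotKerEquivOfSurjective hg).symm.toLinearMap) (lin g x) = lin h x := by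
    intro P h hh x
    have : ((lin g).quotKerEquivOfSurjective hg).symm (lin g x) =
        (LinearMap.ker (lin g)).mkQ x := by
      rw [LinearEquiv.symm_apply_eq]; rfl
    change ((LinearMap.ker (lin g)).liftQ (lin h) (hker h hh))
      (((lin g).quotKerEquivOfSurjective hg).symm (lin g x)) = _
    rw [this]
    rfl
  CokernelCofork.IsColimit.ofπ g w
    (fun {P} h hh =>
      ofLin ((LinearMap.ker (lin g)).liftQ (lin h) (hker h hh) ∘ₗ
        ((lin g).quotKerEquivOfSurjective hg).symm.toLinearMap) (by
        intro p y hy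
        obtain ⟨x, rfl⟩ := hg y
        rw [← N.proj_of_mem hy, proj_lin, key h hh]
        exact lin_mem h (M.proj_mem p x)))
    (fun {P} h hh => by
      ext x
      exact key h hh x)
    (fun {P} h hh m hm => by
      have := epi_of_surjective g hg
      rw [← cancel_epi g, hm]
      ext x
      exact (key h hh x).symm)

instance : HasKernels (GrMod 𝓡) where
  has_limit {M N} f :=
    HasLimit.mk ⟨_, isKernel (M.subι _ (ker_isHomog f)) f (by ext x; exact x.2)
      Subtype.val_injective fun x hx => ⟨⟨x, hx⟩, rfl⟩⟩

instance : HasCokernels (GrMod 𝓡) where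
  has_colimit {M N} f :=
    HasColimit.mk ⟨_, isCokernel f (N.quotπ _ (range_isHomog f))
      (by ext x; exact (Submodule.Quotient.mk_eq_zero _).2 ⟨x, rfl⟩)
      (Submodule.mkQ_surjective _) fun x hx => (Submodule.Quotient.mk_eq_zero _).1 hx⟩

instance : HasCoproducts.{u} (GrMod 𝓡) := fun J => by
  classical
  refine hasCoproducts_of_colimit_cofans (fun M => Cofan.mk (dsum M) (dsumι M)) (fun M => ?_) J
  exact Cofan.IsColimit.mk _ (fun s => dsumDesc M s.inj) (fun s j => dsumι_desc M _ j)
    (fun s m hm => dsum_hom_ext M fun j => (hm j).trans (dsumι_desc M _ j).symm)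

instance : HasFiniteBiproducts (GrMod 𝓡) :=
  have := hasFiniteCoproducts_of_hasCoproducts.{u} (GrMod 𝓡)
  HasFiniteBiproducts.of_hasFiniteCoproducts

instance : Abelian (GrMod 𝓡) where
  normalMonoOfMono {M N} f _ :=
    ⟨{ Z := N.quot _ (range_isHomog f)
       g := N.quotπ _ (range_isHomog f)
       w := by ext x; exact (Submodule.Quotient.mk_eq_zero _).2 ⟨x, rfl⟩
       isLimit := isKernel _ _ _ (injective_of_mono f) fun x hx =>
        (Submodule.Quotient.mk_eq_zero _).1 hx }⟩
  normalEpiOfEpi {M N} f _ :=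
    ⟨{ W := M.sub _ (ker_isHomog f)
       g := M.subι _ (ker_isHomog f)
       w := by ext x; exact x.2
       isColimit := isCokernel _ _ _ (surjective_of_epi f) fun x hx => ⟨⟨x, hx⟩, rfl⟩ }⟩

instance : HasColimitsOfSize.{u, u} (GrMod 𝓡) :=
  has_colimits_of_hasCoequalizers_and_coproducts

instance : HasColimitsOfShape ℕ (GrMod 𝓡) :=
  have : HasColimitsOfSize.{0, 0} (GrMod 𝓡) := hasColimitsOfSizeShrink.{0, 0, u, u} _
  inferInstance

/-! ### Shifts and free modules -/

/-- The shifted graded module `M(p)`, with components `M(p)_n = M_{n + p}`. -/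
abbrev shift (M : GrMod 𝓡) (p : ℤ) : GrMod 𝓡 where
  carrier := M.carrier
  grading n := M.grading (n + p)
  isInternal := by
    refine isInternal_of_projections _ (fun n => M.proj (n + p)) (fun n x hx => M.proj_of_mem hx)
      (fun n m h x hx => M.proj_of_mem_ne (by omega) hx) fun x => ?_
    obtain ⟨s, hs⟩ := M.exists_sum_proj x
    rw [← hs s subset_rfl]
    refine Submodule.sum_mem _ fun n _ => Submodule.mem_iSup_of_mem (n - p) ?_
    rw [sub_add_cancel]
    exact M.proj_mem n x
  smul_mem' {q n r x} hr hx := by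
    rw [add_assoc]
    exact M.smul_mem' hr hx

/-- The shift `f(p) : M(p) ⟶ N(p)` of a morphism. -/
def shiftMap {M N : GrMod 𝓡} (f : M ⟶ N) (p : ℤ) : M.shift p ⟶ N.shift p :=
  ofLin (lin f : M →ₗ[R] N) fun _ _ h => lin_mem f h

theorem shiftMap_id (M : GrMod 𝓡) (p : ℤ) : shiftMap (𝟙 M) p = 𝟙 (M.shift p) := rfl

theorem shiftMap_comp {L M N : GrMod 𝓡} (f : L ⟶ M) (g : M ⟶ N) (p : ℤ) :
    shiftMap (f ≫ g) p = shiftMap f p ≫ shiftMap g p := rfl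

/-- Multiplication by a homogeneous element `r` of degree `q`, as a morphism `M(p) ⟶ M(q + p)`. -/
def mulHom (M : GrMod 𝓡) {q : ℤ} (r : 𝓡 q) (p n : ℤ) (h : q + p = n) : M.shift p ⟶ M.shift n :=
  ofLin (LinearMap.lsmul R M (r : R)) fun m x hx => by
    have := M.smul_mem' r.2 hx
    rwa [show q + (m + p) = m + n by omega] at this

section

variable [GradedAlgebra 𝓡]

variable (𝓡) in
/-- The algebra `R` as a graded module over itself. -/
abbrev self : GrMod 𝓡 where
  carrier := R
  grading := 𝓡
  isInternal := DirectSum.Decomposition.isInternal 𝓡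
  smul_mem' hr hx := SetLike.mul_mem_graded hr hx

/-- The morphism `R(p) ⟶ M` that sends `1` to a given element of degree `-p`. -/
def ofElement (M : GrMod 𝓡) (p : ℤ) (x : M) (hx : x ∈ M.grading (-p)) :
    (self 𝓡).shift p ⟶ M :=
  ofLin (LinearMap.toSpanSingleton R M x) fun n r hr => by
    have := M.smul_mem' (hr : r ∈ 𝓡 (n + p)) hx
    rwa [show n + p + -p = n by omega] at this

/-- The index set of the homogeneous elements of `M`. -/
abbrev HomogElt (M : GrMod 𝓡) : Type u := Σ p : ℤ, M.grading (-p)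

/-- A free graded module of rank one for each homogeneous element of `M`. -/
abbrev freeFamily (M : GrMod 𝓡) (j : M.HomogElt) : GrMod 𝓡 := (self 𝓡).shift j.1

/-- The free graded module with a generator for each homogeneous element of `M`. -/
abbrev freeCover (M : GrMod 𝓡) : GrMod 𝓡 := dsum M.freeFamily

instance (p : ℤ) : Projective ((self 𝓡).shift p) where
  factors {E X} f e _ := by
    have h1 : (1 : R) ∈ ((self 𝓡).shift p).grading (-p) := by
      change (1 : R) ∈ 𝓡 (-p + p)
      rw [neg_add_cancel]
      exact SetLike.one_mem_graded 𝓡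
    obtain ⟨y, hy⟩ := surjective_of_epi e (lin f (1 : R))
    refine ⟨ofElement E p (E.proj (-p) y) (E.proj_mem _ _), ?_⟩
    ext
    change lin e ((1 : R) • E.proj (-p) y) = lin f (1 : R)
    rw [one_smul, ← proj_lin, hy, X.proj_of_mem (lin_mem f h1)]

instance (M : GrMod 𝓡) : Projective (freeCover M) where
  factors {E X} f e _ := by
    classical
    refine ⟨dsumDesc M.freeFamily fun j => Projective.factorThru (dsumι M.freeFamily j ≫ f) e, ?_⟩
    refine dsum_hom_ext _ fun j => ?_
    rw [← Category.assoc, dsumι_desc, Projective.factorThru_comp]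

open Classical in
/-- The canonical surjection onto `M`. -/
def freeCoverπ (M : GrMod 𝓡) : freeCover M ⟶ M :=
  dsumDesc M.freeFamily fun j => ofElement M j.1 j.2.1 j.2.2

theorem freeCoverπ_surjective (M : GrMod 𝓡) : Function.Surjective (lin (freeCoverπ M)) := by
  classical
  intro x
  change x ∈ LinearMap.range (lin (freeCoverπ M))
  induction x using M.hom_induction with
  | zero => exact zero_mem _
  | add x y hx hy => exact add_mem hx hy
  | mem p x hx =>
    have hx' : x ∈ M.grading (- -p) := by rwa [neg_neg]
    let j : M.HomogElt := ⟨-p, x, hx'⟩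
    refine ⟨lin (dsumι M.freeFamily j) (1 : R), ?_⟩
    have := dsumι_desc M.freeFamily (fun j => ofElement M j.1 j.2.1 j.2.2) j
    refine (LinearMap.congr_fun (congrArg lin this) (1 : R)).trans ?_
    exact one_smul R x

instance : EnoughProjectives (GrMod 𝓡) where
  presentation M :=
    ⟨{ p := freeCover M
       f := freeCoverπ M
       epi := epi_of_surjective _ (freeCoverπ_surjective M) }⟩

instance : HasExt.{u} (GrMod 𝓡) := hasExt_of_enoughProjectives _

/-! ### Graded `Ext` -/

/-- The component of degree `p` of the graded module `Ext^i(N, M)`: the group of `i`-extensions of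
`N` by `M(p)` in the category of graded modules. -/
abbrev ExtPiece (i : ℕ) (N M : GrMod 𝓡) (p : ℤ) : Type u := Abelian.Ext.{u} N (M.shift p) i

/-- Composition with morphisms on both sides, on `Ext^i`. -/
def extPieceMap (i : ℕ) {N N' M M' : GrMod 𝓡} {p p' : ℤ} (f : N' ⟶ N)
    (g : M.shift p ⟶ M'.shift p') : ExtPiece i N M p →ₗ[K] ExtPiece i N' M' p' where
  toFun x := ((Abelian.Ext.mk₀ f).comp x (zero_add i)).comp (Abelian.Ext.mk₀ g) (add_zero i)
  map_add' x y := by simp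
  map_smul' k x := by simp [Abelian.Ext.comp_smul, Abelian.Ext.smul_comp]

theorem extPieceMap_id (i : ℕ) (N M : GrMod 𝓡) (p : ℤ) (x : ExtPiece i N M p) :
    extPieceMap i (𝟙 N) (𝟙 (M.shift p)) x = x := by
  simp [extPieceMap]

theorem extPieceMap_comp (i : ℕ) {N N' N'' M M' M'' : GrMod 𝓡} {p p' p'' : ℤ} (f : N' ⟶ N)
    (f' : N'' ⟶ N') (g : M.shift p ⟶ M'.shift p') (g' : M'.shift p' ⟶ M''.shift p'')
    (x : ExtPiece i N M p) :
    extPieceMap i f' g' (extPieceMap i f g x) = extPieceMap i (f' ≫ f) (g ≫ g') x := by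
  simp only [extPieceMap, LinearMap.coe_mk, AddHom.coe_mk]
  rw [← Abelian.Ext.mk₀_comp_mk₀, ← Abelian.Ext.mk₀_comp_mk₀,
    Abelian.Ext.comp_assoc_of_third_deg_zero, Abelian.Ext.comp_assoc_of_third_deg_zero,
    Abelian.Ext.comp_assoc_of_third_deg_zero, Abelian.Ext.comp_assoc_of_second_deg_zero,
    Abelian.Ext.comp_assoc_of_third_deg_zero]
  simp only [Abelian.Ext.comp_assoc_of_third_deg_zero]

theorem extPieceMap_lof (i : ℕ) {N N' M : GrMod 𝓡} {p n n' : ℤ} (h : n = n') (f : N' ⟶ N)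
    (g : M.shift p ⟶ M.shift n) (g' : M.shift p ⟶ M.shift n') (hg : lin g = lin g')
    (x : ExtPiece i N M p) :
    DirectSum.lof K ℤ (ExtPiece i N' M) n (extPieceMap i f g x) =
      DirectSum.lof K ℤ (ExtPiece i N' M) n' (extPieceMap i f g' x) := by
  subst h
  rw [hom_ext hg]

/-- The action of a homogeneous element on `⨁_p Ext^i(N, M(p))`. -/
def extMul (i : ℕ) (N M : GrMod 𝓡) (q : ℤ) :
    𝓡 q →ₗ[K] Module.End K (DirectSum ℤ (ExtPiece i N M)) where
  toFun r := DirectSum.toModule K ℤ _ fun p =>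
    DirectSum.lof K ℤ (ExtPiece i N M) (q + p) ∘ₗ
      extPieceMap i (𝟙 N) (M.mulHom r p (q + p) rfl)
  map_add' r s := by
    refine DirectSum.linearMap_ext _ fun p => LinearMap.ext fun x => ?_
    have : M.mulHom (r + s) p (q + p) rfl = M.mulHom r p _ rfl + M.mulHom s p _ rfl := by
      ext y; exact add_smul _ _ y
    simp [this, extPieceMap, Abelian.Ext.mk₀_add]
  map_smul' k r := by
    refine DirectSum.linearMap_ext _ fun p => LinearMap.ext fun x => ?_
    have : M.mulHom (k • r) p (q + p) rfl = k • M.mulHom r p _ rfl := by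
      ext y
      change (k • (r : R)) • y = algebraMap K R k • (r : R) • y
      rw [smul_assoc, algebraMap_smul]
    simp [this, extPieceMap, Abelian.Ext.mk₀_smul, Abelian.Ext.comp_smul]

theorem extMul_lof (i : ℕ) (N M : GrMod 𝓡) (q : ℤ) (r : 𝓡 q) (p : ℤ) (x : ExtPiece i N M p) :
    extMul i N M q r (DirectSum.lof K ℤ (ExtPiece i N M) p x) =
      DirectSum.lof K ℤ (ExtPiece i N M) (q + p)
        (extPieceMap i (𝟙 N) (M.mulHom r p (q + p) rfl) x) := by
  simp [extMul]

theorem extMul_one (i : ℕ) (N M : GrMod 𝓡) :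
    extMul i N M 0 (GradedMonoid.GOne.one (A := fun q => ↥(𝓡 q))) = 1 := by
  refine DirectSum.linearMap_ext _ fun p => LinearMap.ext fun x => ?_
  refine (extMul_lof i N M 0 _ p x).trans ?_
  refine (extPieceMap_lof i (zero_add p) (𝟙 N) _ (𝟙 (M.shift p)) ?_ x).trans ?_
  · ext y; exact one_smul R y
  · rw [extPieceMap_id]; rfl

theorem extMul_mul (i : ℕ) (N M : GrMod 𝓡) {a b : ℤ} (r : 𝓡 a) (s : 𝓡 b) :
    extMul i N M (a + b) (GradedMonoid.GMul.mul (A := fun q => ↥(𝓡 q)) r s) = extMul i N M a r * extMul i N M b s := by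
  refine DirectSum.linearMap_ext _ fun p => LinearMap.ext fun x => ?_
  refine (extMul_lof i N M (a + b) _ p x).trans ?_
  refine Eq.symm ?_
  change extMul i N M a r (extMul i N M b s (DirectSum.lof K ℤ (ExtPiece i N M) p x)) = _
  rw [extMul_lof, extMul_lof, extPieceMap_comp, Category.comp_id]
  refine extPieceMap_lof i (add_assoc a b p).symm (𝟙 N) _ _ ?_ x
  ext y
  exact (mul_smul (r : R) (s : R) y).symm

/-- The action of `R` on `⨁_p Ext^i(N, M(p))`. -/
def extAction (i : ℕ) (N M : GrMod 𝓡) :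
    R →ₐ[K] Module.End K (DirectSum ℤ (ExtPiece i N M)) :=
  (DirectSum.toAlgebra K (fun q => 𝓡 q) (extMul i N M)
    (extMul_one i N M) (extMul_mul i N M)).comp
    (DirectSum.decomposeAlgEquiv 𝓡).toAlgHom

theorem extAction_lof (i : ℕ) (N M : GrMod 𝓡) (q : ℤ) (r : 𝓡 q) (p : ℤ) (x : ExtPiece i N M p) :
    extAction i N M (r : R) (DirectSum.lof K ℤ (ExtPiece i N M) p x) =
      DirectSum.lof K ℤ (ExtPiece i N M) (q + p)
        (extPieceMap i (𝟙 N) (M.mulHom r p (q + p) rfl) x) := by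
  have : DirectSum.decomposeAlgEquiv 𝓡 (r : R) = DirectSum.of (fun q => 𝓡 q) q r :=
    DirectSum.decompose_coe 𝓡 r
  have key : extAction i N M (r : R) = extMul i N M q r := by
    change DirectSum.toAlgebra K (fun q => 𝓡 q) (extMul i N M) (extMul_one i N M) (extMul_mul i N M)
      (DirectSum.decomposeAlgEquiv 𝓡 (r : R)) = _
    rw [this]
    exact DirectSum.toAddMonoid_of (fun q => (extMul i N M q).toAddMonoidHom) q r
  rw [key, extMul_lof]

/-- The graded `R`-module `Ext^i_R(N, M) = ⨁_p Ext^i(N, M(p))`. For `i = 0` it is the module of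
finite sums of homogeneous homomorphisms `N → M` of arbitrary degree. -/
def gExt (i : ℕ) (N M : GrMod 𝓡) : GrMod 𝓡 where
  carrier := DirectSum ℤ (ExtPiece i N M)
  module := moduleOfAlgHom (extAction i N M)
  isScalarTower := moduleOfAlgHom_isScalarTower (extAction i N M)
  grading p := LinearMap.range (DirectSum.lof K ℤ (ExtPiece i N M) p)
  isInternal := by
    refine isInternal_of_projections _ (fun p =>
      DirectSum.lof K ℤ (ExtPiece i N M) p ∘ₗ DirectSum.component K ℤ (ExtPiece i N M) p) ?_ ?_ ?_
    · rintro p _ ⟨x, rfl⟩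
      simp [DirectSum.component.lof_self]
    · rintro p q h _ ⟨x, rfl⟩
      simp [DirectSum.component.of, h.symm]
    · intro x
      induction x using DirectSum.induction_on with
      | zero => exact zero_mem _
      | add x y hx hy => exact add_mem hx hy
      | of p x => exact Submodule.mem_iSup_of_mem p ⟨x, rfl⟩
  smul_mem' := by
    rintro p q r _ hr ⟨x, rfl⟩
    exact ⟨_, (extAction_lof i N M p ⟨r, hr⟩ q x).symm⟩

/-- The inclusion of the component of degree `p` into the graded module `Ext^i(N, M)`. -/
def extι (i : ℕ) (N M : GrMod 𝓡) (p : ℤ) : ExtPiece i N M p →ₗ[K] gExt i N M :=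
  DirectSum.lof K ℤ (ExtPiece i N M) p

/-- The morphism `Ext^i(N, M) ⟶ Ext^i(N', M')` induced by `N' ⟶ N` and `M ⟶ M'`. -/
def gExtMap (i : ℕ) {N N' M M' : GrMod 𝓡} (f : N' ⟶ N) (g : M ⟶ M') :
    gExt i N M ⟶ gExt i N' M' :=
  ofLin
    { toFun := DirectSum.lmap fun p => extPieceMap i f (shiftMap g p)
      map_add' := fun x y => map_add _ x y
      map_smul' := fun r x => by
        change DirectSum.lmap (fun p => extPieceMap i f (shiftMap g p)) (extAction i N M r x) =
          extAction i N' M' r (DirectSum.lmap (fun p => extPieceMap i f (shiftMap g p)) x)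
        induction x using DirectSum.induction_on with
        | zero => simp
        | add x y hx hy => simp only [map_add, hx, hy]
        | of p x =>
          induction r using DirectSum.Decomposition.inductionOn 𝓡 with
          | zero => simp
          | add r s hr hs => simp only [map_add, LinearMap.add_apply, hr, hs]
          | homogeneous r =>
            rw [← DirectSum.lof_eq_of K, extAction_lof]
            simp only [DirectSum.lmap_lof, extAction_lof, extPieceMap_comp]
            have e : M.mulHom r p _ rfl ≫ shiftMap g _ = shiftMap g p ≫ M'.mulHom r p _ rfl := by
              ext y; exact map_smul (lin g) _ _
            rw [e, Category.comp_id, Category.id_comp] }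
    (by
      rintro p _ ⟨x, rfl⟩
      exact ⟨_, (DirectSum.lmap_lof _ _ _).symm⟩)

theorem gExtMap_ι (i : ℕ) {N N' M M' : GrMod 𝓡} (f : N' ⟶ N) (g : M ⟶ M') (p : ℤ)
    (x : ExtPiece i N M p) :
    lin (gExtMap i f g) (extι i N M p x) =
      extι i N' M' p (extPieceMap i f (shiftMap g p) x) :=
  DirectSum.lmap_lof _ _ _

theorem gExt_hom_ext {i : ℕ} {N M P : GrMod 𝓡} {f g : gExt i N M ⟶ P}
    (h : ∀ (p : ℤ) (x : ExtPiece i N M p), lin f (extι i N M p x) =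
      lin g (extι i N M p x)) : f = g := by
  ext x
  have hx : ∀ x : DirectSum ℤ (ExtPiece i N M), lin f x = lin g x := by
    intro x
    induction x using DirectSum.induction_on with
    | zero => exact (map_zero (lin f)).trans (map_zero (lin g)).symm
    | add x y hx hy =>
      exact (map_add (lin f) x y).trans ((congrArg₂ _ hx hy).trans (map_add (lin g) x y).symm)
    | of p x => exact h p x
  exact hx x

theorem gExtMap_id (i : ℕ) (N M : GrMod 𝓡) : gExtMap i (𝟙 N) (𝟙 M) = 𝟙 (gExt i N M) :=
  gExt_hom_ext fun p x => by
    rw [gExtMap_ι, shiftMap_id, extPieceMap_id]; rfl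

theorem gExtMap_comp (i : ℕ) {N N' N'' M M' M'' : GrMod 𝓡} (f : N' ⟶ N) (f' : N'' ⟶ N')
    (g : M ⟶ M') (g' : M' ⟶ M'') :
    gExtMap i f g ≫ gExtMap i f' g' = gExtMap i (f' ≫ f) (g ≫ g') :=
  gExt_hom_ext fun p x => by
    change lin (gExtMap i f' g') (lin (gExtMap i f g) (extι i N M p x)) = _
    rw [gExtMap_ι, gExtMap_ι, gExtMap_ι, extPieceMap_comp, shiftMap_comp]

variable (𝓡) in
/-- Graded `Ext` as a functor of both arguments. -/
def gExtFunctor (i : ℕ) : (GrMod 𝓡)ᵒᵖ ⥤ GrMod 𝓡 ⥤ GrMod 𝓡 where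
  obj N :=
    { obj M := gExt i N.unop M
      map g := gExtMap i (𝟙 N.unop) g
      map_id M := gExtMap_id i N.unop M
      map_comp f g := by rw [gExtMap_comp, Category.comp_id] }
  map f :=
    { app M := gExtMap i f.unop (𝟙 M)
      naturality M M' g := by
        simp only [gExtMap_comp, Category.comp_id, Category.id_comp] }
  map_id N := by
    ext1; ext1 M; exact gExtMap_id i N.unop M
  map_comp f g := by
    ext1; ext1 M
    refine Eq.trans ?_ (gExtMap_comp i f.unop g.unop (𝟙 M) (𝟙 M)).symm
    change gExtMap i (g.unop ≫ f.unop) (𝟙 M) = gExtMap i (g.unop ≫ f.unop) (𝟙 M ≫ 𝟙 M)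
    rw [Category.comp_id (𝟙 M)]

/-! ### Local cohomology -/

variable (𝓡) in
/-- The irrelevant ideal, generated by the homogeneous elements of positive degree. -/
def irrelevant : Ideal R := Ideal.span {r | ∃ n : ℤ, 0 < n ∧ r ∈ 𝓡 n}

theorem self_proj (p : ℤ) (x : R) :
    (self 𝓡).proj p x = (DirectSum.decompose 𝓡 x p : R) := by
  induction x using DirectSum.Decomposition.inductionOn 𝓡 with
  | zero => rw [DirectSum.decompose_zero]; exact map_zero _
  | add x y hx hy =>
    rw [DirectSum.decompose_add]
    exact (map_add _ x y).trans (congrArg₂ (· + ·) hx hy)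
  | @homogeneous q r =>
    by_cases h : p = q
    · subst h
      rw [DirectSum.decompose_of_mem_same 𝓡 r.2]
      exact (self 𝓡).proj_of_mem r.2
    · rw [DirectSum.decompose_of_mem_ne 𝓡 r.2 (Ne.symm h)]
      exact (self 𝓡).proj_of_mem_ne h r.2

theorem irrelevant_pow_isHomog (t : ℕ) : (self 𝓡).IsHomog (irrelevant 𝓡 ^ t) := by
  have h : ∀ t : ℕ, (irrelevant 𝓡 ^ t).IsHomogeneous 𝓡 := by
    intro t
    induction t with
    | zero => rw [pow_zero, Ideal.one_eq_top]; exact Ideal.IsHomogeneous.top 𝓡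
    | succ t ih =>
      rw [pow_succ]
      exact Ideal.IsHomogeneous.mul ih (Ideal.homogeneous_span 𝓡 _ fun x ⟨n, _, hx⟩ => ⟨n, hx⟩)
  intro x hx p
  rw [self_proj]
  exact h t p hx

variable (𝓡) in
/-- The graded module `R / 𝔪 ^ t`. -/
def quotPow (t : ℕ) : GrMod 𝓡 := (self 𝓡).quot (irrelevant 𝓡 ^ t) (irrelevant_pow_isHomog t)

variable (𝓡) in
/-- The residue class of `1` in `R / 𝔪 ^ t`. -/
def quotPowOne (t : ℕ) : quotPow 𝓡 t := lin (quotπ _ _ (irrelevant_pow_isHomog t)) (1 : R)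

variable (𝓡) in
/-- The projection `R / 𝔪 ^ t ⟶ R / 𝔪 ^ s` for `s ≤ t`. -/
def quotPowMap {s t : ℕ} (h : s ≤ t) : quotPow 𝓡 t ⟶ quotPow 𝓡 s :=
  quotDesc _ _ (irrelevant_pow_isHomog t) (quotπ _ _ (irrelevant_pow_isHomog s)) fun _ hx =>
    (Submodule.Quotient.mk_eq_zero _).2 (Ideal.pow_le_pow_right h hx)

variable (𝓡) in
/-- The inverse system of the graded modules `R / 𝔪 ^ t`. -/
def quotPowSystem : ℕ ⥤ (GrMod 𝓡)ᵒᵖ where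
  obj t := Opposite.op (quotPow 𝓡 t)
  map h := (quotPowMap 𝓡 (leOfHom h)).op
  map_id t := congrArg Quiver.Hom.op (by
    ext x
    obtain ⟨x, rfl⟩ := Submodule.mkQ_surjective _ x
    rfl)
  map_comp f g := congrArg Quiver.Hom.op (by
    ext x
    obtain ⟨x, rfl⟩ := Submodule.mkQ_surjective _ x
    rfl)

variable (𝓡) in
/-- Graded local cohomology `H^i_𝔪(M) = colim_t Ext^i(R / 𝔪 ^ t, M)` with respect to the
irrelevant ideal `𝔪`, as a functor. -/
def localCohomology (i : ℕ) : GrMod 𝓡 ⥤ GrMod 𝓡 :=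
  colimit (quotPowSystem 𝓡 ⋙ gExtFunctor 𝓡 i)

variable (𝓡) in
/-- The canonical morphism `Ext^i(R / 𝔪 ^ t, M) ⟶ H^i_𝔪(M)`. -/
def toLocalCohomology (i t : ℕ) (M : GrMod 𝓡) :
    gExt i (quotPow 𝓡 t) M ⟶ (localCohomology 𝓡 i).obj M :=
  (colimit.ι (quotPowSystem 𝓡 ⋙ gExtFunctor 𝓡 i) t).app M

end

end GrMod

/-! ### Tensor products over the field -/

section

variable {K V W : Type*} [Field K] [AddCommGroup V] [Module K V] [AddCommGroup W] [Module K W]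

/-- The grading of `V ⊗ W`: the component of degree `n` is spanned by the tensors of homogeneous
elements whose degrees add up to `n`. -/
def tensorGrading (𝓥 : ℤ → Submodule K V) (𝓦 : ℤ → Submodule K W) (n : ℤ) :
    Submodule K (V ⊗[K] W) :=
  Submodule.span K {z | ∃ p q : ℤ, p + q = n ∧ ∃ v ∈ 𝓥 p, ∃ w ∈ 𝓦 q, v ⊗ₜ[K] w = z}

theorem tmul_mem_tensorGrading {𝓥 : ℤ → Submodule K V} {𝓦 : ℤ → Submodule K W} {p q n : ℤ}
    (h : p + q = n) {v : V} {w : W} (hv : v ∈ 𝓥 p) (hw : w ∈ 𝓦 q) :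
    v ⊗ₜ[K] w ∈ tensorGrading 𝓥 𝓦 n :=
  Submodule.subset_span ⟨p, q, h, v, hv, w, hw, rfl⟩

theorem tensorGrading_isInternal {𝓥 : ℤ → Submodule K V} {𝓦 : ℤ → Submodule K W}
    (h𝓥 : DirectSum.IsInternal 𝓥) (h𝓦 : DirectSum.IsInternal 𝓦) :
    DirectSum.IsInternal (tensorGrading 𝓥 𝓦) := by
  let e₁ : (DirectSum ℤ fun p => 𝓥 p) ≃ₗ[K] V :=
    LinearEquiv.ofBijective (DirectSum.coeLinearMap 𝓥) h𝓥
  let e₂ : (DirectSum ℤ fun p => 𝓦 p) ≃ₗ[K] W :=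
    LinearEquiv.ofBijective (DirectSum.coeLinearMap 𝓦) h𝓦
  have he₁ : ∀ p (v : 𝓥 p), e₁.symm v = DirectSum.lof K ℤ (fun p => 𝓥 p) p v := fun p v => by
    rw [LinearEquiv.symm_apply_eq]; exact (DirectSum.coeLinearMap_lof 𝓥 p v).symm
  have he₂ : ∀ p (v : 𝓦 p), e₂.symm v = DirectSum.lof K ℤ (fun p => 𝓦 p) p v := fun p v => by
    rw [LinearEquiv.symm_apply_eq]; exact (DirectSum.coeLinearMap_lof 𝓦 p v).symm
  let π : ℤ → V ⊗[K] W →ₗ[K] V ⊗[K] W := fun n =>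
    DirectSum.toModule K (ℤ × ℤ) (V ⊗[K] W) (fun pq =>
      if pq.1 + pq.2 = n then TensorProduct.map (𝓥 pq.1).subtype (𝓦 pq.2).subtype else 0) ∘ₗ
    (TensorProduct.directSum K K (fun p => 𝓥 p) (fun p => 𝓦 p)).toLinearMap ∘ₗ
    (TensorProduct.congr e₁.symm e₂.symm).toLinearMap
  have hπ : ∀ n p q (v : 𝓥 p) (w : 𝓦 q), π n ((v : V) ⊗ₜ[K] (w : W)) =
      if p + q = n then (v : V) ⊗ₜ[K] (w : W) else 0 := by
    intro n p q v w
    simp only [π, LinearMap.comp_apply, LinearEquiv.coe_coe, TensorProduct.congr_tmul, he₁, he₂]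
    rw [TensorProduct.directSum_lof_tmul_lof, DirectSum.toModule_lof]
    split_ifs <;> simp
  refine isInternal_of_projections _ π ?_ ?_ ?_
  · intro n x hx
    refine Submodule.span_induction (p := fun x _ => π n x = x) ?_ (map_zero _) ?_ ?_ hx
    · rintro _ ⟨p, q, h, v, hv, w, hw, rfl⟩
      have := hπ n p q ⟨v, hv⟩ ⟨w, hw⟩
      rwa [if_pos h] at this
    · intro x y _ _ hx hy; rw [map_add, hx, hy]
    · intro k x _ hx; rw [map_smul, hx]
  · intro n m hnm x hx
    refine Submodule.span_induction (p := fun x _ => π n x = 0) ?_ (map_zero _) ?_ ?_ hx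
    · rintro _ ⟨p, q, h, v, hv, w, hw, rfl⟩
      have := hπ n p q ⟨v, hv⟩ ⟨w, hw⟩
      rwa [if_neg (by omega)] at this
    · intro x y _ _ hx hy; rw [map_add, hx, hy, add_zero]
    · intro k x _ hx; rw [map_smul, hx, smul_zero]
  · intro x
    induction x using TensorProduct.induction_on with
    | zero => exact zero_mem _
    | add x y hx hy => exact add_mem hx hy
    | tmul v w =>
      have hv : v ∈ ⨆ p, 𝓥 p := by rw [h𝓥.submodule_iSup_eq_top]; trivial
      have hw : w ∈ ⨆ p, 𝓦 p := by rw [h𝓦.submodule_iSup_eq_top]; trivial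
      refine Submodule.iSup_induction _
        (motive := fun v => v ⊗ₜ[K] w ∈ ⨆ n, tensorGrading 𝓥 𝓦 n) hv (fun p v hv => ?_)
        (by rw [TensorProduct.zero_tmul]; exact zero_mem _)
        (fun x y hx hy => by rw [TensorProduct.add_tmul]; exact add_mem hx hy)
      refine Submodule.iSup_induction _
        (motive := fun w => v ⊗ₜ[K] w ∈ ⨆ n, tensorGrading 𝓥 𝓦 n) hw (fun q w hw => ?_)
        (by rw [TensorProduct.tmul_zero]; exact zero_mem _)
        (fun x y hx hy => by rw [TensorProduct.tmul_add]; exact add_mem hx hy)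
      exact Submodule.mem_iSup_of_mem (p + q) (tmul_mem_tensorGrading rfl hv hw)

end

section

variable {K R₁ R₂ : Type u} [Field K] [CommRing R₁] [CommRing R₂] [Algebra K R₁] [Algebra K R₂]
variable {𝓡₁ : ℤ → Submodule K R₁} {𝓡₂ : ℤ → Submodule K R₂}

/-- The tensor product of two graded algebras is a graded algebra. -/
instance tensorGradedAlgebra [GradedAlgebra 𝓡₁] [GradedAlgebra 𝓡₂] :
    GradedAlgebra (tensorGrading 𝓡₁ 𝓡₂) where
  one_mem := tmul_mem_tensorGrading (zero_add 0) (SetLike.one_mem_graded 𝓡₁)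
    (SetLike.one_mem_graded 𝓡₂)
  mul_mem := by
    intro m n x y hx hy
    induction hx using Submodule.span_induction with
    | zero => rw [zero_mul]; exact zero_mem _
    | add x x' _ _ hx hx' => rw [add_mul]; exact add_mem hx hx'
    | smul k x _ hx => rw [smul_mul_assoc]; exact Submodule.smul_mem _ k hx
    | mem x hx =>
      obtain ⟨p, q, h, a, ha, b, hb, rfl⟩ := hx
      induction hy using Submodule.span_induction with
      | zero => rw [mul_zero]; exact zero_mem _
      | add x x' _ _ hx hx' => rw [mul_add]; exact add_mem hx hx'
      | smul k x _ hx => rw [mul_smul_comm]; exact Submodule.smul_mem _ k hx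
      | mem y hy =>
        obtain ⟨p', q', h', a', ha', b', hb', rfl⟩ := hy
        rw [Algebra.TensorProduct.tmul_mul_tmul]
        exact tmul_mem_tensorGrading (by omega) (SetLike.mul_mem_graded ha ha')
          (SetLike.mul_mem_graded hb hb')
  toDecomposition := (tensorGrading_isInternal (DirectSum.Decomposition.isInternal 𝓡₁)
    (DirectSum.Decomposition.isInternal 𝓡₂)).chooseDecomposition

namespace GrMod

/-- The action of `R₁ ⊗ R₂` on `M ⊗ N`, given by `(r ⊗ s) • (x ⊗ y) = (r • x) ⊗ (s • y)`. -/
def tensorAction (M : GrMod 𝓡₁) (N : GrMod 𝓡₂) :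
    R₁ ⊗[K] R₂ →ₐ[K] Module.End K (M ⊗[K] N) :=
  (Module.endTensorEndAlgHom (R := K) (S := K) (A := K) (M := M) (N := N)).comp
    (Algebra.TensorProduct.map (Algebra.lsmul K K M) (Algebra.lsmul K K N))

theorem tensorAction_tmul (M : GrMod 𝓡₁) (N : GrMod 𝓡₂) (r : R₁) (s : R₂) (x : M) (y : N) :
    tensorAction M N (r ⊗ₜ s) (x ⊗ₜ y) = (r • x) ⊗ₜ (s • y) := rfl

/-- The tensor product over `K` of a graded `R₁`-module and a graded `R₂`-module, as a graded
module over `R₁ ⊗ R₂`. -/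
def tensorObj (M : GrMod 𝓡₁) (N : GrMod 𝓡₂) : GrMod (tensorGrading 𝓡₁ 𝓡₂) where
  carrier := M ⊗[K] N
  module := moduleOfAlgHom (tensorAction M N)
  isScalarTower := moduleOfAlgHom_isScalarTower (tensorAction M N)
  grading := tensorGrading M.grading N.grading
  isInternal := tensorGrading_isInternal M.isInternal N.isInternal
  smul_mem' := by
    intro m n x y hx hy
    change tensorAction M N x y ∈ _
    induction hx using Submodule.span_induction with
    | zero => rw [map_zero]; exact zero_mem _
    | add x x' _ _ hx hx' => rw [map_add]; exact add_mem hx hx'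
    | smul k x _ hx => rw [map_smul]; exact Submodule.smul_mem _ k hx
    | mem x hx =>
      obtain ⟨p, q, h, a, ha, b, hb, rfl⟩ := hx
      induction hy using Submodule.span_induction with
      | zero => rw [map_zero]; exact zero_mem _
      | add x x' _ _ hx hx' => rw [map_add]; exact add_mem hx hx'
      | smul k x _ hx => rw [map_smul]; exact Submodule.smul_mem _ k hx
      | mem y hy =>
        obtain ⟨p', q', h', a', ha', b', hb', rfl⟩ := hy
        rw [tensorAction_tmul]
        exact tmul_mem_tensorGrading (by omega) (M.smul_mem' ha ha') (N.smul_mem' hb hb')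

/-- The element `x ⊗ y` of the tensor product. -/
def tmul {M : GrMod 𝓡₁} {N : GrMod 𝓡₂} (x : M) (y : N) : tensorObj M N := x ⊗ₜ[K] y

theorem tmul_mem {M : GrMod 𝓡₁} {N : GrMod 𝓡₂} {p q n : ℤ} (h : p + q = n) {x : M} {y : N}
    (hx : x ∈ M.grading p) (hy : y ∈ N.grading q) : tmul x y ∈ (tensorObj M N).grading n :=
  tmul_mem_tensorGrading h hx hy

/-- The `K`-linear map underlying `f ⊗ g`. -/
def tensorLin {M M' : GrMod 𝓡₁} {N N' : GrMod 𝓡₂} (f : M ⟶ M') (g : N ⟶ N') :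
    M ⊗[K] N →ₗ[K] M' ⊗[K] N' :=
  TensorProduct.map ((lin f).restrictScalars K) ((lin g).restrictScalars K)

/-- The tensor product of two morphisms. -/
def tensorMap {M M' : GrMod 𝓡₁} {N N' : GrMod 𝓡₂} (f : M ⟶ M') (g : N ⟶ N') :
    tensorObj M N ⟶ tensorObj M' N' :=
  ofLin
    { toFun := tensorLin f g
      map_add' := fun x y => map_add (tensorLin f g) x y
      map_smul' := fun r x => by
        change tensorLin f g (tensorAction M N r x) = tensorAction M' N' r (tensorLin f g x)
        induction x using TensorProduct.induction_on with
        | zero => simp only [map_zero]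
        | add x y hx hy => simp only [map_add, hx, hy]
        | tmul x y =>
          induction r using TensorProduct.induction_on with
          | zero => simp only [map_zero, LinearMap.zero_apply]
          | add r s hr hs => simp only [map_add, LinearMap.add_apply, hr, hs]
          | tmul r s =>
            rw [tensorAction_tmul]
            change lin f (r • x) ⊗ₜ[K] lin g (s • y) = (r • lin f x) ⊗ₜ[K] (s • lin g y)
            rw [map_smul, map_smul] }
    (by
      intro p x hx
      change tensorLin f g x ∈ tensorGrading M'.grading N'.grading p
      refine Submodule.span_induction
        (p := fun x _ => tensorLin f g x ∈ tensorGrading M'.grading N'.grading p) ?_ ?_ ?_ ?_ hx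
      · rintro _ ⟨p, q, h, a, ha, b, hb, rfl⟩
        exact tmul_mem_tensorGrading h (lin_mem f ha) (lin_mem g hb)
      · rw [map_zero]; exact zero_mem _
      · intro x y _ _ hx hy; rw [map_add]; exact add_mem hx hy
      · intro k x _ hx; rw [map_smul]; exact Submodule.smul_mem _ k hx)

theorem tensorMap_tmul {M M' : GrMod 𝓡₁} {N N' : GrMod 𝓡₂} (f : M ⟶ M') (g : N ⟶ N')
    (x : M) (y : N) : lin (tensorMap f g) (tmul x y) = tmul (lin f x) (lin g y) := rfl

theorem tensor_hom_ext {M : GrMod 𝓡₁} {N : GrMod 𝓡₂} {P : GrMod (tensorGrading 𝓡₁ 𝓡₂)}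
    {f g : tensorObj M N ⟶ P} (h : ∀ x y, lin f (tmul x y) = lin g (tmul x y)) : f = g := by
  ext x
  have hx : ∀ x : M ⊗[K] N, lin f x = lin g x := by
    intro x
    induction x using TensorProduct.induction_on with
    | zero => exact (map_zero (lin f)).trans (map_zero (lin g)).symm
    | add x y hx hy =>
      exact (map_add (lin f) x y).trans ((congrArg₂ _ hx hy).trans (map_add (lin g) x y).symm)
    | tmul x y => exact h x y
  exact hx x

theorem tensorMap_id (M : GrMod 𝓡₁) (N : GrMod 𝓡₂) :
    tensorMap (𝟙 M) (𝟙 N) = 𝟙 (tensorObj M N) :=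
  tensor_hom_ext fun _ _ => rfl

theorem tensorMap_comp {M M' M'' : GrMod 𝓡₁} {N N' N'' : GrMod 𝓡₂} (f : M ⟶ M') (f' : M' ⟶ M'')
    (g : N ⟶ N') (g' : N' ⟶ N'') :
    tensorMap (f ≫ f') (g ≫ g') = tensorMap f g ≫ tensorMap f' g' :=
  tensor_hom_ext fun _ _ => rfl

variable (𝓡₁) in
/-- The functor `M ↦ M ⊗ N`. -/
def tensorWith (N : GrMod 𝓡₂) : GrMod 𝓡₁ ⥤ GrMod (tensorGrading 𝓡₁ 𝓡₂) where
  obj M := tensorObj M N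
  map f := tensorMap f (𝟙 N)
  map_id M := tensorMap_id M N
  map_comp _ _ := tensor_hom_ext fun _ _ => rfl

variable (𝓡₂) in
/-- The functor `N ↦ M ⊗ N`. -/
def withTensor (M : GrMod 𝓡₁) : GrMod 𝓡₂ ⥤ GrMod (tensorGrading 𝓡₁ 𝓡₂) where
  obj N := tensorObj M N
  map g := tensorMap (𝟙 M) g
  map_id N := tensorMap_id M N
  map_comp _ _ := tensor_hom_ext fun _ _ => rfl

instance (N : GrMod 𝓡₂) : (tensorWith 𝓡₁ N).Additive where
  map_add := tensor_hom_ext fun _ _ => TensorProduct.add_tmul _ _ _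

instance (M : GrMod 𝓡₁) : (withTensor 𝓡₂ M).Additive where
  map_add := tensor_hom_ext fun _ _ => TensorProduct.tmul_add _ _ _

end GrMod

end

namespace GrMod

section

variable {K R : Type u} [Field K] [CommRing R] [Algebra K R] {𝓡 : ℤ → Submodule K R}

theorem shortExact_iff (S : ShortComplex (GrMod 𝓡)) : S.ShortExact ↔
    Function.Injective (lin S.f) ∧ Function.Exact (lin S.f) (lin S.g) ∧
      Function.Surjective (lin S.g) := by
  constructor
  · intro hS
    have := hS.mono_f
    have := hS.epi_g
    refine ⟨injective_of_mono S.f, fun x => ⟨fun hx => ?_, ?_⟩, surjective_of_epi S.g⟩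
    · let k := S.X₂.subι _ (ker_isHomog S.g)
      obtain ⟨l, hl⟩ := KernelFork.IsLimit.lift' hS.fIsKernel k (by ext y; exact y.2)
      exact ⟨lin l (⟨x, hx⟩ : LinearMap.ker (lin S.g)),
        LinearMap.congr_fun (congrArg lin hl) (⟨x, hx⟩ : LinearMap.ker (lin S.g))⟩
    · rintro ⟨y, rfl⟩
      exact LinearMap.congr_fun (congrArg lin S.zero) y
  · rintro ⟨hf, hfg, hg⟩
    have := mono_of_injective S.f hf
    have := epi_of_surjective S.g hg
    exact ⟨S.exact_of_f_is_kernel (isKernel S.f S.g S.zero hf fun x hx => (hfg x).1 hx)⟩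

end

variable {K R₁ R₂ : Type u} [Field K] [CommRing R₁] [CommRing R₂] [Algebra K R₁] [Algebra K R₂]
variable {𝓡₁ : ℤ → Submodule K R₁} {𝓡₂ : ℤ → Submodule K R₂}

theorem tensorWith_exact (N : GrMod 𝓡₂) :
    PreservesFiniteLimits (tensorWith 𝓡₁ N) ∧ PreservesFiniteColimits (tensorWith 𝓡₁ N) := by
  refine ((Functor.exact_tfae (tensorWith 𝓡₁ N)).out 0 3).1 fun S hS => ?_
  rw [shortExact_iff] at hS ⊢
  obtain ⟨hf, hfg, hg⟩ := hS
  exact ⟨Module.Flat.rTensor_preserves_injective_linearMap (M := N)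
      ((lin S.f).restrictScalars K) hf,
    rTensor_exact (f := (lin S.f).restrictScalars K) (g := (lin S.g).restrictScalars K) N hfg hg,
    LinearMap.rTensor_surjective N (g := (lin S.g).restrictScalars K) hg⟩

theorem withTensor_exact (M : GrMod 𝓡₁) :
    PreservesFiniteLimits (withTensor 𝓡₂ M) ∧ PreservesFiniteColimits (withTensor 𝓡₂ M) := by
  refine ((Functor.exact_tfae (withTensor 𝓡₂ M)).out 0 3).1 fun S hS => ?_
  rw [shortExact_iff] at hS ⊢
  obtain ⟨hf, hfg, hg⟩ := hS
  exact ⟨Module.Flat.lTensor_preserves_injective_linearMap (M := M)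
      ((lin S.f).restrictScalars K) hf,
    lTensor_exact (f := (lin S.f).restrictScalars K) (g := (lin S.g).restrictScalars K) M hfg hg,
    LinearMap.lTensor_surjective M (g := (lin S.g).restrictScalars K) hg⟩

instance (N : GrMod 𝓡₂) : PreservesFiniteLimits (tensorWith 𝓡₁ N) := (tensorWith_exact N).1
instance (N : GrMod 𝓡₂) : PreservesFiniteColimits (tensorWith 𝓡₁ N) := (tensorWith_exact N).2
instance (M : GrMod 𝓡₁) : PreservesFiniteLimits (withTensor 𝓡₂ M) := (withTensor_exact M).1
instance (M : GrMod 𝓡₁) : PreservesFiniteColimits (withTensor 𝓡₂ M) := (withTensor_exact M).2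

/-- The canonical morphism `M(p) ⊗ N(q) ⟶ (M ⊗ N)(p + q)`, which is the identity on elements. -/
def shiftTensor (M : GrMod 𝓡₁) (N : GrMod 𝓡₂) (p q : ℤ) :
    tensorObj (M.shift p) (N.shift q) ⟶ (tensorObj M N).shift (p + q) :=
  ofLin
    { toFun := fun x => x
      map_add' := fun _ _ => rfl
      map_smul' := fun _ _ => rfl }
    (by
      intro n x hx
      have hle : tensorGrading (V := M) (W := N) (M.shift p).grading (N.shift q).grading n ≤
          tensorGrading (V := M) (W := N) M.grading N.grading (n + (p + q)) := by
        refine Submodule.span_mono ?_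
        rintro _ ⟨a, b, h, v, hv, w, hw, rfl⟩
        exact ⟨a + p, b + q, by omega, v, hv, w, hw, rfl⟩
      exact hle hx)

/-- The class `x ⊗ N ∈ Ext^i(L ⊗ N, M ⊗ N)` obtained from `x ∈ Ext^i(L, M)` by applying the exact
functor `- ⊗ N`. -/
def extTensorRight [GradedAlgebra 𝓡₁] [GradedAlgebra 𝓡₂] {i : ℕ} {L M : GrMod 𝓡₁}
    (x : Abelian.Ext.{u} L M i) (N : GrMod 𝓡₂) :
    Abelian.Ext.{u} (tensorObj L N) (tensorObj M N) i :=
  Abelian.Ext.mapExactFunctor (tensorWith 𝓡₁ N) x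

/-- The class `M ⊗ y ∈ Ext^j(M ⊗ L, M ⊗ N)` obtained from `y ∈ Ext^j(L, N)` by applying the exact
functor `M ⊗ -`. -/
def extTensorLeft [GradedAlgebra 𝓡₁] [GradedAlgebra 𝓡₂] {j : ℕ} (M : GrMod 𝓡₁) {L N : GrMod 𝓡₂}
    (y : Abelian.Ext.{u} L N j) : Abelian.Ext.{u} (tensorObj M L) (tensorObj M N) j :=
  Abelian.Ext.mapExactFunctor (withTensor 𝓡₂ M) y

/-- The external product of `x ∈ Ext^i(N₁, M₁(p))` and `y ∈ Ext^j(N₂, M₂(q))`, an element of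
`Ext^k(N₁ ⊗ N₂, (M₁ ⊗ M₂)(p + q))` for `k = i + j`. It is the Yoneda product of
`x ⊗ N₂ ∈ Ext^i(N₁ ⊗ N₂, M₁(p) ⊗ N₂)` and `M₁(p) ⊗ y ∈ Ext^j(M₁(p) ⊗ N₂, M₁(p) ⊗ M₂(q))`. -/
def extProd [GradedAlgebra 𝓡₁] [GradedAlgebra 𝓡₂] {i j k : ℕ} (h : i + j = k)
    {N₁ M₁ : GrMod 𝓡₁} {N₂ M₂ : GrMod 𝓡₂} {p q : ℤ} (x : ExtPiece i N₁ M₁ p)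
    (y : ExtPiece j N₂ M₂ q) : ExtPiece k (tensorObj N₁ N₂) (tensorObj M₁ M₂) (p + q) :=
  ((extTensorRight x N₂).comp (extTensorLeft (M₁.shift p) y) h).comp
    (Abelian.Ext.mk₀ (shiftTensor M₁ M₂ p q)) (add_zero k)

/-- The pairs `(i, j)` of natural numbers with `i + j = k`. -/
abbrev Bidegree (k : ℕ) : Type := {ij : ℕ × ℕ // ij.1 + ij.2 = k}

instance (k : ℕ) : Finite (Bidegree k) :=
  Set.Finite.to_subtype (s := {ij : ℕ × ℕ | ij.1 + ij.2 = k})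
    (((Set.finite_Iic k).prod (Set.finite_Iic k)).subset fun ij (h : ij.1 + ij.2 = k) =>
      ⟨show ij.1 ≤ k by omega, show ij.2 ≤ k by omega⟩)

/-- The direct sum `⨁_{i + j = k} Ext^i(N₁, M₁) ⊗ Ext^j(N₂, M₂)`. -/
abbrev extSum [GradedAlgebra 𝓡₁] [GradedAlgebra 𝓡₂] (k : ℕ) (N₁ M₁ : GrMod 𝓡₁)
    (N₂ M₂ : GrMod 𝓡₂) : GrMod (tensorGrading 𝓡₁ 𝓡₂) :=
  biproduct fun ij : Bidegree k => tensorObj (gExt ij.1.1 N₁ M₁) (gExt ij.1.2 N₂ M₂)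

/-- The map `extSum k N₁ M₁ N₂ M₂ ⟶ extSum k N₁' M₁' N₂' M₂'` induced by morphisms. -/
abbrev extSumMap [GradedAlgebra 𝓡₁] [GradedAlgebra 𝓡₂] (k : ℕ) {N₁ N₁' M₁ M₁' : GrMod 𝓡₁}
    {N₂ N₂' M₂ M₂' : GrMod 𝓡₂} (f₁ : N₁' ⟶ N₁) (g₁ : M₁ ⟶ M₁') (f₂ : N₂' ⟶ N₂)
    (g₂ : M₂ ⟶ M₂') : extSum k N₁ M₁ N₂ M₂ ⟶ extSum k N₁' M₁' N₂' M₂' :=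
  biproduct.map fun ij => tensorMap (gExtMap ij.1.1 f₁ g₁) (gExtMap ij.1.2 f₂ g₂)

/-- The element `x ⊗ y` of the direct sum `⨁_{i + j = k} Ext^i(N₁, M₁) ⊗ Ext^j(N₂, M₂)`, for
homogeneous `x ∈ Ext^i(N₁, M₁)_p` and `y ∈ Ext^j(N₂, M₂)_q`. -/
def extSumTmul [GradedAlgebra 𝓡₁] [GradedAlgebra 𝓡₂] {k : ℕ} (ij : Bidegree k) {N₁ M₁ : GrMod 𝓡₁}
    {N₂ M₂ : GrMod 𝓡₂} {p q : ℤ} (x : ExtPiece ij.1.1 N₁ M₁ p) (y : ExtPiece ij.1.2 N₂ M₂ q) :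
    extSum k N₁ M₁ N₂ M₂ :=
  lin (biproduct.ι (fun ij : Bidegree k => tensorObj (gExt ij.1.1 N₁ M₁) (gExt ij.1.2 N₂ M₂)) ij)
    (tmul (extι ij.1.1 N₁ M₁ p x) (extι ij.1.2 N₂ M₂ q y))

/-- The direct sum `⨁_{i + j = k} H^i(M₁) ⊗ H^j(M₂)` of tensor products of local cohomology
modules. -/
abbrev lcSum [GradedAlgebra 𝓡₁] [GradedAlgebra 𝓡₂] (k : ℕ) (M₁ : GrMod 𝓡₁) (M₂ : GrMod 𝓡₂) :
    GrMod (tensorGrading 𝓡₁ 𝓡₂) :=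
  biproduct fun ij : Bidegree k =>
    tensorObj ((localCohomology 𝓡₁ ij.1.1).obj M₁) ((localCohomology 𝓡₂ ij.1.2).obj M₂)

/-- The map `lcSum k M₁ M₂ ⟶ lcSum k M₁' M₂'` induced by morphisms. -/
abbrev lcSumMap [GradedAlgebra 𝓡₁] [GradedAlgebra 𝓡₂] (k : ℕ) {M₁ M₁' : GrMod 𝓡₁}
    {M₂ M₂' : GrMod 𝓡₂} (g₁ : M₁ ⟶ M₁') (g₂ : M₂ ⟶ M₂') : lcSum k M₁ M₂ ⟶ lcSum k M₁' M₂' :=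
  biproduct.map fun ij =>
    tensorMap ((localCohomology 𝓡₁ ij.1.1).map g₁) ((localCohomology 𝓡₂ ij.1.2).map g₂)

/-- The canonical map from `⨁ Ext^i(R₁ / 𝔪₁ ^ t, M₁) ⊗ Ext^j(R₂ / 𝔪₂ ^ t, M₂)` to
`⨁ H^i(M₁) ⊗ H^j(M₂)`, where `i + j = k`. -/
abbrev extSumToLcSum [GradedAlgebra 𝓡₁] [GradedAlgebra 𝓡₂] (k t : ℕ) (M₁ : GrMod 𝓡₁)
    (M₂ : GrMod 𝓡₂) : extSum k (quotPow 𝓡₁ t) M₁ (quotPow 𝓡₂ t) M₂ ⟶ lcSum k M₁ M₂ :=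
  biproduct.map fun ij =>
    tensorMap (toLocalCohomology 𝓡₁ ij.1.1 t M₁) (toLocalCohomology 𝓡₂ ij.1.2 t M₂)

end GrMod

end

noncomputable section

/-! ### Naturality of the maps on `Ext` induced by exact functors -/

section

open Abelian

variable {C D : Type*} [Category C] [Category D] [Abelian C] [Abelian D]
  [HasExt.{u} C] [HasExt.{u} D]

/-! Everything rests on the exactness of the tensor product over the field `K`. Exact functors act
on `Ext`, so classes `x` and `y` yield `x ⊗ N₂` and `M₁ ⊗ y`, whose Yoneda product is the external
product. Its naturality comes down to the fact that natural transformations of exact functors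
commute with the induced maps on `Ext` (`mapExactFunctor_naturality`), which is proved by dimension
shifting. Multiplication by a homogeneous ring element is a morphism between shifts of a module, so
`R`-linearity is an instance of the same naturality (`extProd_extPieceMap`).

For local cohomology the key is a Künneth theorem for `Ext`: over noetherian `R₁`, `R₂`, the map
`τ_k` is an isomorphism for finitely generated `N₁`, `N₂` and arbitrary `M₁`, `M₂`
(`isIso_extSumProd`). As functions of one of the `N`'s, source and target have long exact sequences,
the source because tensoring with a vector space is exact. A transformation that respects these
sequences and is bijective on the modules `R(p)` is bijective on all finitely generated modules, by
the five lemma and induction on the degree (`bijective_of_finite`). This is applied twice. For `N₁ =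
R₁(p)` only `Hom(N₁, M₁) ⊗ Ext^k(N₂, M₂)` survives, and the argument runs over `N₂`; its base case
`R₁(p) ⊗ R₂(q)` is free of rank one, where higher `Ext` vanishes and `Hom` is evaluation at the
generator. Then the argument runs over `N₁`.

Finally `N₁ = R₁ / 𝔪₁ ^ t` and `N₂ = R₂ / 𝔪₂ ^ t`, and `t` tends to infinity. Tensor products
commute with sequential colimits, so the sources tend to the sum of the `H^i ⊗ H^j`. The targets
tend to `H^k_𝔪`, because `𝔪 ^ (2t) ⊆ 𝔪₁ ^ t R + 𝔪₂ ^ t R ⊆ 𝔪 ^ t` and the quotient of `R` by the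
middle ideal is `R₁ / 𝔪₁ ^ t ⊗ R₂ / 𝔪₂ ^ t` (`isSeqColimit_gExt_tensor_quotPow`). -/

theorem exists_eq_extClass_comp [EnoughProjectives C] {X Y : C} {n : ℕ} (x : Ext.{u} X Y (n + 1)) :
    ∃ (Z P : C) (f : Z ⟶ P) (g : P ⟶ X) (w : f ≫ g = 0)
      (hS : (ShortComplex.mk f g w).ShortExact) (y : Ext.{u} Z Y n),
      hS.extClass.comp y (add_comm 1 n) = x := by
  have hS : (ShortComplex.mk (kernel.ι (Projective.π X)) (Projective.π X)
      (kernel.condition _)).ShortExact :=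
    { exact := ShortComplex.exact_of_f_is_kernel _ (kernelIsKernel _)
      mono_f := equalizer.ι_mono
      epi_g := inferInstanceAs (Epi (Projective.π X)) }
  -- Dimension shifting: pulled back to the projective object over `X`, the class `x` has positive
  -- degree and therefore vanishes, so it comes from the kernel through the connecting map.
  obtain ⟨y, hy⟩ := Ext.contravariant_sequence_exact₃ hS Y x
    (Ext.eq_zero_of_projective (P := Projective.over X) _) (add_comm 1 n)
  exact ⟨_, _, _, _, _, hS, y, hy⟩

/-- Pasting of two commutative squares whose horizontal arrows are `Ext` classes and whose vertical
arrows are morphisms. -/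
theorem comp_square_succ {X X' Z Z' Y Y' : C} {a b c : ℕ} (h : a + b = c) {e : Ext.{u} X Z a}
    {e' : Ext.{u} X' Z' a} {y : Ext.{u} Z Y b} {y' : Ext.{u} Z' Y' b} {f : X ⟶ X'} {g : Z ⟶ Z'}
    {k : Y ⟶ Y'}
    (h₁ : e.comp (Ext.mk₀ g) (add_zero a) = (Ext.mk₀ f).comp e' (zero_add a))
    (h₂ : y.comp (Ext.mk₀ k) (add_zero b) = (Ext.mk₀ g).comp y' (zero_add b)) :
    (e.comp y h).comp (Ext.mk₀ k) (add_zero c) = (Ext.mk₀ f).comp (e'.comp y' h) (zero_add c) := by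
  rw [Ext.comp_assoc_of_third_deg_zero, h₂, ← Ext.comp_assoc_of_second_deg_zero, h₁,
    Ext.comp_assoc _ _ _ (zero_add a) h (by omega)]

/-- In degree zero this is naturality of `η`. A class of higher degree factors as an extension class
followed by a class of lower degree, and extension classes are natural in the short exact sequence,
to which `η` gives a morphism. -/
theorem mapExactFunctor_naturality [EnoughProjectives C] {F G : C ⥤ D} [F.Additive]
    [PreservesFiniteLimits F] [PreservesFiniteColimits F] [G.Additive] [PreservesFiniteLimits G]
    [PreservesFiniteColimits G] (η : F ⟶ G) {X Y : C} {n : ℕ} (x : Ext.{u} X Y n) :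
    (x.mapExactFunctor F).comp (Ext.mk₀ (η.app Y)) (add_zero n) =
      (Ext.mk₀ (η.app X)).comp (x.mapExactFunctor G) (zero_add n) := by
  induction n generalizing X with
  | zero =>
    obtain ⟨f, rfl⟩ := (Ext.mk₀_bijective X Y).2 x
    simp [Ext.mapExactFunctor_mk₀]
  | succ n ih =>
    obtain ⟨Z, P, f, g, w, hS, y, rfl⟩ := exists_eq_extClass_comp x
    have key := ShortComplex.ShortExact.extClass_naturality (hS.map_of_exact F)
      (hS.map_of_exact G) ((ShortComplex.mk f g w).mapNatTrans η)
    rw [Ext.mapExactFunctor_comp, Ext.mapExactFunctor_comp, Ext.mapExactFunctor_extClass,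
      Ext.mapExactFunctor_extClass]
    exact comp_square_succ (add_comm 1 n) key (ih y)

end

/-! ### The functors `- ⊗ N` and `M ⊗ -` on `Ext` classes -/

namespace GrMod

open Abelian

variable {K R₁ R₂ : Type u} [Field K] [CommRing R₁] [CommRing R₂] [Algebra K R₁] [Algebra K R₂]
variable {𝓡₁ : ℤ → Submodule K R₁} {𝓡₂ : ℤ → Submodule K R₂}

variable (𝓡₁) in
/-- The natural transformation `- ⊗ N ⟶ - ⊗ N'` induced by a morphism `N ⟶ N'`. -/
def tensorWithMap {N N' : GrMod 𝓡₂} (g : N ⟶ N') : tensorWith 𝓡₁ N ⟶ tensorWith 𝓡₁ N' where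
  app M := tensorMap (𝟙 M) g
  naturality _ _ _ := tensor_hom_ext fun _ _ => rfl

variable (𝓡₂) in
/-- The natural transformation `M ⊗ - ⟶ M' ⊗ -` induced by a morphism `M ⟶ M'`. -/
def withTensorMap {M M' : GrMod 𝓡₁} (f : M ⟶ M') : withTensor 𝓡₂ M ⟶ withTensor 𝓡₂ M' where
  app N := tensorMap f (𝟙 N)
  naturality _ _ _ := tensor_hom_ext fun _ _ => rfl

instance (N : GrMod 𝓡₂) : (tensorWith 𝓡₁ N).Linear K where
  map_smul f k := tensor_hom_ext fun x y => by
    change (algebraMap K R₁ k • lin f x) ⊗ₜ[K] y = algebraMap K (R₁ ⊗[K] R₂) k • tmul (lin f x) y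
    rw [algebraMap_smul, algebraMap_smul]
    rfl

instance (M : GrMod 𝓡₁) : (withTensor 𝓡₂ M).Linear K where
  map_smul f k := tensor_hom_ext fun x y => by
    change x ⊗ₜ[K] (algebraMap K R₂ k • lin f y) = algebraMap K (R₁ ⊗[K] R₂) k • tmul x (lin f y)
    rw [algebraMap_smul, algebraMap_smul, TensorProduct.tmul_smul]
    rfl

variable [GradedAlgebra 𝓡₁] [GradedAlgebra 𝓡₂]

theorem extTensorRight_mk₀ {L M : GrMod 𝓡₁} (f : L ⟶ M) (N : GrMod 𝓡₂) :
    extTensorRight (Ext.mk₀ f) N = Ext.mk₀ (tensorMap f (𝟙 N)) :=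
  Ext.mapExactFunctor_mk₀ _ _

theorem extTensorLeft_mk₀ {L N : GrMod 𝓡₂} (M : GrMod 𝓡₁) (g : L ⟶ N) :
    extTensorLeft M (Ext.mk₀ g) = Ext.mk₀ (tensorMap (𝟙 M) g) :=
  Ext.mapExactFunctor_mk₀ _ _

theorem extTensorRight_comp {a b c : ℕ} (h : a + b = c) {L M P : GrMod 𝓡₁}
    (x : Ext.{u} L M a) (y : Ext.{u} M P b) (N : GrMod 𝓡₂) :
    extTensorRight (x.comp y h) N = (extTensorRight x N).comp (extTensorRight y N) h :=
  Ext.mapExactFunctor_comp _ _ _ _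

theorem extTensorLeft_comp {a b c : ℕ} (h : a + b = c) (M : GrMod 𝓡₁) {L N P : GrMod 𝓡₂}
    (x : Ext.{u} L N a) (y : Ext.{u} N P b) :
    extTensorLeft M (x.comp y h) = (extTensorLeft M x).comp (extTensorLeft M y) h :=
  Ext.mapExactFunctor_comp _ _ _ _

/-- A morphism in one tensor factor slides past a class in the other factor without a sign. -/
theorem extTensorRight_naturality {i : ℕ} {L M : GrMod 𝓡₁} (x : Ext.{u} L M i) {N N' : GrMod 𝓡₂}
    (g : N ⟶ N') :
    (extTensorRight x N).comp (Ext.mk₀ (tensorMap (𝟙 M) g)) (add_zero i) =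
      (Ext.mk₀ (tensorMap (𝟙 L) g)).comp (extTensorRight x N') (zero_add i) :=
  mapExactFunctor_naturality (tensorWithMap 𝓡₁ g) x

theorem extTensorLeft_naturality {j : ℕ} {M M' : GrMod 𝓡₁} (f : M ⟶ M') {L N : GrMod 𝓡₂}
    (y : Ext.{u} L N j) :
    (extTensorLeft M y).comp (Ext.mk₀ (tensorMap f (𝟙 N))) (add_zero j) =
      (Ext.mk₀ (tensorMap f (𝟙 L))).comp (extTensorLeft M' y) (zero_add j) :=
  mapExactFunctor_naturality (withTensorMap 𝓡₂ f) y

end GrMod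

namespace GrMod

open Abelian

variable {K R₁ R₂ : Type u} [Field K] [CommRing R₁] [CommRing R₂] [Algebra K R₁] [Algebra K R₂]
variable {𝓡₁ : ℤ → Submodule K R₁} {𝓡₂ : ℤ → Submodule K R₂}
variable [GradedAlgebra 𝓡₁] [GradedAlgebra 𝓡₂]

/-! ### The external product of `Ext` classes -/

/-- The Yoneda product of `x ⊗ N₂` and `M₁ ⊗ y`. -/
def extCross {i j k : ℕ} (h : i + j = k) {N₁ M₁ : GrMod 𝓡₁} {N₂ M₂ : GrMod 𝓡₂}
    (x : Ext.{u} N₁ M₁ i) (y : Ext.{u} N₂ M₂ j) :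
    Ext.{u} (tensorObj N₁ N₂) (tensorObj M₁ M₂) k :=
  (extTensorRight x N₂).comp (extTensorLeft M₁ y) h

/-- The class `e` enters at the outer end of the Yoneda product, so associativity suffices, in every
degree and without a sign. -/
theorem extCross_comp_left {a i i' j k k' : ℕ} (ha : a + i = i') (h : i + j = k) (h' : i' + j = k')
    (hk : a + k = k') {L₁ N₁ M₁ : GrMod 𝓡₁} {N₂ M₂ : GrMod 𝓡₂} (e : Ext.{u} L₁ N₁ a)
    (x : Ext.{u} N₁ M₁ i) (y : Ext.{u} N₂ M₂ j) :
    extCross h' (e.comp x ha) y = (extTensorRight e N₂).comp (extCross h x y) hk := by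
  rw [extCross, extTensorRight_comp, Ext.comp_assoc _ _ _ ha h (by omega)]
  rfl

theorem extCross_comp_right {b i j j' k k' : ℕ} (hb : j + b = j') (h : i + j = k) (h' : i + j' = k')
    (hk : k + b = k') {N₁ M₁ : GrMod 𝓡₁} {N₂ M₂ P₂ : GrMod 𝓡₂}
    (x : Ext.{u} N₁ M₁ i) (y : Ext.{u} N₂ M₂ j) (e : Ext.{u} M₂ P₂ b) :
    extCross h' x (y.comp e hb) = (extCross h x y).comp (extTensorLeft M₁ e) hk := by
  rw [extCross, extTensorLeft_comp, ← Ext.comp_assoc _ _ _ h hb (by omega)]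
  rfl

/-- Here `g` stands between the two factors of the Yoneda product and has to slide past the class in
the second factor. -/
theorem extCross_comp_mk₀ {i j k : ℕ} (h : i + j = k) {N₁ M₁ P₁ : GrMod 𝓡₁} {N₂ M₂ : GrMod 𝓡₂}
    (x : Ext.{u} N₁ M₁ i) (g : M₁ ⟶ P₁) (y : Ext.{u} N₂ M₂ j) :
    extCross h (x.comp (Ext.mk₀ g) (add_zero i)) y =
      (extCross h x y).comp (Ext.mk₀ (tensorMap g (𝟙 M₂))) (add_zero k) := by
  rw [extCross, extTensorRight_comp, extTensorRight_mk₀, Ext.comp_assoc_of_second_deg_zero,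
    ← extTensorLeft_naturality, ← Ext.comp_assoc_of_third_deg_zero]
  rfl

theorem extCross_mk₀_comp {i j k : ℕ} (h : i + j = k) {N₁ M₁ : GrMod 𝓡₁} {L₂ N₂ M₂ : GrMod 𝓡₂}
    (x : Ext.{u} N₁ M₁ i) (g : L₂ ⟶ N₂) (y : Ext.{u} N₂ M₂ j) :
    extCross h x ((Ext.mk₀ g).comp y (zero_add j)) =
      (Ext.mk₀ (tensorMap (𝟙 N₁) g)).comp (extCross h x y) (zero_add k) := by
  rw [extCross, extTensorLeft_comp, extTensorLeft_mk₀, ← Ext.comp_assoc_of_second_deg_zero,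
    extTensorRight_naturality, Ext.comp_assoc _ _ _ (zero_add i) h (by omega)]
  rfl

/-- Exchanging `e` with a class `x` of positive degree would in general introduce a sign. For `x` of
degree zero, `x` is a morphism and naturality is enough; only this case is needed below. -/
theorem extCross_zero_comp {b j j' : ℕ} (hb : b + j = j') {N₁ M₁ : GrMod 𝓡₁}
    {L₂ N₂ M₂ : GrMod 𝓡₂} (x : Ext.{u} N₁ M₁ 0) (e : Ext.{u} L₂ N₂ b) (y : Ext.{u} N₂ M₂ j) :
    extCross (zero_add j') x (e.comp y hb) =
      (extTensorLeft N₁ e).comp (extCross (zero_add j) x y) hb := by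
  obtain ⟨f, rfl⟩ := (Ext.mk₀_bijective N₁ M₁).2 x
  rw [extCross, extCross, extTensorLeft_comp, extTensorRight_mk₀, extTensorRight_mk₀,
    ← Ext.comp_assoc _ _ _ (zero_add b) hb (by omega), ← extTensorLeft_naturality,
    Ext.comp_assoc_of_second_deg_zero]

theorem extCross_mk₀_mk₀ {N₁ M₁ : GrMod 𝓡₁} {N₂ M₂ : GrMod 𝓡₂} (f : N₁ ⟶ M₁) (g : N₂ ⟶ M₂) :
    extCross (zero_add 0) (Ext.mk₀ f) (Ext.mk₀ g) = Ext.mk₀ (tensorMap f g) := by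
  rw [extCross, extTensorRight_mk₀, extTensorLeft_mk₀, Ext.mk₀_comp_mk₀, ← tensorMap_comp,
    Category.comp_id, Category.id_comp]

theorem extProd_eq {i j k : ℕ} (h : i + j = k) {N₁ M₁ : GrMod 𝓡₁} {N₂ M₂ : GrMod 𝓡₂} {p q : ℤ}
    (x : ExtPiece i N₁ M₁ p) (y : ExtPiece j N₂ M₂ q) :
    extProd h x y = (extCross h x y).comp (Ext.mk₀ (shiftTensor M₁ M₂ p q)) (add_zero k) := rfl

/-- A common source of naturality and `R`-linearity: `g` may be a shift of `g₁ ⊗ g₂`, or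
multiplication by `r ⊗ s`. The target degree `n'` is only propositionally equal to `p' + q'`, hence
the comparison inside the total module through `extι`. -/
theorem extProd_extPieceMap {i j k : ℕ} (h : i + j = k) {N₁ N₁' M₁ M₁' : GrMod 𝓡₁}
    {N₂ N₂' M₂ M₂' : GrMod 𝓡₂} {p q p' q' n' : ℤ} (hn : p' + q' = n') (f₁ : N₁' ⟶ N₁)
    (g₁ : M₁.shift p ⟶ M₁'.shift p')
    (f₂ : N₂' ⟶ N₂) (g₂ : M₂.shift q ⟶ M₂'.shift q')
    (g : (tensorObj M₁ M₂).shift (p + q) ⟶ (tensorObj M₁' M₂').shift n')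
    (hg : ∀ x y, lin g (tmul x y) = tmul (lin g₁ x) (lin g₂ y))
    (x : ExtPiece i N₁ M₁ p) (y : ExtPiece j N₂ M₂ q) :
    extι k (tensorObj N₁' N₂') (tensorObj M₁' M₂') (p' + q')
        (extProd h (extPieceMap i f₁ g₁ x) (extPieceMap j f₂ g₂ y)) =
      extι k _ _ n' (extPieceMap k (tensorMap f₁ f₂) g (extProd h x y)) := by
  subst hn
  -- The canonical morphisms `shiftTensor` are the identity on elements, so this is exactly `hg`.
  have hg' : shiftTensor M₁ M₂ p q ≫ g = tensorMap g₁ g₂ ≫ shiftTensor M₁' M₂' p' q' :=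
    tensor_hom_ext fun x y => hg x y
  have e₁ : tensorMap f₁ f₂ = tensorMap f₁ (𝟙 N₂') ≫ tensorMap (𝟙 N₁) f₂ := by
    rw [← tensorMap_comp, Category.comp_id, Category.id_comp]
  have e₂ : tensorMap g₁ g₂ = tensorMap (𝟙 _) g₂ ≫ tensorMap g₁ (𝟙 _) := by
    rw [← tensorMap_comp, Category.comp_id, Category.id_comp]
  congr 1
  simp only [extPieceMap, LinearMap.coe_mk, AddHom.coe_mk, extProd_eq]
  rw [extCross_comp_mk₀, extCross_comp_left (zero_add i) h h (zero_add k),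
    extCross_comp_right (add_zero j) h h (add_zero k), extCross_mk₀_comp, extTensorRight_mk₀,
    extTensorLeft_mk₀]
  simp only [Ext.comp_assoc_of_third_deg_zero, Ext.mk₀_comp_mk₀, hg', e₁, e₂, Category.assoc]
  rw [← Ext.mk₀_comp_mk₀_assoc]

/-! ### The external product as a homomorphism of graded modules -/

theorem extTensorRight_add {i : ℕ} {L M : GrMod 𝓡₁} (x x' : Ext.{u} L M i) (N : GrMod 𝓡₂) :
    extTensorRight (x + x') N = extTensorRight x N + extTensorRight x' N :=
  Ext.mapExactFunctor_add _ _ _ _ _ _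

theorem extTensorRight_smul {i : ℕ} {L M : GrMod 𝓡₁} (c : K) (x : Ext.{u} L M i) (N : GrMod 𝓡₂) :
    extTensorRight (c • x) N = c • extTensorRight x N :=
  Functor.mapExactFunctor_smul _ _ _ _ _ _ _

theorem extTensorLeft_add {i : ℕ} (M : GrMod 𝓡₁) {L N : GrMod 𝓡₂} (y y' : Ext.{u} L N i) :
    extTensorLeft M (y + y') = extTensorLeft M y + extTensorLeft M y' :=
  Ext.mapExactFunctor_add _ _ _ _ _ _

theorem extTensorLeft_smul {i : ℕ} (M : GrMod 𝓡₁) {L N : GrMod 𝓡₂} (c : K) (y : Ext.{u} L N i) :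
    extTensorLeft M (c • y) = c • extTensorLeft M y :=
  Functor.mapExactFunctor_smul _ _ _ _ _ _ _

/-- The external product as a bilinear map. -/
def extProdLin {i j k : ℕ} (h : i + j = k) (N₁ M₁ : GrMod 𝓡₁) (N₂ M₂ : GrMod 𝓡₂) (p q : ℤ) :
    ExtPiece i N₁ M₁ p →ₗ[K] ExtPiece j N₂ M₂ q →ₗ[K]
      ExtPiece k (tensorObj N₁ N₂) (tensorObj M₁ M₂) (p + q) :=
  LinearMap.mk₂ K (extProd h)
    (fun x x' y => by
      simp only [extProd, extTensorRight_add, Ext.add_comp])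
    (fun c x y => by
      simp only [extProd, extTensorRight_smul, Ext.smul_comp])
    (fun x y y' => by
      simp only [extProd, extTensorLeft_add, Ext.comp_add, Ext.add_comp])
    (fun c x y => by
      simp only [extProd, extTensorLeft_smul, Ext.smul_comp, Ext.comp_smul])

section

variable {R : Type u} [CommRing R] [Algebra K R] {𝓡 : ℤ → Submodule K R} [GradedAlgebra 𝓡]

/-- The `K`-linear map out of `Ext^i(N, M)` given by linear maps on the components. -/
def gExtDesc (i : ℕ) (N M : GrMod 𝓡) {V : Type*} [AddCommGroup V] [Module K V]
    (f : ∀ p, ExtPiece i N M p →ₗ[K] V) : gExt i N M →ₗ[K] V :=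
  DirectSum.toModule K ℤ V f

theorem gExtDesc_ι (i : ℕ) (N M : GrMod 𝓡) {V : Type*} [AddCommGroup V] [Module K V]
    (f : ∀ p, ExtPiece i N M p →ₗ[K] V) (p : ℤ) (x : ExtPiece i N M p) :
    gExtDesc i N M f (extι i N M p x) = f p x :=
  DirectSum.toModule_lof _ _ _

theorem gExt_induction {i : ℕ} {N M : GrMod 𝓡} {P : gExt i N M → Prop} (z : gExt i N M) (h0 : P 0)
    (hadd : ∀ x y, P x → P y → P (x + y)) (h : ∀ p x, P (extι i N M p x)) : P z :=
  DirectSum.induction_on (motive := P) z h0 (fun p x => h p x) hadd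

theorem smul_extι (i : ℕ) (N M : GrMod 𝓡) (q : ℤ) (r : 𝓡 q) (p : ℤ) (x : ExtPiece i N M p) :
    (r : R) • extι i N M p x =
      extι i N M (q + p) (extPieceMap i (𝟙 N) (M.mulHom r p (q + p) rfl) x) :=
  extAction_lof i N M q r p x

end

/-- The external product `Ext^i(N₁, M₁) ⊗ Ext^j(N₂, M₂) → Ext^k(N₁ ⊗ N₂, M₁ ⊗ M₂)` as a
`K`-linear map. -/
def extProdTotal {i j k : ℕ} (h : i + j = k) (N₁ M₁ : GrMod 𝓡₁) (N₂ M₂ : GrMod 𝓡₂) :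
    gExt i N₁ M₁ ⊗[K] gExt j N₂ M₂ →ₗ[K] gExt k (tensorObj N₁ N₂) (tensorObj M₁ M₂) :=
  TensorProduct.lift <| gExtDesc i N₁ M₁ fun p => LinearMap.flip <|
    gExtDesc j N₂ M₂ fun q => LinearMap.flip <|
      (extProdLin h N₁ M₁ N₂ M₂ p q).compr₂ (extι k _ _ (p + q))

theorem extProdTotal_ι {i j k : ℕ} (h : i + j = k) (N₁ M₁ : GrMod 𝓡₁) (N₂ M₂ : GrMod 𝓡₂)
    (p q : ℤ) (x : ExtPiece i N₁ M₁ p) (y : ExtPiece j N₂ M₂ q) :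
    extProdTotal h N₁ M₁ N₂ M₂ (extι i N₁ M₁ p x ⊗ₜ extι j N₂ M₂ q y) =
      extι k (tensorObj N₁ N₂) (tensorObj M₁ M₂) (p + q) (extProd h x y) := by
  rw [extProdTotal, TensorProduct.lift.tmul, gExtDesc_ι, LinearMap.flip_apply, gExtDesc_ι,
    LinearMap.flip_apply, LinearMap.compr₂_apply]
  rfl

/-- Two linear maps on the tensor product of graded `Ext` modules agree if they agree on tensors of
homogeneous elements. -/
theorem gExt_tensor_induction {i j : ℕ} {N₁ M₁ : GrMod 𝓡₁} {N₂ M₂ : GrMod 𝓡₂}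
    {P : gExt i N₁ M₁ ⊗[K] gExt j N₂ M₂ → Prop}
    (z : gExt i N₁ M₁ ⊗[K] gExt j N₂ M₂) (h0 : P 0) (hadd : ∀ x y, P x → P y → P (x + y))
    (h : ∀ p q x y, P (extι i N₁ M₁ p x ⊗ₜ extι j N₂ M₂ q y)) :
    P z := by
  induction z using TensorProduct.induction_on with
  | zero => exact h0
  | add x y hx hy => exact hadd x y hx hy
  | tmul x y =>
    induction x using gExt_induction with
    | h0 => rwa [TensorProduct.zero_tmul]
    | hadd x x' hx hx' => rw [TensorProduct.add_tmul]; exact hadd _ _ hx hx'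
    | h p x =>
      induction y using gExt_induction with
      | h0 => rwa [TensorProduct.tmul_zero]
      | hadd y y' hy hy' => rw [TensorProduct.tmul_add]; exact hadd _ _ hy hy'
      | h q y => exact h p q x y

theorem tensorGrading_hom_induction {V W : Type*} [AddCommGroup V] [Module K V] [AddCommGroup W]
    [Module K W] {𝓥 : ℤ → Submodule K V} {𝓦 : ℤ → Submodule K W}
    (h𝓥 : DirectSum.IsInternal 𝓥) (h𝓦 : DirectSum.IsInternal 𝓦)
    {P : V ⊗[K] W → Prop} (z : V ⊗[K] W) (h0 : P 0) (hadd : ∀ x y, P x → P y → P (x + y))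
    (h : ∀ p q, ∀ v ∈ 𝓥 p, ∀ w ∈ 𝓦 q, P (v ⊗ₜ w)) : P z := by
  induction z using TensorProduct.induction_on with
  | zero => exact h0
  | add x y hx hy => exact hadd x y hx hy
  | tmul v w =>
    have hv : v ∈ ⨆ p, 𝓥 p := by rw [h𝓥.submodule_iSup_eq_top]; trivial
    have hw : w ∈ ⨆ p, 𝓦 p := by rw [h𝓦.submodule_iSup_eq_top]; trivial
    induction hv using Submodule.iSup_induction' with
    | zero => rwa [TensorProduct.zero_tmul]
    | add x x' _ _ hx hx' => rw [TensorProduct.add_tmul]; exact hadd _ _ hx hx'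
    | mem p v hv =>
      induction hw using Submodule.iSup_induction' with
      | zero => rwa [TensorProduct.tmul_zero]
      | add y y' _ _ hy hy' => rw [TensorProduct.tmul_add]; exact hadd _ _ hy hy'
      | mem q w hw => exact h p q v hv w hw

/-- By additivity everything may be taken homogeneous. Then scalars act through morphisms between
shifts, and linearity becomes naturality. -/
theorem extProdTotal_smul {i j k : ℕ} (h : i + j = k) (N₁ M₁ : GrMod 𝓡₁) (N₂ M₂ : GrMod 𝓡₂)
    (r : R₁ ⊗[K] R₂) (z : gExt i N₁ M₁ ⊗[K] gExt j N₂ M₂) :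
    extProdTotal h N₁ M₁ N₂ M₂ (tensorAction (gExt i N₁ M₁) (gExt j N₂ M₂) r z) =
      r • extProdTotal h N₁ M₁ N₂ M₂ z := by
  induction z using gExt_tensor_induction with
  | h0 => rw [map_zero, map_zero, smul_zero]
  | hadd x y hx hy => rw [map_add, map_add, map_add, hx, hy, smul_add]
  | h p q x y =>
    induction r using tensorGrading_hom_induction (DirectSum.Decomposition.isInternal 𝓡₁)
      (DirectSum.Decomposition.isInternal 𝓡₂) with
    | h0 => rw [map_zero, LinearMap.zero_apply, map_zero, zero_smul]
    | hadd r s hr hs => rw [map_add, LinearMap.add_apply, map_add, hr, hs, add_smul]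
    | h a b r hr s hs =>
      have e₁ := smul_extι i N₁ M₁ a ⟨r, hr⟩ p x
      have e₂ := smul_extι j N₂ M₂ b ⟨s, hs⟩ q y
      have e₃ := smul_extι k (tensorObj N₁ N₂) (tensorObj M₁ M₂) (a + b)
        ⟨r ⊗ₜ s, tmul_mem_tensorGrading rfl hr hs⟩ (p + q) (extProd h x y)
      dsimp only at e₁ e₂ e₃
      rw [tensorAction_tmul, e₁, e₂, extProdTotal_ι, extProdTotal_ι, e₃]
      -- The product of the multiplied classes lies in degree `(a + p) + (b + q)`, the multiple of
      -- the product in degree `(a + b) + (p + q)`.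
      refine (extProd_extPieceMap h (n' := a + b + (p + q)) (by omega) _ _ _ _
        ((tensorObj M₁ M₂).mulHom ⟨r ⊗ₜ s, tmul_mem_tensorGrading rfl hr hs⟩ (p + q) _ rfl)
        (fun _ _ => rfl) x y).trans ?_
      rw [tensorMap_id]

/-- The external product on graded `Ext` modules. -/
def gExtProd {i j k : ℕ} (h : i + j = k) (N₁ M₁ : GrMod 𝓡₁) (N₂ M₂ : GrMod 𝓡₂) :
    tensorObj (gExt i N₁ M₁) (gExt j N₂ M₂) ⟶ gExt k (tensorObj N₁ N₂) (tensorObj M₁ M₂) :=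
  ofLin
    { toFun := extProdTotal h N₁ M₁ N₂ M₂
      map_add' := fun x y => map_add (extProdTotal h N₁ M₁ N₂ M₂) x y
      map_smul' := extProdTotal_smul h N₁ M₁ N₂ M₂ }
    (by
      intro n z hz
      refine Submodule.span_induction (p := fun z _ => extProdTotal h N₁ M₁ N₂ M₂ z ∈
        (gExt k (tensorObj N₁ N₂) (tensorObj M₁ M₂)).grading n) ?_ ?_ ?_ ?_ hz
      · rintro _ ⟨p, q, rfl, _, ⟨x, rfl⟩, _, ⟨y, rfl⟩, rfl⟩
        exact ⟨_, (extProdTotal_ι h N₁ M₁ N₂ M₂ p q x y).symm⟩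
      · rw [map_zero]; exact zero_mem _
      · intro x y _ _ hx hy; rw [map_add]; exact add_mem hx hy
      · intro c x _ hx; rw [map_smul]; exact Submodule.smul_mem _ c hx)

theorem gExtProd_ι {i j k : ℕ} (h : i + j = k) (N₁ M₁ : GrMod 𝓡₁) (N₂ M₂ : GrMod 𝓡₂)
    (p q : ℤ) (x : ExtPiece i N₁ M₁ p) (y : ExtPiece j N₂ M₂ q) :
    lin (gExtProd h N₁ M₁ N₂ M₂) (tmul (extι i N₁ M₁ p x) (extι j N₂ M₂ q y)) =
      extι k (tensorObj N₁ N₂) (tensorObj M₁ M₂) (p + q) (extProd h x y) :=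
  extProdTotal_ι h N₁ M₁ N₂ M₂ p q x y

theorem gExt_tensor_hom_ext {i j : ℕ} {N₁ M₁ : GrMod 𝓡₁} {N₂ M₂ : GrMod 𝓡₂}
    {P : GrMod (tensorGrading 𝓡₁ 𝓡₂)}
    {f g : tensorObj (gExt i N₁ M₁) (gExt j N₂ M₂) ⟶ P}
    (h : ∀ p q x y, lin f (tmul (extι i N₁ M₁ p x) (extι j N₂ M₂ q y)) =
      lin g (tmul (extι i N₁ M₁ p x) (extι j N₂ M₂ q y))) : f = g := by
  ext z
  induction z using gExt_tensor_induction with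
  | h0 => exact (map_zero (lin f)).trans (map_zero (lin g)).symm
  | hadd x y hx hy =>
    exact (map_add (lin f) x y).trans ((congrArg₂ _ hx hy).trans (map_add (lin g) x y).symm)
  | h p q x y => exact h p q x y

theorem gExtProd_naturality {i j k : ℕ} (h : i + j = k) {N₁ N₁' M₁ M₁' : GrMod 𝓡₁}
    {N₂ N₂' M₂ M₂' : GrMod 𝓡₂} (f₁ : N₁' ⟶ N₁) (g₁ : M₁ ⟶ M₁') (f₂ : N₂' ⟶ N₂) (g₂ : M₂ ⟶ M₂') :
    tensorMap (gExtMap i f₁ g₁) (gExtMap j f₂ g₂) ≫ gExtProd h N₁' M₁' N₂' M₂' =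
      gExtProd h N₁ M₁ N₂ M₂ ≫ gExtMap k (tensorMap f₁ f₂) (tensorMap g₁ g₂) := by
  refine gExt_tensor_hom_ext fun p q x y => ?_
  simp only [lin_comp, LinearMap.comp_apply, tensorMap_tmul, gExtMap_ι, gExtProd_ι]
  exact extProd_extPieceMap h rfl f₁ _ f₂ _ (shiftMap (tensorMap g₁ g₂) (p + q))
    (fun _ _ => rfl) x y

/-- The external product on the direct sum `⨁_{i + j = k} Ext^i(N₁, M₁) ⊗ Ext^j(N₂, M₂)`. -/
def extSumProd (k : ℕ) (N₁ M₁ : GrMod 𝓡₁) (N₂ M₂ : GrMod 𝓡₂) :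
    extSum k N₁ M₁ N₂ M₂ ⟶ gExt k (tensorObj N₁ N₂) (tensorObj M₁ M₂) :=
  biproduct.desc fun ij : Bidegree k => gExtProd ij.2 N₁ M₁ N₂ M₂

theorem extSumProd_naturality (k : ℕ) {N₁ N₁' M₁ M₁' : GrMod 𝓡₁} {N₂ N₂' M₂ M₂' : GrMod 𝓡₂}
    (f₁ : N₁' ⟶ N₁) (g₁ : M₁ ⟶ M₁') (f₂ : N₂' ⟶ N₂) (g₂ : M₂ ⟶ M₂') :
    extSumMap k f₁ g₁ f₂ g₂ ≫ extSumProd k N₁' M₁' N₂' M₂' =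
      extSumProd k N₁ M₁ N₂ M₂ ≫ gExtMap k (tensorMap f₁ f₂) (tensorMap g₁ g₂) := by
  refine biproduct.hom_ext' _ _ fun ij => ?_
  rw [biproduct.ι_map_assoc, extSumProd, extSumProd, biproduct.ι_desc, biproduct.ι_desc_assoc,
    gExtProd_naturality]

theorem extSumProd_tmul (k : ℕ) (ij : Bidegree k) (N₁ M₁ : GrMod 𝓡₁) (N₂ M₂ : GrMod 𝓡₂) (p q : ℤ)
    (x : ExtPiece ij.1.1 N₁ M₁ p) (y : ExtPiece ij.1.2 N₂ M₂ q) :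
    lin (extSumProd k N₁ M₁ N₂ M₂) (extSumTmul ij x y) =
      extι k (tensorObj N₁ N₂) (tensorObj M₁ M₂) (p + q) (extProd ij.2 x y) := by
  have h := biproduct.ι_desc (fun ij : Bidegree k => gExtProd ij.2 N₁ M₁ N₂ M₂) ij
  exact (LinearMap.congr_fun (congrArg lin h) _).trans (gExtProd_ι ij.2 N₁ M₁ N₂ M₂ p q x y)

theorem extSumProd_zero (N₁ M₁ : GrMod 𝓡₁) (N₂ M₂ : GrMod 𝓡₂) (p q : ℤ)
    (f : N₁ ⟶ M₁.shift p) (g : N₂ ⟶ M₂.shift q) :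
    lin (extSumProd 0 N₁ M₁ N₂ M₂) (extSumTmul (k := 0) ⟨(0, 0), rfl⟩
        (Ext.mk₀ f) (Ext.mk₀ g)) =
      extι 0 (tensorObj N₁ N₂) (tensorObj M₁ M₂) (p + q)
        (Ext.mk₀ (tensorMap f g ≫ shiftTensor M₁ M₂ p q)) := by
  rw [extSumProd_tmul, extProd_eq, extCross_mk₀_mk₀, Ext.mk₀_comp_mk₀]

end GrMod

/-! ### Long exact sequences of vector spaces -/

/-- A long exact sequence `0 → A₃ 0 → A₂ 0 → A₁ 0 → A₃ 1 → A₂ 1 → ⋯`. -/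
structure LongExact (K : Type*) [Field K] (A₁ A₂ A₃ : ℕ → Type*) [∀ i, AddCommGroup (A₁ i)]
    [∀ i, AddCommGroup (A₂ i)] [∀ i, AddCommGroup (A₃ i)] [∀ i, Module K (A₁ i)]
    [∀ i, Module K (A₂ i)] [∀ i, Module K (A₃ i)] where
  g : ∀ i, A₃ i →ₗ[K] A₂ i
  f : ∀ i, A₂ i →ₗ[K] A₁ i
  δ : ∀ i, A₁ i →ₗ[K] A₃ (i + 1)
  inj : Function.Injective (g 0)
  exact₂ : ∀ i, Function.Exact (g i) (f i)
  exact₁ : ∀ i, Function.Exact (f i) (δ i)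
  exact₃ : ∀ i, Function.Exact (δ i) (g (i + 1))

namespace LongExact

section

variable {K : Type*} [Field K] {A₁ A₂ A₃ B₁ B₂ B₃ : ℕ → Type*} [∀ i, AddCommGroup (A₁ i)]
    [∀ i, AddCommGroup (A₂ i)] [∀ i, AddCommGroup (A₃ i)] [∀ i, Module K (A₁ i)]
    [∀ i, Module K (A₂ i)] [∀ i, Module K (A₃ i)] [∀ i, AddCommGroup (B₁ i)]
    [∀ i, AddCommGroup (B₂ i)] [∀ i, AddCommGroup (B₃ i)] [∀ i, Module K (B₁ i)]
    [∀ i, Module K (B₂ i)] [∀ i, Module K (B₃ i)]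

/-- Compatibility of linear maps with two long exact sequences. -/
structure IsHom (L : LongExact K A₁ A₂ A₃) (L' : LongExact K B₁ B₂ B₃)
    (φ₁ : ∀ i, A₁ i →ₗ[K] B₁ i) (φ₂ : ∀ i, A₂ i →ₗ[K] B₂ i) (φ₃ : ∀ i, A₃ i →ₗ[K] B₃ i) : Prop where
  comm_g : ∀ i, L'.g i ∘ₗ φ₃ i = φ₂ i ∘ₗ L.g i
  comm_f : ∀ i, L'.f i ∘ₗ φ₂ i = φ₁ i ∘ₗ L.f i
  comm_δ : ∀ i, L'.δ i ∘ₗ φ₁ i = φ₃ (i + 1) ∘ₗ L.δ i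

namespace IsHom

variable {L : LongExact K A₁ A₂ A₃} {L' : LongExact K B₁ B₂ B₃} {φ₁ : ∀ i, A₁ i →ₗ[K] B₁ i}
  {φ₂ : ∀ i, A₂ i →ₗ[K] B₂ i} {φ₃ : ∀ i, A₃ i →ₗ[K] B₃ i}

/-- The four lemma. Apart from `φ₂` in degree `k`, only degrees below `k` enter, which makes an
induction on `k` possible. -/
theorem injective₃ (h : IsHom L L' φ₁ φ₂ φ₃) (k : ℕ) (h₂ : ∀ i ≤ k, Function.Bijective (φ₂ i))
    (h₁ : ∀ i < k, Function.Bijective (φ₁ i)) : Function.Injective (φ₃ k) := by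
  cases k with
  | zero =>
    refine Function.Injective.of_comp (f := L'.g 0) ?_
    rw [← LinearMap.coe_comp, h.comm_g, LinearMap.coe_comp]
    exact (h₂ 0 le_rfl).1.comp L.inj
  | succ k =>
    exact LinearMap.injective_of_surjective_of_injective_of_injective (L.f k) (L.δ k) (L.g (k + 1))
      (L'.f k) (L'.δ k) (L'.g (k + 1)) (φ₂ k) (φ₁ k) (φ₃ (k + 1)) (φ₂ (k + 1)) (h.comm_f k)
      (h.comm_δ k) (h.comm_g (k + 1)) (L.exact₁ k) (L.exact₃ k) (L'.exact₁ k)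
      (h₂ k (by omega)).2 (h₁ k (by omega)).1 (h₂ (k + 1) le_rfl).1

/-- The other four lemma. In degree `k` it requires only injectivity of `φ₁`, so it can be used once
injectivity in degree `k` is established. -/
theorem surjective₃ (h : IsHom L L' φ₁ φ₂ φ₃) (k : ℕ) (h₂ : Function.Bijective (φ₂ k))
    (h₁ : ∀ i < k, Function.Bijective (φ₁ i)) (h₁' : Function.Injective (φ₁ k)) :
    Function.Surjective (φ₃ k) := by
  cases k with
  | zero =>
    exact LinearMap.surjective_of_surjective_of_injective_of_left_exact (L.g 0) (L.f 0)
      (L'.g 0) (L'.f 0) (φ₃ 0) (φ₂ 0) (φ₁ 0) (h.comm_g 0) (h.comm_f 0)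
      (L.exact₂ 0) (L'.exact₂ 0) h₂.2 h₁' L'.inj
  | succ k =>
    exact LinearMap.surjective_of_surjective_of_surjective_of_injective (L.δ k) (L.g (k + 1))
      (L.f (k + 1)) (L'.δ k) (L'.g (k + 1)) (L'.f (k + 1)) (φ₁ k) (φ₃ (k + 1)) (φ₂ (k + 1))
      (φ₁ (k + 1)) (h.comm_δ k) (h.comm_g (k + 1)) (h.comm_f (k + 1)) (L.exact₂ _) (L'.exact₃ k)
      (L'.exact₂ _) (h₁ k (by omega)).2 h₂.2 h₁'

/-- The five lemma for the middle term; it shows that bijectivity passes to direct sums. -/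
theorem bijective₂ (h : IsHom L L' φ₁ φ₂ φ₃) (h₁ : ∀ i, Function.Bijective (φ₁ i))
    (h₃ : ∀ i, Function.Bijective (φ₃ i)) (k : ℕ) : Function.Bijective (φ₂ k) := by
  refine ⟨?_, LinearMap.surjective_of_surjective_of_surjective_of_injective (L.g k) (L.f k)
    (L.δ k) (L'.g k) (L'.f k) (L'.δ k) (φ₃ k) (φ₂ k) (φ₁ k) (φ₃ (k + 1)) (h.comm_g k) (h.comm_f k)
    (h.comm_δ k) (L.exact₁ k) (L'.exact₂ k) (L'.exact₁ k) (h₃ k).2 (h₁ k).2 (h₃ (k + 1)).1⟩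
  cases k with
  | zero =>
    -- In degree zero the sequences are continued on the left by a zero module.
    exact LinearMap.injective_of_surjective_of_injective_of_injective
      (0 : PUnit →ₗ[K] A₃ 0) (L.g 0) (L.f 0) (0 : PUnit →ₗ[K] B₃ 0) (L'.g 0) (L'.f 0)
      (LinearMap.id) (φ₃ 0) (φ₂ 0) (φ₁ 0) (by simp) (h.comm_g 0) (h.comm_f 0)
      (fun x => ⟨fun hx => ⟨0, (L.inj (hx.trans (map_zero _).symm)).symm⟩, by
        rintro ⟨y, rfl⟩; simp⟩) (L.exact₂ 0)
      (fun x => ⟨fun hx => ⟨0, (L'.inj (hx.trans (map_zero _).symm)).symm⟩, by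
        rintro ⟨y, rfl⟩; simp⟩) Function.surjective_id (h₃ 0).1 (h₁ 0).1
  | succ k =>
    exact LinearMap.injective_of_surjective_of_injective_of_injective (L.δ k) (L.g (k + 1))
      (L.f (k + 1)) (L'.δ k) (L'.g (k + 1)) (L'.f (k + 1)) (φ₁ k) (φ₃ (k + 1)) (φ₂ (k + 1))
      (φ₁ (k + 1)) (h.comm_δ k) (h.comm_g (k + 1)) (h.comm_f (k + 1)) (L.exact₃ k)
      (L.exact₂ _) (L'.exact₃ k) (h₁ k).2 (h₃ _).1 (h₁ _).1

end IsHom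

/-- A long exact sequence tensored with a vector space from the left. -/
def lTensor (L : LongExact K A₁ A₂ A₃) (V : Type*) [AddCommGroup V] [Module K V] :
    LongExact K (fun i => V ⊗[K] A₁ i) (fun i => V ⊗[K] A₂ i) (fun i => V ⊗[K] A₃ i) where
  g i := (L.g i).lTensor V
  f i := (L.f i).lTensor V
  δ i := (L.δ i).lTensor V
  inj := Module.Flat.lTensor_preserves_injective_linearMap _ L.inj
  exact₂ i := Module.Flat.lTensor_exact V (L.exact₂ i)
  exact₁ i := Module.Flat.lTensor_exact V (L.exact₁ i)
  exact₃ i := Module.Flat.lTensor_exact V (L.exact₃ i)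

theorem lTensor_g (L : LongExact K A₁ A₂ A₃) (V : Type*) [AddCommGroup V] [Module K V] (i : ℕ) :
    (L.lTensor V).g i = (L.g i).lTensor V := rfl

theorem lTensor_f (L : LongExact K A₁ A₂ A₃) (V : Type*) [AddCommGroup V] [Module K V] (i : ℕ) :
    (L.lTensor V).f i = (L.f i).lTensor V := rfl

theorem lTensor_δ (L : LongExact K A₁ A₂ A₃) (V : Type*) [AddCommGroup V] [Module K V] (i : ℕ) :
    (L.lTensor V).δ i = (L.δ i).lTensor V := rfl

end

open GrMod

variable {K : Type*} [Field K] {A₁ A₂ A₃ : ℕ → Type*} [∀ i, AddCommGroup (A₁ i)]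
    [∀ i, AddCommGroup (A₂ i)] [∀ i, AddCommGroup (A₃ i)] [∀ i, Module K (A₁ i)]
    [∀ i, Module K (A₂ i)] [∀ i, Module K (A₃ i)]

/-- The components of total degree `k` of the tensor product of two graded vector spaces. -/
abbrev TotalTensor (K : Type*) [Field K] (A E : ℕ → Type*) [∀ i, AddCommGroup (A i)]
    [∀ i, Module K (A i)] [∀ i, AddCommGroup (E i)] [∀ i, Module K (E i)] (k : ℕ) : Type _ :=
  ∀ ij : Bidegree k, A ij.1.1 ⊗[K] E ij.1.2

/-- The bidegrees of total degree `k + 1` with positive first entry. -/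
abbrev bidegreeSucc {k : ℕ} (ij : Bidegree k) : Bidegree (k + 1) :=
  ⟨(ij.1.1 + 1, ij.1.2), by have := ij.2; omega⟩

/-- The connecting map of `LongExact.totalTensor`. -/
def totalTensorδ {A A' : ℕ → Type*} [∀ i, AddCommGroup (A i)] [∀ i, Module K (A i)]
    [∀ i, AddCommGroup (A' i)] [∀ i, Module K (A' i)]
    (δ : ∀ i, A i →ₗ[K] A' (i + 1)) (E : ℕ → Type*) [∀ i, AddCommGroup (E i)]
    [∀ i, Module K (E i)] (k : ℕ) : TotalTensor K A E k →ₗ[K] TotalTensor K A' E (k + 1) :=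
  LinearMap.pi fun
    | ⟨(0, _), _⟩ => 0
    | ⟨(i + 1, j), h⟩ => (δ i).rTensor (E j) ∘ₗ
        LinearMap.proj (R := K) (φ := fun ij : Bidegree k => A ij.1.1 ⊗[K] E ij.1.2)
          ⟨(i, j), by omega⟩

/-- The total tensor product of a long exact sequence with a graded vector space. -/
def totalTensor (L : LongExact K A₁ A₂ A₃) (E : ℕ → Type*) [∀ i, AddCommGroup (E i)]
    [∀ i, Module K (E i)] :
    LongExact K (TotalTensor K A₁ E) (TotalTensor K A₂ E) (TotalTensor K A₃ E) where
  g k := LinearMap.piMap fun ij => (L.g ij.1.1).rTensor _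
  f k := LinearMap.piMap fun ij => (L.f ij.1.1).rTensor _
  δ k := totalTensorδ L.δ E k
  inj := by
    refine Function.Injective.piMap fun ⟨⟨i, j⟩, h⟩ => ?_
    -- In total degree zero the only bidegree is `(0, 0)`, where injectivity of `L.g 0` applies.
    obtain rfl : i = 0 := by simp only at h; omega
    exact Module.Flat.rTensor_preserves_injective_linearMap _ L.inj
  exact₂ k := by
    have h := fun ij : Bidegree k => Module.Flat.rTensor_exact (E ij.1.2) (L.exact₂ ij.1.1)
    refine fun x => ⟨fun hx => ?_, ?_⟩
    · choose y hy using fun ij => (h ij (x ij)).1 (congrFun hx ij)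
      exact ⟨y, funext hy⟩
    · rintro ⟨y, rfl⟩
      exact funext fun ij => (h ij _).2 ⟨y ij, rfl⟩
  exact₁ k := by
    have h := fun ij : Bidegree k => Module.Flat.rTensor_exact (E ij.1.2) (L.exact₁ ij.1.1)
    refine fun x => ⟨fun hx => ?_, ?_⟩
    -- The component of the connecting map at `(i + 1, j)` sees only the component of `x` at `(i,
    -- j)`, so exactness splits into the separate bidegrees.
    · choose y hy using fun ij => (h ij (x ij)).1 (congrFun hx (bidegreeSucc ij))
      exact ⟨y, funext hy⟩
    · rintro ⟨y, rfl⟩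
      funext ⟨⟨i, j⟩, hij⟩
      cases i with
      | zero => rfl
      | succ i => exact (h ⟨(i, j), by omega⟩ _).2 ⟨y ⟨(i, j), _⟩, rfl⟩
  exact₃ k := by
    have h := fun ij : Bidegree k => Module.Flat.rTensor_exact (E ij.1.2) (L.exact₃ ij.1.1)
    refine fun x => ⟨fun hx => ?_, ?_⟩
    · choose y hy using fun ij => (h ij (x (bidegreeSucc ij))).1 (congrFun hx (bidegreeSucc ij))
      refine ⟨y, ?_⟩
      funext ⟨⟨i, j⟩, hij⟩
      cases i with
      | zero =>
        -- Nothing maps to bidegree `(0, k + 1)` under the connecting map; there the component of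
        -- `x` vanishes because `L.g 0` remains injective after tensoring.
        refine Module.Flat.rTensor_preserves_injective_linearMap (M := E j) (L.g 0) L.inj ?_
        exact (map_zero _).trans (congrFun hx ⟨(0, j), hij⟩).symm
      | succ i => exact hy ⟨(i, j), by omega⟩
    · rintro ⟨y, rfl⟩
      funext ⟨⟨i, j⟩, hij⟩
      cases i with
      | zero => exact map_zero ((L.g 0).rTensor (E j))
      | succ i => exact (h ⟨(i, j), by omega⟩ _).2 ⟨y ⟨(i, j), _⟩, rfl⟩

end LongExact

namespace GrMod

instance (k : ℕ) : Fintype (Bidegree k) := Fintype.ofFinite _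

/-- A bidegree of total degree `k + 1` is `(0, k + 1)` or comes from one of total degree `k`. -/
def bidegreeEquiv (k : ℕ) : Option (Bidegree k) ≃ Bidegree (k + 1) where
  toFun
    | none => ⟨(0, k + 1), by simp⟩
    | some ij => LongExact.bidegreeSucc ij
  invFun
    | ⟨(0, _), _⟩ => none
    | ⟨(i + 1, j), h⟩ => some ⟨(i, j), by omega⟩
  left_inv
    | none => rfl
    | some _ => rfl
  right_inv
    | ⟨(0, j), h⟩ => Subtype.ext (Prod.ext rfl (by simp only at h ⊢; omega))
    | ⟨(i + 1, j), h⟩ => rfl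

/-- Matches a sum over total degree `k + 1` with one over total degree `k`, as required after a
connecting map that raises the first degree. -/
theorem sum_bidegree_succ {M : Type*} [AddCommMonoid M] (k : ℕ) (F : Bidegree (k + 1) → M)
    (h0 : ∀ h, F ⟨(0, k + 1), h⟩ = 0) :
    ∑ ij, F ij = ∑ ij : Bidegree k, F (LongExact.bidegreeSucc ij) := by
  rw [← (bidegreeEquiv k).sum_comp, Fintype.sum_option]
  exact (congrArg (· + _) (h0 _)).trans (zero_add _)

end GrMod

theorem DirectSum.lmap_exact {K ι : Type*} [Field K] {A B C : ι → Type*} [∀ i, AddCommGroup (A i)]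
    [∀ i, AddCommGroup (B i)] [∀ i, AddCommGroup (C i)] [∀ i, Module K (A i)] [∀ i, Module K (B i)]
    [∀ i, Module K (C i)] {f : ∀ i, A i →ₗ[K] B i} {g : ∀ i, B i →ₗ[K] C i}
    (h : ∀ i, Function.Exact (f i) (g i)) :
    Function.Exact (DirectSum.lmap f) (DirectSum.lmap g) := by
  rw [LinearMap.exact_iff, DirectSum.ker_lmap, DirectSum.range_lmap]
  simp only [fun i => LinearMap.exact_iff.1 (h i)]

namespace GrMod

open Abelian

section

variable {K R : Type u} [Field K] [CommRing R] [Algebra K R] {𝓡 : ℤ → Submodule K R}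
  [GradedAlgebra 𝓡]

/-! ### The long exact sequence of graded `Ext` -/

/-- Precomposition with a class in `Ext^a(N', N)` on a component of graded `Ext`. -/
def extPiecePrecomp {a i i' : ℕ} (h : a + i = i') {N' N : GrMod 𝓡} (e : Ext.{u} N' N a)
    (M : GrMod 𝓡) (p : ℤ) : ExtPiece i N M p →ₗ[K] ExtPiece i' N' M p where
  toFun x := e.comp x h
  map_add' _ _ := Ext.comp_add _ _ _ _
  map_smul' _ _ := Ext.comp_smul _ _ _ _

/-- Precomposition with a class in `Ext^a(N', N)` on graded `Ext`. -/
def gExtPrecomp {a i i' : ℕ} (h : a + i = i') {N' N : GrMod 𝓡} (e : Ext.{u} N' N a)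
    (M : GrMod 𝓡) : gExt i N M →ₗ[K] gExt i' N' M :=
  DirectSum.lmap fun p => extPiecePrecomp h e M p

theorem gExtPrecomp_ι {a i i' : ℕ} (h : a + i = i') {N' N : GrMod 𝓡} (e : Ext.{u} N' N a)
    (M : GrMod 𝓡) (p : ℤ) (x : ExtPiece i N M p) :
    gExtPrecomp h e M (extι i N M p x) = extι i' N' M p (e.comp x h) :=
  DirectSum.lmap_lof _ _ _

/-- The long exact sequence of graded `Ext` modules in the first argument. -/
def gExtLongExact {X₁ X₂ X₃ : GrMod 𝓡} (f : X₁ ⟶ X₂) (g : X₂ ⟶ X₃) (e : Ext.{u} X₃ X₁ 1)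
    (h : ∃ (w : f ≫ g = 0) (hS : (ShortComplex.mk f g w).ShortExact), e = hS.extClass)
    (M : GrMod 𝓡) :
    LongExact K (fun i => gExt i X₁ M) (fun i => gExt i X₂ M) (fun i => gExt i X₃ M) where
  g i := gExtPrecomp (zero_add i) (Ext.mk₀ g) M
  f i := gExtPrecomp (zero_add i) (Ext.mk₀ f) M
  δ i := gExtPrecomp (add_comm 1 i) e M
  inj := (DirectSum.lmap_injective _).2 fun p => by
    obtain ⟨w, hS, -⟩ := h
    have : Epi g := hS.epi_g
    exact Ext.precomp_mk₀_injective_of_epi (M.shift p) g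
  exact₂ i := DirectSum.lmap_exact fun p x => by
    obtain ⟨w, hS, -⟩ := h
    refine ⟨fun hx => Ext.contravariant_sequence_exact₂ hS _ x hx, ?_⟩
    rintro ⟨y, rfl⟩
    refine (Ext.mk₀_comp_mk₀_assoc _ _ _).trans ?_
    rw [w, Ext.mk₀_zero, Ext.zero_comp]
  exact₁ i := DirectSum.lmap_exact fun p x => by
    obtain ⟨w, hS, rfl⟩ := h
    refine ⟨fun hx => Ext.contravariant_sequence_exact₁ hS _ x (add_comm 1 i) hx, ?_⟩
    rintro ⟨y, rfl⟩
    exact hS.extClass_comp_assoc (h := add_comm 1 i) y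
  exact₃ i := DirectSum.lmap_exact fun p x => by
    obtain ⟨w, hS, rfl⟩ := h
    refine ⟨fun hx => Ext.contravariant_sequence_exact₃ hS _ x hx (add_comm 1 i), ?_⟩
    rintro ⟨y, rfl⟩
    exact hS.comp_extClass_assoc y (add_comm 1 i)

theorem gExtLongExact_g {X₁ X₂ X₃ : GrMod 𝓡} (f : X₁ ⟶ X₂) (g : X₂ ⟶ X₃) (e : Ext.{u} X₃ X₁ 1)
    (h : ∃ (w : f ≫ g = 0) (hS : (ShortComplex.mk f g w).ShortExact), e = hS.extClass)
    (M : GrMod 𝓡) (i : ℕ) :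
    (gExtLongExact f g e h M).g i = gExtPrecomp (zero_add i) (Ext.mk₀ g) M := rfl

theorem gExtLongExact_f {X₁ X₂ X₃ : GrMod 𝓡} (f : X₁ ⟶ X₂) (g : X₂ ⟶ X₃) (e : Ext.{u} X₃ X₁ 1)
    (h : ∃ (w : f ≫ g = 0) (hS : (ShortComplex.mk f g w).ShortExact), e = hS.extClass)
    (M : GrMod 𝓡) (i : ℕ) :
    (gExtLongExact f g e h M).f i = gExtPrecomp (zero_add i) (Ext.mk₀ f) M := rfl

theorem gExtLongExact_δ {X₁ X₂ X₃ : GrMod 𝓡} (f : X₁ ⟶ X₂) (g : X₂ ⟶ X₃) (e : Ext.{u} X₃ X₁ 1)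
    (h : ∃ (w : f ≫ g = 0) (hS : (ShortComplex.mk f g w).ShortExact), e = hS.extClass)
    (M : GrMod 𝓡) (i : ℕ) :
    (gExtLongExact f g e h M).δ i = gExtPrecomp (add_comm 1 i) e M := rfl

end

/-! ### The external product and the long exact sequences -/

variable {K R₁ R₂ : Type u} [Field K] [CommRing R₁] [CommRing R₂] [Algebra K R₁] [Algebra K R₂]
variable {𝓡₁ : ℤ → Submodule K R₁} {𝓡₂ : ℤ → Submodule K R₂}
variable [GradedAlgebra 𝓡₁] [GradedAlgebra 𝓡₂]

/-- For `a = 0` this gives compatibility with restriction along morphisms, for `a = 1` with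
connecting maps in the first argument. -/
theorem extProdTotal_precomp_left {a i i' j k k' : ℕ} (ha : a + i = i') (h : i + j = k)
    (h' : i' + j = k') (hk : a + k = k') {L₁ N₁ : GrMod 𝓡₁} (M₁ : GrMod 𝓡₁) (N₂ M₂ : GrMod 𝓡₂)
    (e : Ext.{u} L₁ N₁ a) (z : gExt i N₁ M₁ ⊗[K] gExt j N₂ M₂) :
    extProdTotal h' L₁ M₁ N₂ M₂ ((gExtPrecomp ha e M₁).rTensor _ z) =
      gExtPrecomp hk (extTensorRight e N₂) (tensorObj M₁ M₂) (extProdTotal h N₁ M₁ N₂ M₂ z) := by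
  induction z using gExt_tensor_induction with
  | h0 => simp only [map_zero]
  | hadd x y hx hy => simp only [map_add, hx, hy]
  | h p q x y =>
    rw [LinearMap.rTensor_tmul, gExtPrecomp_ι, extProdTotal_ι, extProdTotal_ι, gExtPrecomp_ι,
      extProd_eq, extCross_comp_left ha h h' hk, Ext.comp_assoc_of_third_deg_zero]
    rfl

/-- The first degree is zero in order that `e` can be exchanged with the first factor by
`extCross_zero_comp`. -/
theorem extProdTotal_precomp_right {b j j' : ℕ} (hb : b + j = j') (N₁ M₁ : GrMod 𝓡₁)
    {L₂ N₂ : GrMod 𝓡₂} (M₂ : GrMod 𝓡₂) (e : Ext.{u} L₂ N₂ b)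
    (z : gExt 0 N₁ M₁ ⊗[K] gExt j N₂ M₂) :
    extProdTotal (zero_add j') N₁ M₁ L₂ M₂ ((gExtPrecomp hb e M₂).lTensor _ z) =
      gExtPrecomp hb (extTensorLeft N₁ e) (tensorObj M₁ M₂)
        (extProdTotal (zero_add j) N₁ M₁ N₂ M₂ z) := by
  induction z using gExt_tensor_induction with
  | h0 => simp only [map_zero]
  | hadd x y hx hy => simp only [map_add, hx, hy]
  | h p q x y =>
    rw [LinearMap.lTensor_tmul, gExtPrecomp_ι, extProdTotal_ι, extProdTotal_ι, gExtPrecomp_ι,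
      extProd_eq, extCross_zero_comp hb, Ext.comp_assoc_of_third_deg_zero]
    rfl

/-- The sum of the external products over all bidegrees of total degree `k`. -/
def extProdSum (k : ℕ) (N₁ M₁ : GrMod 𝓡₁) (N₂ M₂ : GrMod 𝓡₂) :
    LongExact.TotalTensor K (fun i => gExt i N₁ M₁) (fun j => gExt j N₂ M₂) k →ₗ[K]
      gExt k (tensorObj N₁ N₂) (tensorObj M₁ M₂) :=
  ∑ ij : Bidegree k, extProdTotal ij.2 N₁ M₁ N₂ M₂ ∘ₗ LinearMap.proj (R := K)
    (φ := fun ij : Bidegree k => gExt ij.1.1 N₁ M₁ ⊗[K] gExt ij.1.2 N₂ M₂) ij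

theorem extProdSum_apply (k : ℕ) (N₁ M₁ : GrMod 𝓡₁) (N₂ M₂ : GrMod 𝓡₂)
    (z : LongExact.TotalTensor K (fun i => gExt i N₁ M₁) (fun j => gExt j N₂ M₂) k) :
    extProdSum k N₁ M₁ N₂ M₂ z = ∑ ij, extProdTotal ij.2 N₁ M₁ N₂ M₂ (z ij) := by
  rw [extProdSum, LinearMap.sum_apply]
  rfl

theorem extProdSum_precomp {k : ℕ} {L₁ N₁ : GrMod 𝓡₁} (M₁ : GrMod 𝓡₁) (N₂ M₂ : GrMod 𝓡₂)
    (f : L₁ ⟶ N₁)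
    (z : LongExact.TotalTensor K (fun i => gExt i N₁ M₁) (fun j => gExt j N₂ M₂) k) :
    extProdSum k L₁ M₁ N₂ M₂
        (fun ij => (gExtPrecomp (zero_add ij.1.1) (Ext.mk₀ f) M₁).rTensor _ (z ij)) =
      gExtPrecomp (zero_add k) (Ext.mk₀ (tensorMap f (𝟙 N₂))) (tensorObj M₁ M₂)
        (extProdSum k N₁ M₁ N₂ M₂ z) := by
  rw [extProdSum_apply, extProdSum_apply, map_sum]
  refine Finset.sum_congr rfl fun ij _ => ?_
  rw [extProdTotal_precomp_left (zero_add _) ij.2 ij.2 (zero_add k), extTensorRight_mk₀]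

/-- The term of bidegree `(0, k + 1)` vanishes by construction of the connecting map, and the other
terms correspond to the bidegrees of total degree `k`. -/
theorem extProdSum_precomp_one {k : ℕ} {L₁ N₁ : GrMod 𝓡₁} (M₁ : GrMod 𝓡₁) (N₂ M₂ : GrMod 𝓡₂)
    (e : Ext.{u} L₁ N₁ 1)
    (z : LongExact.TotalTensor K (fun i => gExt i N₁ M₁) (fun j => gExt j N₂ M₂) k) :
    extProdSum (k + 1) L₁ M₁ N₂ M₂
        (LongExact.totalTensorδ (fun i => gExtPrecomp (add_comm 1 i) e M₁) _ k z) =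
      gExtPrecomp (add_comm 1 k) (extTensorRight e N₂) (tensorObj M₁ M₂)
        (extProdSum k N₁ M₁ N₂ M₂ z) := by
  rw [extProdSum_apply, extProdSum_apply, map_sum, sum_bidegree_succ k _ fun h => map_zero _]
  refine Finset.sum_congr rfl fun ij _ => ?_
  exact extProdTotal_precomp_left (add_comm 1 _) ij.2 (LongExact.bidegreeSucc ij).2 (add_comm 1 k)
    M₁ N₂ M₂ e (z ij)

/-- The class of the tensored sequence is the tensored class, which is what the external product
composes with. For this reason `gExtLongExact` accepts any class together with a proof that it is
the extension class. -/
theorem exists_extClass_tensorRight {X₁ X₂ X₃ : GrMod 𝓡₁} {f : X₁ ⟶ X₂} {g : X₂ ⟶ X₃}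
    {e : Ext.{u} X₃ X₁ 1}
    (h : ∃ (w : f ≫ g = 0) (hS : (ShortComplex.mk f g w).ShortExact), e = hS.extClass)
    (N : GrMod 𝓡₂) :
    ∃ (w : tensorMap f (𝟙 N) ≫ tensorMap g (𝟙 N) = 0)
      (hS : (ShortComplex.mk _ _ w).ShortExact), extTensorRight e N = hS.extClass := by
  obtain ⟨w, hS, rfl⟩ := h
  exact ⟨_, hS.map_of_exact (tensorWith 𝓡₁ N), Ext.mapExactFunctor_extClass (tensorWith 𝓡₁ N) hS⟩

theorem exists_extClass_tensorLeft {X₁ X₂ X₃ : GrMod 𝓡₂} {f : X₁ ⟶ X₂} {g : X₂ ⟶ X₃}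
    {e : Ext.{u} X₃ X₁ 1}
    (h : ∃ (w : f ≫ g = 0) (hS : (ShortComplex.mk f g w).ShortExact), e = hS.extClass)
    (N : GrMod 𝓡₁) :
    ∃ (w : tensorMap (𝟙 N) f ≫ tensorMap (𝟙 N) g = 0)
      (hS : (ShortComplex.mk _ _ w).ShortExact), extTensorLeft N e = hS.extClass := by
  obtain ⟨w, hS, rfl⟩ := h
  exact ⟨_, hS.map_of_exact (withTensor 𝓡₂ N), Ext.mapExactFunctor_extClass (withTensor 𝓡₂ N) hS⟩

theorem extProdSum_isHom {X₁ X₂ X₃ : GrMod 𝓡₁} {f : X₁ ⟶ X₂} {g : X₂ ⟶ X₃}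
    {e : Ext.{u} X₃ X₁ 1}
    (h : ∃ (w : f ≫ g = 0) (hS : (ShortComplex.mk f g w).ShortExact), e = hS.extClass)
    (M₁ : GrMod 𝓡₁)
    (N₂ M₂ : GrMod 𝓡₂) :
    LongExact.IsHom
      ((gExtLongExact f g e h M₁).totalTensor fun j => gExt j N₂ M₂)
      (gExtLongExact _ _ _ (exists_extClass_tensorRight h N₂) (tensorObj M₁ M₂))
      (fun k => extProdSum k X₁ M₁ N₂ M₂) (fun k => extProdSum k X₂ M₁ N₂ M₂)
      (fun k => extProdSum k X₃ M₁ N₂ M₂) where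
  comm_g _ := LinearMap.ext fun z => (extProdSum_precomp M₁ N₂ M₂ g z).symm
  comm_f _ := LinearMap.ext fun z => (extProdSum_precomp M₁ N₂ M₂ f z).symm
  comm_δ _ := LinearMap.ext fun z => (extProdSum_precomp_one M₁ N₂ M₂ e z).symm

theorem extProdTotal_precomp_mk₀_right {j : ℕ} (N₁ M₁ : GrMod 𝓡₁)
    {L₂ N₂ : GrMod 𝓡₂} (M₂ : GrMod 𝓡₂) (f : L₂ ⟶ N₂) (z : gExt 0 N₁ M₁ ⊗[K] gExt j N₂ M₂) :
    extProdTotal (zero_add j) N₁ M₁ L₂ M₂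
        ((gExtPrecomp (zero_add j) (Ext.mk₀ f) M₂).lTensor _ z) =
      gExtPrecomp (zero_add j) (Ext.mk₀ (tensorMap (𝟙 N₁) f)) (tensorObj M₁ M₂)
        (extProdTotal (zero_add j) N₁ M₁ N₂ M₂ z) := by
  rw [extProdTotal_precomp_right, extTensorLeft_mk₀]

end GrMod

namespace GrMod

open Abelian

variable {K R₁ R₂ : Type u} [Field K] [CommRing R₁] [CommRing R₂] [Algebra K R₁] [Algebra K R₂]
variable {𝓡₁ : ℤ → Submodule K R₁} {𝓡₂ : ℤ → Submodule K R₂}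
variable [GradedAlgebra 𝓡₁] [GradedAlgebra 𝓡₂]

/-- The external products with first degree zero. -/
def extProdZero (N₁ M₁ : GrMod 𝓡₁) (N₂ M₂ : GrMod 𝓡₂) (k : ℕ) :
    gExt 0 N₁ M₁ ⊗[K] gExt k N₂ M₂ →ₗ[K] gExt k (tensorObj N₁ N₂) (tensorObj M₁ M₂) :=
  extProdTotal (zero_add k) N₁ M₁ N₂ M₂
-- The long exact sequence in the second argument is treated only for first degree zero, where no
-- signs arise. This suffices because the first argument will be free of rank one at that stage.
theorem extProdZero_isHom {X₁ X₂ X₃ : GrMod 𝓡₂} {f : X₁ ⟶ X₂} {g : X₂ ⟶ X₃}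
    {e : Ext.{u} X₃ X₁ 1}
    (h : ∃ (w : f ≫ g = 0) (hS : (ShortComplex.mk f g w).ShortExact), e = hS.extClass)
    (N₁ M₁ : GrMod 𝓡₁)
    (M₂ : GrMod 𝓡₂) :
    LongExact.IsHom ((gExtLongExact f g e h M₂).lTensor (gExt 0 N₁ M₁))
      (gExtLongExact (tensorMap (𝟙 N₁) f) (tensorMap (𝟙 N₁) g) (extTensorLeft N₁ e)
        (exists_extClass_tensorLeft h N₁) (tensorObj M₁ M₂))
      (extProdZero N₁ M₁ X₁ M₂) (extProdZero N₁ M₁ X₂ M₂) (extProdZero N₁ M₁ X₃ M₂) where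
  comm_g k := by
    rw [LongExact.lTensor_g, gExtLongExact_g, gExtLongExact_g]
    exact LinearMap.ext fun z => (extProdTotal_precomp_mk₀_right N₁ M₁ M₂ g z).symm
  comm_f k := by
    rw [LongExact.lTensor_f, gExtLongExact_f, gExtLongExact_f]
    exact LinearMap.ext fun z => (extProdTotal_precomp_mk₀_right N₁ M₁ M₂ f z).symm
  comm_δ k := by
    rw [LongExact.lTensor_δ, gExtLongExact_δ, gExtLongExact_δ]
    refine LinearMap.ext fun z => ?_
    have := extProdTotal_precomp_right (add_comm 1 k) N₁ M₁ M₂ e z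
    rw [LinearMap.comp_apply, LinearMap.comp_apply, extProdZero, extProdZero]
    rw [this]

end GrMod

namespace GrMod

open Abelian

section

variable {K R : Type u} [Field K] [CommRing R] [Algebra K R] {𝓡 : ℤ → Submodule K R}

/-! ### Reduction to free modules of rank one -/

theorem isIso_of_bijective {M N : GrMod 𝓡} (f : M ⟶ N) (hf : Function.Bijective (lin f)) :
    IsIso f :=
  have := mono_of_injective f hf.1
  have := epi_of_surjective f hf.2
  isIso_of_mono_of_epi f

theorem lin_sum {M N : GrMod 𝓡} {ι : Type*} (s : Finset ι) (f : ι → (M ⟶ N)) :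
    lin (∑ i ∈ s, f i) = ∑ i ∈ s, lin (f i) :=
  map_sum (⟨⟨lin, rfl⟩, fun _ _ => rfl⟩ : (M ⟶ N) →+ (M →ₗ[R] N)) f s

theorem biproduct_sum {ι : Type} [Fintype ι] (M : ι → GrMod 𝓡) (x : (⨁ M : GrMod 𝓡)) :
    ∑ i, lin (biproduct.ι M i) (lin (biproduct.π M i) x) = x := by
  have h := LinearMap.congr_fun (congrArg lin (biproduct.total (f := M))) x
  rw [lin_sum, LinearMap.sum_apply] at h
  exact h

theorem biprod_shortExact (F F' : GrMod 𝓡) :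
    (ShortComplex.mk (biprod.inl : F ⟶ F ⊞ F') biprod.snd biprod.inl_snd).ShortExact :=
  (ShortComplex.Splitting.ofHasBinaryBiproduct F F').shortExact

theorem range_biprod_desc {F F' N : GrMod 𝓡} (f : F ⟶ N) (f' : F' ⟶ N) :
    LinearMap.range (lin f) ⊔ LinearMap.range (lin f') ≤
      LinearMap.range (lin (biprod.desc f f')) := by
  refine sup_le ?_ ?_
  · rintro _ ⟨x, rfl⟩
    exact ⟨lin biprod.inl x, LinearMap.congr_fun (congrArg lin (biprod.inl_desc f f')) x⟩
  · rintro _ ⟨x, rfl⟩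
    exact ⟨lin biprod.inr x, LinearMap.congr_fun (congrArg lin (biprod.inr_desc f f')) x⟩

theorem finite_biprod (F F' : GrMod 𝓡) [Module.Finite R F] [Module.Finite R F'] :
    Module.Finite R (F ⊞ F' : GrMod 𝓡) := by
  refine Module.Finite.of_surjective
    ((lin (biprod.inl : F ⟶ F ⊞ F')).coprod (lin (biprod.inr : F' ⟶ F ⊞ F'))) fun x => ?_
  exact ⟨(lin biprod.fst x, lin biprod.snd x),
    LinearMap.congr_fun (congrArg lin (biprod.total (X := F) (Y := F'))) x⟩

theorem ker_shortExact {F N : GrMod 𝓡} (f : F ⟶ N) (hf : Function.Surjective (lin f)) :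
    ∃ w, (ShortComplex.mk (F.subι _ (ker_isHomog f)) f w).ShortExact :=
  ⟨by ext x; exact x.2, (shortExact_iff _).2 ⟨Subtype.val_injective,
    fun x => ⟨fun hx => ⟨⟨x, hx⟩, rfl⟩, by rintro ⟨y, rfl⟩; exact y.2⟩, hf⟩⟩

variable [GradedAlgebra 𝓡] {T U : ℕ → GrMod 𝓡 → Type u} [∀ k N, AddCommGroup (T k N)]
  [∀ k N, AddCommGroup (U k N)] [∀ k N, Module K (T k N)] [∀ k N, Module K (U k N)]
  (φ : ∀ k N, T k N →ₗ[K] U k N)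

/-- Linear maps that are compatible with the long exact sequences of short exact sequences. -/
def IsConnected : Prop :=
  ∀ {X₁ X₂ X₃ : GrMod 𝓡} (f : X₁ ⟶ X₂) (g : X₂ ⟶ X₃) (w : f ≫ g = 0),
    (ShortComplex.mk f g w).ShortExact →
    ∃ (L : LongExact K (fun k => T k X₁) (fun k => T k X₂) (fun k => T k X₃))
      (L' : LongExact K (fun k => U k X₁) (fun k => U k X₂) (fun k => U k X₃)),
      L.IsHom L' (fun k => φ k X₁) (fun k => φ k X₂) (fun k => φ k X₃)

variable {φ}

/-- A homogeneous element is hit by a module `R(p)`, an arbitrary element by a finite direct sum of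
these, one for each of finitely many homogeneous summands. Bijectivity of `φ` is carried along as
the direct sum grows. -/
theorem exists_cover_of_fg (hφ : IsConnected φ)
    (base : ∀ p k, Function.Bijective (φ k ((self 𝓡).shift p))) (N : GrMod 𝓡) (Q : Submodule R N)
    (hQ : Q.FG) :
    ∃ (F : GrMod 𝓡) (f : F ⟶ N), (∀ k, Function.Bijective (φ k F)) ∧ Module.Finite R F ∧
      Q ≤ LinearMap.range (lin f) := by
  have hsup : ∀ Q Q' : Submodule R N,
      (∃ (F : GrMod 𝓡) (f : F ⟶ N), (∀ k, Function.Bijective (φ k F)) ∧ Module.Finite R F ∧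
        Q ≤ LinearMap.range (lin f)) →
      (∃ (F : GrMod 𝓡) (f : F ⟶ N), (∀ k, Function.Bijective (φ k F)) ∧ Module.Finite R F ∧
        Q' ≤ LinearMap.range (lin f)) →
      (∃ (F : GrMod 𝓡) (f : F ⟶ N), (∀ k, Function.Bijective (φ k F)) ∧ Module.Finite R F ∧
        Q ⊔ Q' ≤ LinearMap.range (lin f)) := by
    rintro Q Q' ⟨F, f, hF, hF', hf⟩ ⟨G, g, hG, hG', hg⟩
    -- The split sequence of `F ⊞ G` and the five lemma show that `φ` is bijective on the sum.
    obtain ⟨L, L', h⟩ := hφ _ _ _ (biprod_shortExact F G)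
    exact ⟨F ⊞ G, biprod.desc f g, h.bijective₂ hF hG, finite_biprod F G,
      (sup_le_sup hf hg).trans (range_biprod_desc f g)⟩
  induction Q, hQ using Submodule.fg_induction with
  | sup Q Q' _ _ hQ hQ' => exact hsup Q Q' hQ hQ'
  | singleton x =>
    induction x using N.hom_induction with
    | mem p x hx =>
      refine ⟨(self 𝓡).shift (-p), ofElement N (-p) x (by rwa [neg_neg]), base _,
        inferInstanceAs (Module.Finite R R), ?_⟩
      rw [Submodule.span_singleton_le_iff_mem]
      exact ⟨(1 : R), one_smul R x⟩
    | zero =>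
      -- Nothing has to be covered; any module on which `φ` is known to be bijective will do.
      exact ⟨(self 𝓡).shift 0, 0, base _, inferInstanceAs (Module.Finite R R), by simp⟩
    | add x y hx hy =>
      obtain ⟨F, f, hF, hF', hf⟩ := hsup _ _ hx hy
      refine ⟨F, f, hF, hF', le_trans ?_ hf⟩
      rw [Submodule.span_singleton_le_iff_mem]
      exact add_mem (Submodule.mem_sup_left (Submodule.mem_span_singleton_self x))
        (Submodule.mem_sup_right (Submodule.mem_span_singleton_self y))

/-- Dévissage along `0 → Z → F → N → 0` with `F` built from modules `R(p)` and `Z` again finitely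
generated, by strong induction on the degree for all finitely generated modules at once. -/
theorem bijective_of_finite [IsNoetherianRing R] (hφ : IsConnected φ)
    (base : ∀ p k, Function.Bijective (φ k ((self 𝓡).shift p))) (k : ℕ) (N : GrMod 𝓡)
    [Module.Finite R N] : Function.Bijective (φ k N) := by
  induction k using Nat.strong_induction_on generalizing N with
  | h k ih =>
    have cover : ∀ (N : GrMod 𝓡) [Module.Finite R N], ∃ (Z F : GrMod 𝓡) (f : Z ⟶ F) (g : F ⟶ N)
        (w : f ≫ g = 0), (ShortComplex.mk f g w).ShortExact ∧ Module.Finite R Z ∧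
        ∀ k, Function.Bijective (φ k F) := by
      intro N _
      obtain ⟨F, f, hF, hF', hf⟩ := exists_cover_of_fg hφ base N ⊤ Module.Finite.fg_top
      obtain ⟨w, hS⟩ := ker_shortExact f (LinearMap.range_eq_top.1 (top_le_iff.1 hf))
      -- The kernel is finitely generated because `R` is noetherian.
      exact ⟨_, F, _, f, w, hS, inferInstanceAs (Module.Finite R (LinearMap.ker (lin f))), hF⟩
    -- Injectivity in degree `k` needs `Z` in lower degrees only. It is proved for all modules
    -- first, since surjectivity for `N` uses injectivity for `Z` in the same degree.
    have inj : ∀ (N : GrMod 𝓡) [Module.Finite R N], Function.Injective (φ k N) := by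
      intro N _
      obtain ⟨Z, F, f, g, w, hS, hZ, hF⟩ := cover N
      obtain ⟨L, L', h⟩ := hφ f g w hS
      exact h.injective₃ k (fun i _ => hF i) fun i hi => ih i hi Z
    obtain ⟨Z, F, f, g, w, hS, hZ, hF⟩ := cover N
    obtain ⟨L, L', h⟩ := hφ f g w hS
    exact ⟨inj N, h.surjective₃ k (hF k) (fun i hi => ih i hi Z) (inj Z)⟩

/-! ### Graded `Ext` of free modules of rank one -/

theorem subsingleton_gExt {i : ℕ} (hi : 0 < i) (N M : GrMod 𝓡) [Projective N] :
    Subsingleton (gExt i N M) := by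
  refine subsingleton_of_forall_eq 0 fun z => ?_
  induction z using gExt_induction with
  | h0 => rfl
  | hadd x y hx hy => rw [hx, hy, add_zero]
  | h p x =>
    obtain ⟨i, rfl⟩ := Nat.exists_eq_succ_of_ne_zero hi.ne'
    rw [Ext.eq_zero_of_projective x, map_zero]

/-- The value of a sum of homogeneous homomorphisms at `n`. -/
def gExtEval (N M : GrMod 𝓡) (n : N) : gExt 0 N M →ₗ[K] M :=
  gExtDesc 0 N M fun p =>
    { toFun := fun x => lin (Ext.homEquiv₀ x) n
      map_add' := fun x y => by
        have : Ext.homEquiv₀ (x + y) = Ext.homEquiv₀ x + Ext.homEquiv₀ y :=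
          map_add Ext.addEquiv₀ x y
        rw [this]; rfl
      map_smul' := fun c x => by
        have : Ext.homEquiv₀ (c • x) = c • Ext.homEquiv₀ x :=
          map_smul (Ext.linearEquiv₀ (R := K)) c x
        rw [this]
        exact algebraMap_smul R c _ }

theorem gExtEval_ι (N M : GrMod 𝓡) (n : N) (p : ℤ) (f : N ⟶ M.shift p) :
    gExtEval N M n (extι 0 N M p (Ext.mk₀ f)) = lin f n := by
  rw [gExtEval, gExtDesc_ι]
  exact congrArg (fun f => lin f n) (Ext.homEquiv₀.apply_symm_apply f)

theorem gExtEval_mem (N M : GrMod 𝓡) {d : ℤ} {n : N} (hn : n ∈ N.grading d) (p : ℤ)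
    (x : ExtPiece 0 N M p) : gExtEval N M n (extι 0 N M p x) ∈ M.grading (d + p) := by
  obtain ⟨f, rfl⟩ := (Ext.mk₀_bijective _ _).2 x
  rw [gExtEval_ι]
  exact lin_mem f hn

/-- A homomorphism out of a module that is free on one homogeneous generator is determined by the
image of the generator, which is arbitrary. A general element of `M` is a finite sum of homogeneous
values, matching the finite sums of homogeneous homomorphisms in `gExt 0 N M`. -/
theorem gExtEval_bijective (N M : GrMod 𝓡) {d : ℤ} {n : N} (hn : n ∈ N.grading d)
    (h : Function.Bijective fun r : R => r • n) : Function.Bijective (gExtEval N M n) := by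
  let e : R ≃ₗ[R] N := LinearEquiv.ofBijective (LinearMap.toSpanSingleton R N n) h
  have he : ∀ r, e r = r • n := fun r => rfl
  -- The inverse of `e` respects degrees up to the shift by `d`, because `e` intertwines the
  -- homogeneous projections.
  have hmem : ∀ q (r : R), e r ∈ N.grading (q + d) → r ∈ 𝓡 q := by
    intro q r hr
    have h1 : ∀ r : R, N.proj (q + d) (e r) = e ((self 𝓡).proj q r) := by
      intro r
      induction r using (self 𝓡).hom_induction with
      | mem a r hr =>
        have := N.smul_mem' hr hn
        by_cases haq : q = a
        · subst haq
          rw [(self 𝓡).proj_of_mem hr]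
          exact N.proj_of_mem this
        · rw [(self 𝓡).proj_of_mem_ne haq hr]
          exact (N.proj_of_mem_ne (by omega) this).trans (map_zero e).symm
      | zero =>
          exact (congrArg _ (map_zero e)).trans (by
            rw [map_zero, map_zero]; exact (map_zero e).symm)
      | add r s hr hs =>
        refine (congrArg _ (map_add e r s)).trans ?_
        rw [map_add, map_add, hr, hs]
        exact (map_add e _ _).symm
    have h2 := h1 r
    rw [N.proj_of_mem hr] at h2
    rw [e.injective h2]
    exact (self 𝓡).proj_mem q r
  have hsurj : ∀ p, ∀ m ∈ M.grading (d + p), ∃ f : N ⟶ M.shift p, lin f n = m := by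
    intro p m hm
    refine ⟨ofLin ((LinearMap.toSpanSingleton R M m) ∘ₗ e.symm.toLinearMap) ?_, ?_⟩
    · intro a x hx
      obtain ⟨r, rfl⟩ := e.surjective x
      have hr : r ∈ 𝓡 (a - d) := hmem (a - d) r (by rwa [sub_add_cancel])
      change (e.symm (e r)) • m ∈ M.grading (a + p)
      rw [e.symm_apply_apply, show a + p = a - d + (d + p) by omega]
      exact M.smul_mem' hr hm
    · change (e.symm n) • m = m
      rw [show n = e 1 from (one_smul R n).symm, e.symm_apply_apply, one_smul]
  have hinj : ∀ p (f : N ⟶ M.shift p), lin f n = 0 → f = 0 := by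
    intro p f hf
    ext x
    obtain ⟨r, rfl⟩ := e.surjective x
    rw [he, map_smul, hf]
    simp
  constructor
  -- Evaluation carries degree `p` to degree `d + p`, so a kernel element has its components in the
  -- kernel, and `hinj` applies to each of them.
  · have hcomp : ∀ (z : gExt 0 N M) (p : ℤ), M.proj (d + p) (gExtEval N M n z) =
        gExtEval N M n ((gExt 0 N M).proj p z) := by
      intro z p
      induction z using gExt_induction with
      | h0 => simp only [map_zero]
      | hadd x y hx hy => simp only [map_add, hx, hy]
      | h q x =>
        have h1 : extι 0 N M q x ∈ (gExt 0 N M).grading q := ⟨x, rfl⟩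
        have h2 := gExtEval_mem N M hn q x
        by_cases hpq : p = q
        · subst hpq
          rw [M.proj_of_mem h2, (gExt 0 N M).proj_of_mem h1]
        · rw [M.proj_of_mem_ne (by omega) h2, (gExt 0 N M).proj_of_mem_ne hpq h1, map_zero]
    rw [injective_iff_map_eq_zero]
    intro z hz
    obtain ⟨s, hs⟩ := (gExt 0 N M).exists_sum_proj z
    rw [← hs s subset_rfl]
    refine Finset.sum_eq_zero fun p _ => ?_
    have h0 := hcomp z p
    rw [hz, map_zero] at h0
    obtain ⟨x, hx⟩ := (gExt 0 N M).proj_mem p z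
    obtain ⟨f, rfl⟩ := (Ext.mk₀_bijective _ _).2 x
    rw [← hx] at h0 ⊢
    have h3 : lin f n = 0 := (gExtEval_ι N M n p f).symm.trans h0.symm
    rw [hinj p f h3, Ext.mk₀_zero, map_zero]
    rfl
  · intro m
    induction m using M.hom_induction with
    | zero => exact ⟨0, map_zero _⟩
    | add x y hx hy =>
      obtain ⟨a, rfl⟩ := hx
      obtain ⟨b, rfl⟩ := hy
      exact ⟨a + b, map_add _ a b⟩
    | mem p m hm =>
      obtain ⟨f, hf⟩ := hsurj (p - d) m (by rwa [add_sub_cancel])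
      exact ⟨extι 0 N M (p - d) (Ext.mk₀ f), by rw [gExtEval_ι, hf]⟩

/-- Such a module is isomorphic to `R(-d)`. -/
theorem projective_of_bijective_smul (N : GrMod 𝓡) {d : ℤ} {n : N} (hn : n ∈ N.grading d)
    (h : Function.Bijective fun r : R => r • n) : Projective N :=
  have hn' : n ∈ N.grading (- -d) := by rwa [neg_neg]
  have := isIso_of_bijective (ofElement N (-d) n hn') h
  Projective.of_iso (asIso (ofElement N (-d) n hn')) inferInstance

theorem one_mem_shift (p : ℤ) : (1 : R) ∈ ((self 𝓡).shift p).grading (-p) := by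
  change (1 : R) ∈ 𝓡 (-p + p)
  rw [neg_add_cancel]
  exact SetLike.one_mem_graded 𝓡

end

/-! ### External products for free modules of rank one -/

variable {K R₁ R₂ : Type u} [Field K] [CommRing R₁] [CommRing R₂] [Algebra K R₁] [Algebra K R₂]
variable {𝓡₁ : ℤ → Submodule K R₁} {𝓡₂ : ℤ → Submodule K R₂}
variable [GradedAlgebra 𝓡₁] [GradedAlgebra 𝓡₂]

/-- The carrier of `R₁(p) ⊗ R₂(q)` is `R₁ ⊗ R₂` itself; hence this module is free on `1 ⊗ 1`. -/
theorem smul_one_tmul_one (p q : ℤ) (r : R₁ ⊗[K] R₂) :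
    (r • tmul (M := (self 𝓡₁).shift p) (N := (self 𝓡₂).shift q) (1 : R₁) (1 : R₂) :
      tensorObj ((self 𝓡₁).shift p) ((self 𝓡₂).shift q)) = r := by
  change tensorAction ((self 𝓡₁).shift p) ((self 𝓡₂).shift q) r ((1 : R₁) ⊗ₜ[K] (1 : R₂)) = r
  induction r using TensorProduct.induction_on with
  | zero => rw [map_zero, LinearMap.zero_apply]
  | add r s hr hs => rw [map_add, LinearMap.add_apply, hr, hs]
  | tmul r s =>
    rw [tensorAction_tmul]
    exact congrArg₂ _ (mul_one r) (mul_one s)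

theorem bijective_smul_one_tmul_one (p q : ℤ) : Function.Bijective fun r : R₁ ⊗[K] R₂ =>
    (r • tmul (M := (self 𝓡₁).shift p) (N := (self 𝓡₂).shift q) (1 : R₁) (1 : R₂) :
      tensorObj ((self 𝓡₁).shift p) ((self 𝓡₂).shift q)) := by
  rw [show (fun r : R₁ ⊗[K] R₂ =>
    (r • tmul (M := (self 𝓡₁).shift p) (N := (self 𝓡₂).shift q) (1 : R₁) (1 : R₂) :
      tensorObj ((self 𝓡₁).shift p) ((self 𝓡₂).shift q))) = id from
    funext (smul_one_tmul_one p q)]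
  exact Function.bijective_id

/-- In degree zero the external product of `f` and `g` is `f ⊗ g`, whose value at `n₁ ⊗ n₂` is the
tensor of the two values. -/
theorem gExtEval_extProdTotal (N₁ M₁ : GrMod 𝓡₁) (N₂ M₂ : GrMod 𝓡₂) (n₁ : N₁) (n₂ : N₂)
    (z : gExt 0 N₁ M₁ ⊗[K] gExt 0 N₂ M₂) :
    gExtEval (tensorObj N₁ N₂) (tensorObj M₁ M₂) (tmul n₁ n₂)
        (extProdTotal (zero_add 0) N₁ M₁ N₂ M₂ z) =
      TensorProduct.map (gExtEval N₁ M₁ n₁) (gExtEval N₂ M₂ n₂) z := by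
  induction z using gExt_tensor_induction with
  | h0 => simp only [map_zero]; rfl
  | hadd x y hx hy => simp only [map_add, hx, hy]; rfl
  | h p q x y =>
    obtain ⟨f, rfl⟩ := (Ext.mk₀_bijective _ _).2 x
    obtain ⟨g, rfl⟩ := (Ext.mk₀_bijective _ _).2 y
    rw [extProdTotal_ι, extProd_eq, extCross_mk₀_mk₀, Ext.mk₀_comp_mk₀, gExtEval_ι,
      TensorProduct.map_tmul, gExtEval_ι, gExtEval_ι]
    rfl

theorem extProdZero_bijective_of_free (M₁ : GrMod 𝓡₁) (M₂ : GrMod 𝓡₂) (p q : ℤ) (k : ℕ) :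
    Function.Bijective (extProdZero ((self 𝓡₁).shift p) M₁ ((self 𝓡₂).shift q) M₂ k) := by
  have hb := bijective_smul_one_tmul_one (𝓡₁ := 𝓡₁) (𝓡₂ := 𝓡₂) p q
  have hmem : tmul (M := (self 𝓡₁).shift p) (N := (self 𝓡₂).shift q) (1 : R₁) (1 : R₂) ∈
      (tensorObj ((self 𝓡₁).shift p) ((self 𝓡₂).shift q)).grading (-p + -q) :=
    tmul_mem rfl (one_mem_shift p) (one_mem_shift q)
  rcases Nat.eq_zero_or_pos k with rfl | hk
  · have h₁ := gExtEval_bijective ((self 𝓡₁).shift p) M₁ (n := (1 : R₁)) (one_mem_shift p) (by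
      simpa only [smul_eq_mul, mul_one] using! Function.bijective_id (α := R₁))
    have h₂ := gExtEval_bijective ((self 𝓡₂).shift q) M₂ (n := (1 : R₂)) (one_mem_shift q) (by
      simpa only [smul_eq_mul, mul_one] using! Function.bijective_id (α := R₂))
    have h₃ := gExtEval_bijective _ (tensorObj M₁ M₂) hmem hb
    -- Followed by the evaluation at `1 ⊗ 1`, the product becomes the tensor product of the
    -- evaluations at `1`, all of which are bijective.
    rw [← Function.Bijective.of_comp_iff' h₃]
    have := (TensorProduct.congr (LinearEquiv.ofBijective _ h₁)
      (LinearEquiv.ofBijective _ h₂)).bijective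
    exact (congrArg Function.Bijective (funext (gExtEval_extProdTotal
      ((self 𝓡₁).shift p) M₁ ((self 𝓡₂).shift q) M₂ (1 : R₁) (1 : R₂)))).mpr this
  -- In positive degree source and target are both zero.
  · have := projective_of_bijective_smul _ hmem hb
    have h₂ := subsingleton_gExt hk ((self 𝓡₂).shift q) M₂
    have h₃ := subsingleton_gExt hk (tensorObj ((self 𝓡₁).shift p) ((self 𝓡₂).shift q))
      (tensorObj M₁ M₂)
    have h₁ : Subsingleton (gExt 0 ((self 𝓡₁).shift p) M₁ ⊗[K] gExt k ((self 𝓡₂).shift q) M₂) :=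
      inferInstance
    exact ⟨fun _ _ _ => Subsingleton.elim _ _, fun y => ⟨0, Subsingleton.elim _ _⟩⟩

/-! ### The Künneth theorem for `Ext` of finitely generated modules -/

theorem extProdZero_isConnected (N₁ M₁ : GrMod 𝓡₁) (M₂ : GrMod 𝓡₂) :
    IsConnected (fun k N₂ => extProdZero N₁ M₁ N₂ M₂ k) :=
  fun _ _ w hS => ⟨_, _, extProdZero_isHom ⟨w, hS, rfl⟩ N₁ M₁ M₂⟩

/-- First dévissage: the second argument varies and the first is free of rank one. -/
theorem extProdZero_bijective [IsNoetherianRing R₂] (M₁ : GrMod 𝓡₁) (N₂ M₂ : GrMod 𝓡₂)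
    [Module.Finite R₂ N₂] (p : ℤ) (k : ℕ) :
    Function.Bijective (extProdZero ((self 𝓡₁).shift p) M₁ N₂ M₂ k) :=
  bijective_of_finite (extProdZero_isConnected _ M₁ M₂)
    (fun q k => extProdZero_bijective_of_free M₁ M₂ p q k) k N₂

theorem extProdSum_isConnected (M₁ : GrMod 𝓡₁) (N₂ M₂ : GrMod 𝓡₂) :
    IsConnected (fun k N₁ => extProdSum k N₁ M₁ N₂ M₂) :=
  fun _ _ w hS => ⟨_, _, extProdSum_isHom ⟨w, hS, rfl⟩ M₁ N₂ M₂⟩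

/-- For projective `N₁` all summands with positive first degree vanish, so the whole sum is its
summand of bidegree `(0, k)`. -/
theorem extProdSum_bijective_of_projective (N₁ M₁ : GrMod 𝓡₁) [Projective N₁] (N₂ M₂ : GrMod 𝓡₂)
    (k : ℕ) (h : Function.Bijective (extProdZero N₁ M₁ N₂ M₂ k)) :
    Function.Bijective (extProdSum k N₁ M₁ N₂ M₂) := by
  classical
  have hs : ∀ ij : Bidegree k, ij ≠ ⟨(0, k), zero_add k⟩ →
      Subsingleton (gExt ij.1.1 N₁ M₁ ⊗[K] gExt ij.1.2 N₂ M₂) := by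
    rintro ⟨⟨i, j⟩, hij⟩ hne
    have hi : 0 < i := by
      rcases Nat.eq_zero_or_pos i with rfl | hi
      · have hj : 0 + j = k := hij
        exact (hne (Subtype.ext (Prod.ext rfl (show j = k by omega)))).elim
      · exact hi
    have := subsingleton_gExt hi N₁ M₁
    exact inferInstance
  have key : ∀ z, extProdSum k N₁ M₁ N₂ M₂ z =
      extProdZero N₁ M₁ N₂ M₂ k (z ⟨(0, k), zero_add k⟩) := by
    intro z
    rw [extProdSum_apply, Fintype.sum_eq_single ⟨(0, k), zero_add k⟩, extProdZero]
    intro ij hne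
    have := hs ij hne
    rw [Subsingleton.elim (z ij) 0, map_zero]
  constructor
  · rw [injective_iff_map_eq_zero]
    intro z hz
    rw [key] at hz
    funext ij
    by_cases hij : ij = ⟨(0, k), zero_add k⟩
    · subst hij
      exact h.1 (hz.trans (map_zero _).symm)
    · have := hs ij hij
      exact Subsingleton.elim _ _
  · intro y
    obtain ⟨x, rfl⟩ := h.2 y
    refine ⟨Pi.single (M := fun ij : Bidegree k => gExt ij.1.1 N₁ M₁ ⊗[K] gExt ij.1.2 N₂ M₂)
      ⟨(0, k), zero_add k⟩ x, ?_⟩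
    rw [key, Pi.single_eq_same]

/-- Second dévissage: the first argument varies, with the result of the first dévissage as base
case. -/
theorem extProdSum_bijective [IsNoetherianRing R₁] [IsNoetherianRing R₂] (N₁ M₁ : GrMod 𝓡₁)
    (N₂ M₂ : GrMod 𝓡₂) [Module.Finite R₁ N₁] [Module.Finite R₂ N₂] (k : ℕ) :
    Function.Bijective (extProdSum k N₁ M₁ N₂ M₂) :=
  bijective_of_finite (extProdSum_isConnected M₁ N₂ M₂) (fun p k =>
    extProdSum_bijective_of_projective _ M₁ N₂ M₂ k (extProdZero_bijective M₁ N₂ M₂ p k)) k N₁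

/-- Transfers the bijectivity from families of tensors indexed by bidegrees, where the five lemma
was applied, to the categorical biproduct. -/
theorem isIso_extSumProd [IsNoetherianRing R₁] [IsNoetherianRing R₂] (N₁ M₁ : GrMod 𝓡₁)
    (N₂ M₂ : GrMod 𝓡₂) [Module.Finite R₁ N₁] [Module.Finite R₂ N₂] (k : ℕ) :
    IsIso (extSumProd k N₁ M₁ N₂ M₂) := by
  have key : ∀ z : LongExact.TotalTensor K (fun i => gExt i N₁ M₁) (fun j => gExt j N₂ M₂) k,
      lin (extSumProd k N₁ M₁ N₂ M₂) (∑ ij : Bidegree k, lin (biproduct.ι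
        (fun ij : Bidegree k => tensorObj (gExt ij.1.1 N₁ M₁) (gExt ij.1.2 N₂ M₂)) ij) (z ij)) =
      extProdSum k N₁ M₁ N₂ M₂ z := by
    intro z
    rw [extProdSum_apply, map_sum]
    refine Finset.sum_congr rfl fun ij _ => ?_
    exact LinearMap.congr_fun (congrArg lin (biproduct.ι_desc
      (fun ij : Bidegree k => gExtProd ij.2 N₁ M₁ N₂ M₂) ij)) (z ij)
  have h := extProdSum_bijective N₁ M₁ N₂ M₂ k
  refine isIso_of_bijective _ ⟨?_, fun y => ?_⟩
  · rw [injective_iff_map_eq_zero]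
    intro x hx
    have hz := h.1 ((key fun ij => lin (biproduct.π _ ij) x).symm.trans
      ((congrArg _ (biproduct_sum _ x)).trans (hx.trans (map_zero _).symm)))
    rw [← biproduct_sum _ x]
    exact Finset.sum_eq_zero fun ij _ => (congrArg _ (congrFun hz ij)).trans (map_zero _)
  · obtain ⟨z, rfl⟩ := h.2 y
    exact ⟨_, key z⟩

end GrMod

namespace GrMod

open Abelian

section

variable {K R : Type u} [Field K] [CommRing R] [Algebra K R] {𝓡 : ℤ → Submodule K R}

/-! ### Sequential colimits of graded modules -/

/-- An element-wise description of the colimit of a sequence of graded modules. -/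
structure IsSeqColimit (F : ℕ → GrMod 𝓡) (f : ∀ {s t}, s ≤ t → (F s ⟶ F t)) (X : GrMod 𝓡)
    (c : ∀ t, F t ⟶ X) : Prop where
  map_comp : ∀ {r s t} (h : r ≤ s) (h' : s ≤ t), f h ≫ f h' = f (h.trans h')
  w : ∀ {s t} (h : s ≤ t), f h ≫ c t = c s
  surj : ∀ x : X, ∃ t y, lin (c t) y = x
  ker : ∀ t y, lin (c t) y = 0 → ∃ (t' : ℕ) (h : t ≤ t'), lin (f h) y = 0

namespace IsSeqColimit

variable {F : ℕ → GrMod 𝓡} {f : ∀ {s t}, s ≤ t → (F s ⟶ F t)} {X : GrMod 𝓡} {c : ∀ t, F t ⟶ X}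

theorem w_apply (h : IsSeqColimit F f X c) {s t} (hst : s ≤ t) (y : F s) :
    lin (c t) (lin (f hst) y) = lin (c s) y :=
  LinearMap.congr_fun (congrArg lin (h.w hst)) y

theorem map_comp_apply (h : IsSeqColimit F f X c) {r s t} (hrs : r ≤ s) (hst : s ≤ t) (y : F r) :
    lin (f hst) (lin (f hrs) y) = lin (f (hrs.trans hst)) y :=
  LinearMap.congr_fun (congrArg lin (h.map_comp hrs hst)) y

theorem hom_ext (h : IsSeqColimit F f X c) {Z : GrMod 𝓡} {a b : X ⟶ Z}
    (hab : ∀ t, c t ≫ a = c t ≫ b) : a = b := by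
  ext x
  obtain ⟨t, y, rfl⟩ := h.surj x
  exact LinearMap.congr_fun (congrArg lin (hab t)) y

theorem exists_eq_of_eq (h : IsSeqColimit F f X c) {s t} {y : F s} {y' : F t}
    (hy : lin (c s) y = lin (c t) y') :
    ∃ (r : ℕ) (hs : s ≤ r) (ht : t ≤ r), lin (f hs) y = lin (f ht) y' := by
  obtain ⟨r, hr, h0⟩ := h.ker (max s t)
    (lin (f (le_max_left s t)) y - lin (f (le_max_right s t)) y') (by
      rw [map_sub, h.w_apply, h.w_apply, hy, sub_self])
  refine ⟨r, (le_max_left s t).trans hr, (le_max_right s t).trans hr, ?_⟩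
  rw [map_sub, h.map_comp_apply, h.map_comp_apply, sub_eq_zero] at h0
  exact h0

theorem exists_desc (h : IsSeqColimit F f X c) {Z : GrMod 𝓡} (z : ∀ t, F t ⟶ Z)
    (hz : ∀ {s t} (h : s ≤ t), f h ≫ z t = z s) : ∃ D : X ⟶ Z, ∀ t, c t ≫ D = z t := by
  choose t y hy using h.surj
  have hz' : ∀ {s t} (h : s ≤ t) (y : F s), lin (z t) (lin (f h) y) = lin (z s) y :=
    fun h y => LinearMap.congr_fun (congrArg lin (hz h)) y
  let D : X → Z := fun x => lin (z (t x)) (y x)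
  -- Two representatives of one element agree at a later stage, so `D` is independent of the chosen
  -- ones.
  have hD : ∀ s (v : F s), D (lin (c s) v) = lin (z s) v := by
    intro s v
    obtain ⟨r, hs, ht, e⟩ := h.exists_eq_of_eq (hy (lin (c s) v))
    change lin (z (t _)) (y _) = _
    rw [← hz' hs, e, hz']
  refine ⟨ofLin ⟨⟨D, fun a b => ?_⟩, fun r a => ?_⟩ fun p a ha => ?_, fun t => ?_⟩
  · obtain ⟨s, v, rfl⟩ := h.surj a
    obtain ⟨s', v', rfl⟩ := h.surj b
    rw [hD, hD, ← h.w_apply (le_max_left s s') v, ← h.w_apply (le_max_right s s') v', ← map_add, hD,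
      map_add, hz', hz']
  · obtain ⟨s, v, rfl⟩ := h.surj a
    rw [← map_smul]
    change D _ = r • D _
    rw [hD, hD, map_smul]
  · obtain ⟨s, v, rfl⟩ := h.surj a
    change D _ ∈ _
    -- The representative of a homogeneous element need not be homogeneous; its projection to degree
    -- `p` represents the same element.
    rw [← X.proj_of_mem ha, proj_lin, hD]
    exact lin_mem (z s) ((F s).proj_mem p v)
  · ext v
    exact hD t v

/-- An element killed by `D` has a representative that dies in `Z`, hence at a finite stage, hence
already in `X`. -/
theorem isIso_of_comp_eq (h : IsSeqColimit F f X c) {Z : GrMod 𝓡} {z : ∀ t, F t ⟶ Z}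
    (h' : IsSeqColimit F f Z z) (D : X ⟶ Z) (hD : ∀ t, c t ≫ D = z t) : IsIso D := by
  have hD' : ∀ t y, lin D (lin (c t) y) = lin (z t) y :=
    fun t y => LinearMap.congr_fun (congrArg lin (hD t)) y
  refine isIso_of_bijective D ⟨?_, fun x => ?_⟩
  · rw [injective_iff_map_eq_zero]
    intro x hx
    obtain ⟨t, y, rfl⟩ := h.surj x
    rw [hD'] at hx
    obtain ⟨t', ht, h0⟩ := h'.ker t y hx
    rw [← h.w_apply ht, h0, map_zero]
  · obtain ⟨t, y, rfl⟩ := h'.surj x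
    exact ⟨_, hD' t y⟩

theorem exists_iso (h : IsSeqColimit F f X c) {Z : GrMod 𝓡} {z : ∀ t, F t ⟶ Z}
    (h' : IsSeqColimit F f Z z) : ∃ e : X ≅ Z, ∀ t, c t ≫ e.hom = z t := by
  obtain ⟨D, hD⟩ := h.exists_desc z h'.w
  have := h.isIso_of_comp_eq h' D hD
  exact ⟨asIso D, hD⟩

theorem of_isIso {G : ℕ → GrMod 𝓡} {g : ∀ {s t}, s ≤ t → (G s ⟶ G t)}
    (h : IsSeqColimit F f X c) (e : ∀ t, G t ⟶ F t) [∀ t, IsIso (e t)]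
    (he : ∀ {s t} (h : s ≤ t), g h ≫ e t = e s ≫ f h) :
    IsSeqColimit G g X (fun t => e t ≫ c t) where
  map_comp {r s t} hrs hst := by
    rw [← cancel_mono (e t), Category.assoc, he, ← Category.assoc, he, Category.assoc, h.map_comp,
      he]
  w {s t} hst := by rw [← Category.assoc, he, Category.assoc, h.w]
  surj x := by
    obtain ⟨t, y, rfl⟩ := h.surj x
    obtain ⟨y', rfl⟩ := surjective_of_epi (e t) y
    exact ⟨t, y', rfl⟩
  ker t y hy := by
    obtain ⟨t', ht, h0⟩ := h.ker t (lin (e t) y) hy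
    refine ⟨t', ht, injective_of_mono (e t') ?_⟩
    rw [map_zero, ← h0]
    exact LinearMap.congr_fun (congrArg lin (he ht)) y

end IsSeqColimit

/-- The index set is finite, so the stages found for the separate summands have a common upper
bound. -/
theorem isSeqColimit_biproduct {ι : Type} [Fintype ι] {F : ι → ℕ → GrMod 𝓡}
    {f : ∀ i, ∀ {s t}, s ≤ t → (F i s ⟶ F i t)} {X : ι → GrMod 𝓡} {c : ∀ i t, F i t ⟶ X i}
    (h : ∀ i, IsSeqColimit (F i) (f i) (X i) (c i)) :
    IsSeqColimit (fun t => ⨁ fun i => F i t) (fun h => biproduct.map fun i => f i h) (⨁ X)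
      (fun t => biproduct.map fun i => c i t) where
  map_comp hrs hst := by
    refine biproduct.hom_ext' _ _ fun i => ?_
    rw [biproduct.ι_map_assoc, biproduct.ι_map, biproduct.ι_map, ← Category.assoc,
      (h i).map_comp]
  w hst := by
    refine biproduct.hom_ext' _ _ fun i => ?_
    rw [biproduct.ι_map_assoc, biproduct.ι_map, biproduct.ι_map, ← Category.assoc, (h i).w]
  surj x := by
    choose t y hy using fun i => (h i).surj (lin (biproduct.π X i) x)
    let m := Finset.univ.sup t
    have hm : ∀ i, t i ≤ m := fun i => Finset.le_sup (Finset.mem_univ i)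
    refine ⟨m, ∑ i, lin (biproduct.ι (fun i => F i m) i) (lin (f i (hm i)) (y i)), ?_⟩
    rw [map_sum]
    refine Eq.trans ?_ (biproduct_sum X x)
    refine Finset.sum_congr rfl fun i _ => ?_
    rw [← hy, ← (h i).w_apply (hm i)]
    exact LinearMap.congr_fun (congrArg lin (biproduct.ι_map (fun i => c i m) i)) _
  ker t y hy := by
    have hi : ∀ i, lin (c i t) (lin (biproduct.π (fun i => F i t) i) y) = 0 := by
      intro i
      have := LinearMap.congr_fun (congrArg lin (biproduct.map_π (fun i => c i t) i)) y
      refine this.symm.trans ((congrArg (lin (biproduct.π X i)) hy).trans (map_zero _))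
    choose t' ht h0 using fun i => (h i).ker t _ (hi i)
    let m := max t (Finset.univ.sup t')
    have hm : ∀ i, t' i ≤ m :=
      fun i => (Finset.le_sup (Finset.mem_univ i)).trans (le_max_right _ _)
    refine ⟨m, le_max_left _ _, ?_⟩
    rw [← biproduct_sum _ (lin (biproduct.map fun i => f i (le_max_left t _)) y)]
    refine Finset.sum_eq_zero fun i _ => ?_
    have := LinearMap.congr_fun (congrArg lin
      (biproduct.map_π (fun i => f i (le_max_left t (Finset.univ.sup t'))) i)) y
    refine (congrArg _ this).trans ?_
    change lin _ (lin (f i _) (lin (biproduct.π (fun i => F i t) i) y)) = 0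
    rw [← (h i).map_comp_apply (ht i) (hm i), h0, map_zero, map_zero]

/-! The colimit of a functor on `ℕ` is a sequential colimit. -/

/-- The map to the `n`-th term of a sequence from the direct sum of all terms. -/
def seqSumToTerm (F : ℕ ⥤ GrMod 𝓡) (n : ℕ) :
    dsum (fun j : ULift.{u} ℕ => F.obj j.down) ⟶ F.obj n :=
  -- The value zero beyond stage `n` is harmless: for each element only its images at all
  -- sufficiently late stages are considered.
  dsumDesc _ fun j => if h : j.down ≤ n then F.map (homOfLE h) else 0

theorem seqSumToTerm_ι (F : ℕ ⥤ GrMod 𝓡) {t n : ℕ} (h : t ≤ n) (y : F.obj t) :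
    lin (seqSumToTerm F n) (lin (dsumι (fun j : ULift.{u} ℕ => F.obj j.down) ⟨t⟩) y) =
      lin (F.map (homOfLE h)) y := by
  have := LinearMap.congr_fun (congrArg lin (dsumι_desc (fun j : ULift.{u} ℕ => F.obj j.down)
    (fun j => if h : j.down ≤ n then F.map (homOfLE h) else 0) ⟨t⟩)) y
  rw [dif_pos h] at this
  exact this

/-- The elements of the direct sum of the terms of a sequence that vanish in the colimit. -/
def seqRelations (F : ℕ ⥤ GrMod 𝓡) :
    Submodule R (dsum (fun j : ULift.{u} ℕ => F.obj j.down)) where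
  carrier := {z | ∃ m, ∀ n, m ≤ n → lin (seqSumToTerm F n) z = 0}
  zero_mem' := ⟨0, fun _ _ => map_zero _⟩
  add_mem' := by
    rintro x y ⟨m, hm⟩ ⟨m', hm'⟩
    refine ⟨max m m', fun n hn => ?_⟩
    rw [map_add, hm n ((le_max_left _ _).trans hn), hm' n ((le_max_right _ _).trans hn), add_zero]
  smul_mem' := by
    rintro r x ⟨m, hm⟩
    exact ⟨m, fun n hn => by rw [map_smul, hm n hn, smul_zero]⟩

theorem seqRelations_isHomog (F : ℕ ⥤ GrMod 𝓡) : IsHomog _ (seqRelations F) := by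
  rintro x ⟨m, hm⟩ p
  exact ⟨m, fun n hn => by rw [← proj_lin, hm n hn, map_zero]⟩

/-- A cocone that detects the elements that vanish in the colimit. -/
def seqCocone (F : ℕ ⥤ GrMod 𝓡) : Cocone F where
  pt := quot _ _ (seqRelations_isHomog F)
  ι :=
    { app t := dsumι (fun j : ULift.{u} ℕ => F.obj j.down) ⟨t⟩ ≫ quotπ _ _ (seqRelations_isHomog F)
      naturality s t hst := by
        ext y
        -- From stage `t` on, `y` and its image in `F.obj t` have the same image.
        refine (Submodule.Quotient.eq _).2 ⟨t, fun n hn => ?_⟩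
        have e := seqSumToTerm_ι F hn (lin (F.map hst) y)
        have e' := seqSumToTerm_ι F ((leOfHom hst).trans hn) y
        rw [map_sub, sub_eq_zero]
        refine e.trans (Eq.trans ?_ e'.symm)
        have := F.map_comp hst (homOfLE hn)
        exact (LinearMap.congr_fun (congrArg lin this) y).symm }

/-- Turns the universal property into statements about elements: uniqueness of maps out of the
colimit gives surjectivity, and comparison with `seqCocone` gives the description of the kernels. -/
theorem isSeqColimit_of_isColimit {F : ℕ ⥤ GrMod 𝓡} (c : Cocone F) (hc : IsColimit c) :
    IsSeqColimit F.obj (fun h => F.map (homOfLE h)) c.pt c.ι.app where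
  map_comp h h' := (F.map_comp _ _).symm
  w h := c.w _
  surj x := by
    have hdir : Directed (· ≤ ·) fun t => LinearMap.range (lin (c.ι.app t)) := by
      refine Monotone.directed_le fun s t hst => ?_
      rintro _ ⟨y, rfl⟩
      exact ⟨lin (F.map (homOfLE hst)) y, LinearMap.congr_fun (congrArg lin (c.w (homOfLE hst))) y⟩
    have hmem : ∀ x, x ∈ ⨆ t, LinearMap.range (lin (c.ι.app t)) ↔ ∃ t y, lin (c.ι.app t) y = x :=
      fun x => Submodule.mem_iSup_of_directed _ hdir
    have hQ : c.pt.IsHomog (⨆ t, LinearMap.range (lin (c.ι.app t))) := by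
      intro x hx p
      obtain ⟨t, y, rfl⟩ := (hmem x).1 hx
      exact (hmem _).2 ⟨t, (F.obj t).proj p y, (proj_lin _ p y).symm⟩
    -- The quotient by the union of the images vanishes on every term, so its projection is zero and
    -- the union is everything.
    have h0 : c.pt.quotπ _ hQ = 0 := hc.hom_ext fun t => by
      ext y
      exact (Submodule.Quotient.mk_eq_zero _).2 ((hmem _).2 ⟨t, y, rfl⟩)
    exact (hmem x).1 ((Submodule.Quotient.mk_eq_zero _).1
      (LinearMap.congr_fun (congrArg lin h0) x))
  ker t y hy := by
    have e := LinearMap.congr_fun (congrArg lin (hc.fac (seqCocone F) t)) y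
    -- An element that is zero in the colimit is zero in every cocone; in `seqCocone` this means
    -- that its images vanish at all late stages.
    have e' : lin ((seqCocone F).ι.app t) y = 0 :=
      e.symm.trans ((congrArg (lin (hc.desc (seqCocone F))) hy).trans (map_zero _))
    obtain ⟨m, hm⟩ := (Submodule.Quotient.mk_eq_zero _).1 e'
    exact ⟨max t m, le_max_left t m,
      (seqSumToTerm_ι F (le_max_left t m) y).symm.trans (hm _ (le_max_right t m))⟩

/-- Local cohomology is defined as a colimit of functors, and evaluation at `M` preserves colimits.
-/
theorem isSeqColimit_localCohomology [GradedAlgebra 𝓡] (i : ℕ) (M : GrMod 𝓡) :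
    IsSeqColimit (fun t => gExt i (quotPow 𝓡 t) M)
      (fun h => gExtMap i (quotPowMap 𝓡 h) (𝟙 M)) ((localCohomology 𝓡 i).obj M)
      (fun t => toLocalCohomology 𝓡 i t M) :=
  isSeqColimit_of_isColimit _ (isColimitOfPreserves ((evaluation _ _).obj M)
    (colimit.isColimit (quotPowSystem 𝓡 ⋙ gExtFunctor 𝓡 i)))

end

end GrMod

namespace GrMod

section

variable {K R₁ R₂ : Type u} [Field K] [CommRing R₁] [CommRing R₂] [Algebra K R₁] [Algebra K R₂]
variable {𝓡₁ : ℤ → Submodule K R₁} {𝓡₂ : ℤ → Submodule K R₂}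

/-! ### Tensor products of sequential colimits -/

theorem tensor_induction {M : GrMod 𝓡₁} {N : GrMod 𝓡₂} {P : tensorObj M N → Prop}
    (zero : P 0) (tmul : ∀ x y, P (tmul x y)) (add : ∀ x y, P x → P y → P (x + y)) (z) : P z :=
  TensorProduct.induction_on (motive := P) z zero tmul add

theorem tensorMap_comp_apply {M M' M'' : GrMod 𝓡₁} {N N' N'' : GrMod 𝓡₂} (f : M ⟶ M')
    (f' : M' ⟶ M'') (g : N ⟶ N') (g' : N' ⟶ N'') (z : tensorObj M N) :
    lin (tensorMap f' g') (lin (tensorMap f g) z) = lin (tensorMap (f ≫ f') (g ≫ g')) z :=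
  (LinearMap.congr_fun (congrArg lin (tensorMap_comp f f' g g')) z).symm

namespace IsSeqColimit

variable {F : ℕ → GrMod 𝓡₁} {f : ∀ {s t}, s ≤ t → (F s ⟶ F t)} {X : GrMod 𝓡₁} {c : ∀ t, F t ⟶ X}
variable {G : ℕ → GrMod 𝓡₂} {g : ∀ {s t}, s ≤ t → (G s ⟶ G t)} {Y : GrMod 𝓡₂} {d : ∀ t, G t ⟶ Y}

/-- By flatness the kernel of `c t ⊗ N` is spanned by tensors `x ⊗ y` with `x` in the kernel of `c
t`. Each of the finitely many tensors needed dies at a finite stage. -/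
theorem exists_tensorMap_id_eq_zero (h : IsSeqColimit F f X c) (N : GrMod 𝓡₂) (t : ℕ)
    (z : tensorObj (F t) N) (hz : lin (tensorMap (c t) (𝟙 N)) z = 0) :
    ∃ (t' : ℕ) (ht : t ≤ t'), lin (tensorMap (f ht) (𝟙 N)) z = 0 := by
  have hex : Function.Exact ((LinearMap.ker (lin (c t))).subtype.restrictScalars K)
      ((lin (c t)).restrictScalars K) := LinearMap.exact_subtype_ker_map (lin (c t))
  obtain ⟨w, rfl⟩ := (Module.Flat.rTensor_exact (M := N) hex z).1 hz
  clear hz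
  induction w using TensorProduct.induction_on with
  | zero => exact ⟨t, le_rfl, by rw [map_zero]; exact map_zero _⟩
  | tmul x y =>
    obtain ⟨t', ht, h0⟩ := h.ker t x.1 x.2
    refine ⟨t', ht, ?_⟩
    change lin (f ht) x.1 ⊗ₜ[K] y = 0
    rw [h0, TensorProduct.zero_tmul]
  | add x y hx hy =>
    obtain ⟨r, hr, hx⟩ := hx
    obtain ⟨s, hs, hy⟩ := hy
    refine ⟨max r s, hr.trans (le_max_left r s), ?_⟩
    have e : ∀ {r} (hr : t ≤ r) {m} (hm : r ≤ m) (z : tensorObj (F t) N),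
        lin (tensorMap (f hr) (𝟙 N)) z = 0 → lin (tensorMap (f (hr.trans hm)) (𝟙 N)) z = 0 := by
      intro r hr m hm z hz
      have := tensorMap_comp_apply (f hr) (f hm) (𝟙 N) (𝟙 N) z
      rw [hz, map_zero, h.map_comp, Category.comp_id] at this
      exact this.symm
    rw [map_add]
    refine (map_add (lin (tensorMap _ _)) _ _).trans ?_
    refine (congrArg₂ (· + ·) (e hr (le_max_left r s) _ hx) (e hs (le_max_right r s) _ hy)).trans ?_
    exact add_zero _

theorem exists_id_tensorMap_eq_zero (h : IsSeqColimit G g Y d) (M : GrMod 𝓡₁) (t : ℕ)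
    (z : tensorObj M (G t)) (hz : lin (tensorMap (𝟙 M) (d t)) z = 0) :
    ∃ (t' : ℕ) (ht : t ≤ t'), lin (tensorMap (𝟙 M) (g ht)) z = 0 := by
  have hex : Function.Exact ((LinearMap.ker (lin (d t))).subtype.restrictScalars K)
      ((lin (d t)).restrictScalars K) := LinearMap.exact_subtype_ker_map (lin (d t))
  obtain ⟨w, rfl⟩ := (Module.Flat.lTensor_exact (M := M) hex z).1 hz
  clear hz
  induction w using TensorProduct.induction_on with
  | zero => exact ⟨t, le_rfl, by rw [map_zero]; exact map_zero _⟩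
  | tmul y x =>
    obtain ⟨t', ht, h0⟩ := h.ker t x.1 x.2
    refine ⟨t', ht, ?_⟩
    change y ⊗ₜ[K] lin (g ht) x.1 = 0
    rw [h0, TensorProduct.tmul_zero]
  | add x y hx hy =>
    obtain ⟨r, hr, hx⟩ := hx
    obtain ⟨s, hs, hy⟩ := hy
    refine ⟨max r s, hr.trans (le_max_left r s), ?_⟩
    have e : ∀ {r} (hr : t ≤ r) {m} (hm : r ≤ m) (z : tensorObj M (G t)),
        lin (tensorMap (𝟙 M) (g hr)) z = 0 → lin (tensorMap (𝟙 M) (g (hr.trans hm))) z = 0 := by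
      intro r hr m hm z hz
      have := tensorMap_comp_apply (𝟙 M) (𝟙 M) (g hr) (g hm) z
      rw [hz, map_zero, h.map_comp, Category.comp_id] at this
      exact this.symm
    rw [map_add]
    refine (map_add (lin (tensorMap _ _)) _ _).trans ?_
    refine (congrArg₂ (· + ·) (e hr (le_max_left r s) _ hx) (e hs (le_max_right r s) _ hy)).trans ?_
    exact add_zero _

/-- Both factors run along the same index: the diagonal is cofinal among pairs of stages. -/
theorem tensor (h : IsSeqColimit F f X c) (h' : IsSeqColimit G g Y d) :
    IsSeqColimit (fun t => tensorObj (F t) (G t)) (fun h => tensorMap (f h) (g h))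
      (tensorObj X Y) (fun t => tensorMap (c t) (d t)) where
  map_comp hrs hst := by rw [← tensorMap_comp, h.map_comp, h'.map_comp]
  w hst := by rw [← tensorMap_comp, h.w, h'.w]
  surj z := by
    induction z using tensor_induction with
    | zero => exact ⟨0, 0, map_zero _⟩
    | tmul x y =>
      obtain ⟨s, x, rfl⟩ := h.surj x
      obtain ⟨t, y, rfl⟩ := h'.surj y
      refine ⟨max s t, GrMod.tmul (lin (f (le_max_left s t)) x) (lin (g (le_max_right s t)) y), ?_⟩
      rw [tensorMap_tmul, h.w_apply, h'.w_apply]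
    | add x y hx hy =>
      obtain ⟨s, x, rfl⟩ := hx
      obtain ⟨t, y, rfl⟩ := hy
      refine ⟨max s t, lin (tensorMap (f (le_max_left s t)) (g (le_max_left s t))) x +
        lin (tensorMap (f (le_max_right s t)) (g (le_max_right s t))) y, ?_⟩
      rw [map_add, tensorMap_comp_apply, tensorMap_comp_apply, h.w, h.w, h'.w, h'.w]
  ker t z hz := by
    -- The map `c t ⊗ d t` is factored through `F t ⊗ Y`, so that one tensor factor passes to the
    -- limit at a time.
    have e : lin (tensorMap (c t) (𝟙 Y)) (lin (tensorMap (𝟙 (F t)) (d t)) z) = 0 := by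
      rw [tensorMap_comp_apply, Category.id_comp, Category.comp_id, hz]
    obtain ⟨r, hr, h0⟩ := h.exists_tensorMap_id_eq_zero Y t _ e
    have e' : lin (tensorMap (𝟙 (F r)) (d t)) (lin (tensorMap (f hr) (𝟙 (G t))) z) = 0 := by
      rw [tensorMap_comp_apply, Category.id_comp, Category.comp_id] at h0 ⊢
      exact h0
    obtain ⟨s, hs, h1⟩ := h'.exists_id_tensorMap_eq_zero (F r) t _ e'
    refine ⟨max r s, hr.trans (le_max_left r s), ?_⟩
    rw [tensorMap_comp_apply, Category.id_comp, Category.comp_id] at h1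
    have := tensorMap_comp_apply (f hr) (f (le_max_left r s)) (g hs) (g (le_max_right r s)) z
    rw [h1, map_zero, h.map_comp, h'.map_comp] at this
    exact this.symm

end IsSeqColimit

variable [GradedAlgebra 𝓡₁] [GradedAlgebra 𝓡₂]

theorem isSeqColimit_lcSum (k : ℕ) (M₁ : GrMod 𝓡₁) (M₂ : GrMod 𝓡₂) :
    IsSeqColimit (fun t => extSum k (quotPow 𝓡₁ t) M₁ (quotPow 𝓡₂ t) M₂)
      (fun h => extSumMap k (quotPowMap 𝓡₁ h) (𝟙 M₁) (quotPowMap 𝓡₂ h) (𝟙 M₂))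
      (lcSum k M₁ M₂) (fun t => extSumToLcSum k t M₁ M₂) :=
  isSeqColimit_biproduct fun ij : Bidegree k =>
    (isSeqColimit_localCohomology ij.1.1 M₁).tensor (isSeqColimit_localCohomology ij.1.2 M₂)

end

end GrMod

namespace GrMod

section

variable {K R : Type u} [Field K] [CommRing R] [Algebra K R] {𝓡 : ℤ → Submodule K R}

/-! ### Tensor products of the quotients by powers of the irrelevant ideals -/

theorem exists_desc_of_surjective {A B Z : GrMod 𝓡} (e : A ⟶ B)
    (he : Function.Surjective (lin e)) (f : A ⟶ Z)
    (hf : LinearMap.ker (lin e) ≤ LinearMap.ker (lin f)) : ∃ g : B ⟶ Z, e ≫ g = f := by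
  let l : B →ₗ[R] Z := (LinearMap.ker (lin e)).liftQ (lin f) hf ∘ₗ
    ((lin e).quotKerEquivOfSurjective he).symm.toLinearMap
  have hl : ∀ x, l (lin e x) = lin f x := by
    intro x
    have : ((lin e).quotKerEquivOfSurjective he).symm (lin e x) =
        (LinearMap.ker (lin e)).mkQ x := by
      rw [LinearEquiv.symm_apply_eq]
      rfl
    change (LinearMap.ker (lin e)).liftQ (lin f) hf _ = _
    rw [LinearEquiv.coe_coe, this, Submodule.mkQ_apply, Submodule.liftQ_apply]
  refine ⟨ofLin l fun p y hy => ?_, by ext x; exact hl x⟩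
  obtain ⟨x, rfl⟩ := he y
  rw [← B.proj_of_mem hy, proj_lin, hl]
  exact lin_mem f (A.proj_mem p x)

variable [GradedAlgebra 𝓡]

theorem exists_smul_quotPowOne {t : ℕ} (x : quotPow 𝓡 t) : ∃ r : R, r • quotPowOne 𝓡 t = x := by
  obtain ⟨r, rfl⟩ := Submodule.mkQ_surjective _ x
  refine ⟨r, ?_⟩
  change Submodule.mkQ _ (r • (1 : R)) = _
  rw [smul_eq_mul, mul_one]

theorem smul_quotPowOne_eq_zero {t : ℕ} {r : R} (hr : r ∈ irrelevant 𝓡 ^ t) :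
    r • quotPowOne 𝓡 t = 0 := by
  change Submodule.mkQ _ (r • (1 : R)) = _
  rw [smul_eq_mul, mul_one]
  exact (Submodule.Quotient.mk_eq_zero _).2 hr

theorem quotPowOne_mem (t : ℕ) : quotPowOne 𝓡 t ∈ (quotPow 𝓡 t).grading 0 :=
  ⟨(1 : R), SetLike.one_mem_graded 𝓡, rfl⟩

theorem quotPow_hom_ext {t : ℕ} {Z : GrMod 𝓡} {f g : quotPow 𝓡 t ⟶ Z}
    (h : lin f (quotPowOne 𝓡 t) = lin g (quotPowOne 𝓡 t)) : f = g := by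
  ext x
  obtain ⟨r, rfl⟩ := exists_smul_quotPowOne x
  rw [map_smul, map_smul, h]

theorem lin_quotPowMap_quotPowOne {s t : ℕ} (h : s ≤ t) :
    lin (quotPowMap 𝓡 h) (quotPowOne 𝓡 t) = quotPowOne 𝓡 s := rfl

/-- Multiplication of scalars with an element of degree zero. -/
def smulElement {Z : GrMod 𝓡} (z : Z) (hz : z ∈ Z.grading 0) : self 𝓡 ⟶ Z :=
  ofLin (LinearMap.toSpanSingleton R Z z) fun p r hr => by
    have := Z.smul_mem' hr hz
    rwa [add_zero] at this

theorem lin_smulElement {Z : GrMod 𝓡} (z : Z) (hz : z ∈ Z.grading 0) (r : R) :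
    lin (smulElement z hz) r = r • z := rfl

theorem exists_quotPow_hom {t : ℕ} {Z : GrMod 𝓡} (z : Z) (hz : z ∈ Z.grading 0)
    (h : ∀ r ∈ irrelevant 𝓡 ^ t, r • z = 0) :
    ∃ f : quotPow 𝓡 t ⟶ Z, lin f (quotPowOne 𝓡 t) = z :=
  ⟨quotDesc _ _ (irrelevant_pow_isHomog t) (smulElement z hz) h, one_smul R z⟩

end

section

variable {K R₁ R₂ : Type u} [Field K] [CommRing R₁] [CommRing R₂] [Algebra K R₁] [Algebra K R₂]
variable {𝓡₁ : ℤ → Submodule K R₁} {𝓡₂ : ℤ → Submodule K R₂}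

theorem smul_tmul {M : GrMod 𝓡₁} {N : GrMod 𝓡₂} (r : R₁) (s : R₂) (x : M) (y : N) :
    (r ⊗ₜ[K] s) • tmul x y = tmul (r • x) (s • y) := rfl

variable (𝓡₁ 𝓡₂) in
/-- The sum of the ideals of `R₁ ⊗ R₂` generated by `𝔪₁ ^ s` and `𝔪₂ ^ t`. -/
def irrelevantSup (s t : ℕ) : Ideal (R₁ ⊗[K] R₂) :=
  (irrelevant 𝓡₁ ^ s).map (Algebra.TensorProduct.includeLeft : R₁ →ₐ[K] R₁ ⊗[K] R₂) ⊔
    (irrelevant 𝓡₂ ^ t).map (Algebra.TensorProduct.includeRight : R₂ →ₐ[K] R₁ ⊗[K] R₂)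

theorem tmul_mem_irrelevantSup_left {s t : ℕ} {a : R₁} (ha : a ∈ irrelevant 𝓡₁ ^ s) (b : R₂) :
    a ⊗ₜ[K] b ∈ irrelevantSup 𝓡₁ 𝓡₂ s t := by
  refine Ideal.mem_sup_left ?_
  have := Ideal.mul_mem_left _ ((1 : R₁) ⊗ₜ[K] b) (Ideal.mem_map_of_mem
    (Algebra.TensorProduct.includeLeft : R₁ →ₐ[K] R₁ ⊗[K] R₂) ha)
  rwa [Algebra.TensorProduct.includeLeft_apply, Algebra.TensorProduct.tmul_mul_tmul, one_mul,
    mul_one] at this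

theorem tmul_mem_irrelevantSup_right {s t : ℕ} (a : R₁) {b : R₂} (hb : b ∈ irrelevant 𝓡₂ ^ t) :
    a ⊗ₜ[K] b ∈ irrelevantSup 𝓡₁ 𝓡₂ s t := by
  refine Ideal.mem_sup_right ?_
  have := Ideal.mul_mem_left _ (a ⊗ₜ[K] (1 : R₂)) (Ideal.mem_map_of_mem
    (Algebra.TensorProduct.includeRight : R₂ →ₐ[K] R₁ ⊗[K] R₂) hb)
  rwa [Algebra.TensorProduct.includeRight_apply, Algebra.TensorProduct.tmul_mul_tmul, one_mul,
    mul_one] at this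

theorem irrelevantSup_le {s t : ℕ} {J : Ideal (R₁ ⊗[K] R₂)}
    (h₁ : ∀ a ∈ irrelevant 𝓡₁ ^ s, a ⊗ₜ[K] (1 : R₂) ∈ J)
    (h₂ : ∀ b ∈ irrelevant 𝓡₂ ^ t, (1 : R₁) ⊗ₜ[K] b ∈ J) : irrelevantSup 𝓡₁ 𝓡₂ s t ≤ J :=
  sup_le (Ideal.map_le_iff_le_comap.2 h₁) (Ideal.map_le_iff_le_comap.2 h₂)

/-- If `p + q` is positive then `p` or `q` is positive, so one of the two tensor factors lies in its
irrelevant ideal. -/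
theorem irrelevant_le : irrelevant (tensorGrading 𝓡₁ 𝓡₂) ≤ irrelevantSup 𝓡₁ 𝓡₂ 1 1 := by
  refine Ideal.span_le.2 ?_
  rintro r ⟨n, hn, hr⟩
  have hle : tensorGrading 𝓡₁ 𝓡₂ n ≤ (irrelevantSup 𝓡₁ 𝓡₂ 1 1).restrictScalars K := by
    refine Submodule.span_le.2 ?_
    rintro _ ⟨p, q, h, v, hv, w, hw, rfl⟩
    rcases lt_or_ge 0 p with hp | hp
    · refine tmul_mem_irrelevantSup_left ?_ w
      rw [pow_one]
      exact Ideal.subset_span ⟨p, hp, hv⟩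
    · refine tmul_mem_irrelevantSup_right v ?_
      rw [pow_one]
      exact Ideal.subset_span ⟨q, by omega, hw⟩
  exact hle hr

/-- In a product of `s + t` elements of `I + J`, expanded, every term contains `s` factors from `I`
or `t` factors from `J`. -/
theorem irrelevant_pow_add_le (s t : ℕ) :
    irrelevant (tensorGrading 𝓡₁ 𝓡₂) ^ (s + t) ≤ irrelevantSup 𝓡₁ 𝓡₂ s t := by
  refine (Ideal.pow_right_mono irrelevant_le _).trans ?_
  refine (Ideal.sup_pow_add_le_pow_sup_pow).trans ?_
  rw [irrelevantSup, pow_one, pow_one, Ideal.map_pow, Ideal.map_pow]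

variable [GradedAlgebra 𝓡₁] [GradedAlgebra 𝓡₂]

theorem irrelevantSup_le_irrelevant_pow (t : ℕ) :
    irrelevantSup 𝓡₁ 𝓡₂ t t ≤ irrelevant (tensorGrading 𝓡₁ 𝓡₂) ^ t := by
  rw [irrelevantSup, Ideal.map_pow, Ideal.map_pow]
  refine sup_le (Ideal.pow_right_mono ?_ t) (Ideal.pow_right_mono ?_ t)
  · refine Ideal.map_le_iff_le_comap.2 (Ideal.span_le.2 ?_)
    rintro a ⟨n, hn, ha⟩
    exact Ideal.subset_span ⟨n, hn, tmul_mem_tensorGrading (add_zero n) ha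
      (SetLike.one_mem_graded 𝓡₂)⟩
  · refine Ideal.map_le_iff_le_comap.2 (Ideal.span_le.2 ?_)
    rintro a ⟨n, hn, ha⟩
    exact Ideal.subset_span ⟨n, hn, tmul_mem_tensorGrading (zero_add n)
      (SetLike.one_mem_graded 𝓡₁) ha⟩

theorem smul_tmul_quotPowOne_eq_zero {s t : ℕ} {r : R₁ ⊗[K] R₂}
    (hr : r ∈ irrelevantSup 𝓡₁ 𝓡₂ s t) :
    r • tmul (quotPowOne 𝓡₁ s) (quotPowOne 𝓡₂ t) = 0 := by
  have : irrelevantSup 𝓡₁ 𝓡₂ s t ≤ LinearMap.ker (LinearMap.toSpanSingleton (R₁ ⊗[K] R₂) _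
      (tmul (quotPowOne 𝓡₁ s) (quotPowOne 𝓡₂ t))) := by
    refine irrelevantSup_le (fun a ha => ?_) fun b hb => ?_
    · refine (smul_tmul a (1 : R₂) (quotPowOne 𝓡₁ s) (quotPowOne 𝓡₂ t)).trans ?_
      rw [smul_quotPowOne_eq_zero ha]
      exact TensorProduct.zero_tmul _ _
    · refine (smul_tmul (1 : R₁) b (quotPowOne 𝓡₁ s) (quotPowOne 𝓡₂ t)).trans ?_
      rw [smul_quotPowOne_eq_zero hb]
      exact TensorProduct.tmul_zero _ _
  exact this hr

theorem exists_smul_tmul_quotPowOne {s t : ℕ} (x : tensorObj (quotPow 𝓡₁ s) (quotPow 𝓡₂ t)) :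
    ∃ r : R₁ ⊗[K] R₂, r • tmul (quotPowOne 𝓡₁ s) (quotPowOne 𝓡₂ t) = x := by
  induction x using tensor_induction with
  | zero => exact ⟨0, zero_smul _ _⟩
  | tmul x y =>
    obtain ⟨a, rfl⟩ := exists_smul_quotPowOne x
    obtain ⟨b, rfl⟩ := exists_smul_quotPowOne y
    exact ⟨a ⊗ₜ b, rfl⟩
  | add x y hx hy =>
    obtain ⟨a, rfl⟩ := hx
    obtain ⟨b, rfl⟩ := hy
    exact ⟨a + b, add_smul _ _ _⟩

/-- The kernel of a tensor product of two surjections is generated by the tensors with one factor in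
the respective kernel. Hence the annihilator of `1 ⊗ 1` is no larger than the sum of the two ideals.
-/
theorem mem_irrelevantSup_of_smul_eq_zero {s t : ℕ} {r : R₁ ⊗[K] R₂}
    (hr : r • tmul (quotPowOne 𝓡₁ s) (quotPowOne 𝓡₂ t) = 0) :
    r ∈ irrelevantSup 𝓡₁ 𝓡₂ s t := by
  let i₁ : ↥(irrelevant 𝓡₁ ^ s) →ₗ[K] R₁ := (irrelevant 𝓡₁ ^ s).subtype.restrictScalars K
  let i₂ : ↥(irrelevant 𝓡₂ ^ t) →ₗ[K] R₂ := (irrelevant 𝓡₂ ^ t).subtype.restrictScalars K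
  let q₁ : R₁ →ₗ[K] quotPow 𝓡₁ s := (irrelevant 𝓡₁ ^ s).mkQ.restrictScalars K
  let q₂ : R₂ →ₗ[K] quotPow 𝓡₂ t := (irrelevant 𝓡₂ ^ t).mkQ.restrictScalars K
  have e₁ : Function.Exact i₁ q₁ := LinearMap.exact_subtype_mkQ (irrelevant 𝓡₁ ^ s)
  have e₂ : Function.Exact i₂ q₂ := LinearMap.exact_subtype_mkQ (irrelevant 𝓡₂ ^ t)
  have hker := TensorProduct.map_ker e₁ (Submodule.mkQ_surjective (irrelevant 𝓡₁ ^ s)) e₂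
    (Submodule.mkQ_surjective (irrelevant 𝓡₂ ^ t))
  have hmap : ∀ r : R₁ ⊗[K] R₂, r • tmul (quotPowOne 𝓡₁ s) (quotPowOne 𝓡₂ t) =
      TensorProduct.map q₁ q₂ r := by
    intro r
    induction r using TensorProduct.induction_on with
    | zero => rw [map_zero, zero_smul]; rfl
    | add x y hx hy => rw [map_add, add_smul, hx, hy]; rfl
    | tmul a b =>
      refine (smul_tmul a b (quotPowOne 𝓡₁ s) (quotPowOne 𝓡₂ t)).trans ?_
      change ((irrelevant 𝓡₁ ^ s).mkQ (a • (1 : R₁))) ⊗ₜ[K]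
        ((irrelevant 𝓡₂ ^ t).mkQ (b • (1 : R₂))) = _
      rw [smul_eq_mul, smul_eq_mul, mul_one, mul_one]
      rfl
  have hmem : r ∈ LinearMap.ker (TensorProduct.map q₁ q₂) := (hmap r).symm.trans hr
  rw [hker] at hmem
  have hle : LinearMap.range (LinearMap.lTensor R₁ i₂) ⊔ LinearMap.range (LinearMap.rTensor R₂ i₁) ≤
      (irrelevantSup 𝓡₁ 𝓡₂ s t).restrictScalars K := by
    refine sup_le ?_ ?_
    · rintro _ ⟨x, rfl⟩
      induction x using TensorProduct.induction_on with
      | zero => rw [map_zero]; exact zero_mem _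
      | add x y hx hy => rw [map_add]; exact add_mem hx hy
      | tmul a b => exact tmul_mem_irrelevantSup_right a b.2
    · rintro _ ⟨x, rfl⟩
      induction x using TensorProduct.induction_on with
      | zero => rw [map_zero]; exact zero_mem _
      | add x y hx hy => rw [map_add]; exact add_mem hx hy
      | tmul a b => exact tmul_mem_irrelevantSup_left a.2 b
  exact hle hmem

theorem tensor_quotPow_hom_ext {s t : ℕ} {Z : GrMod (tensorGrading 𝓡₁ 𝓡₂)}
    {f g : tensorObj (quotPow 𝓡₁ s) (quotPow 𝓡₂ t) ⟶ Z}
    (h : lin f (tmul (quotPowOne 𝓡₁ s) (quotPowOne 𝓡₂ t)) =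
      lin g (tmul (quotPowOne 𝓡₁ s) (quotPowOne 𝓡₂ t))) : f = g := by
  ext x
  obtain ⟨r, rfl⟩ := exists_smul_tmul_quotPowOne x
  rw [map_smul, map_smul, h]

theorem tmul_quotPowOne_mem (s t : ℕ) : tmul (quotPowOne 𝓡₁ s) (quotPowOne 𝓡₂ t) ∈
    (tensorObj (quotPow 𝓡₁ s) (quotPow 𝓡₂ t)).grading 0 :=
  tmul_mem (add_zero 0) (quotPowOne_mem s) (quotPowOne_mem t)

variable (𝓡₁ 𝓡₂)

theorem exists_quotPow_hom_tensor (s t : ℕ) :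
    ∃ π : quotPow (tensorGrading 𝓡₁ 𝓡₂) (s + t) ⟶ tensorObj (quotPow 𝓡₁ s) (quotPow 𝓡₂ t),
      lin π (quotPowOne (tensorGrading 𝓡₁ 𝓡₂) (s + t)) =
        tmul (quotPowOne 𝓡₁ s) (quotPowOne 𝓡₂ t) :=
  exists_quotPow_hom _ (tmul_quotPowOne_mem s t) fun _ hr =>
    smul_tmul_quotPowOne_eq_zero (irrelevant_pow_add_le s t hr)

/-- The tensor product is cyclic on `1 ⊗ 1` and its annihilator is contained in `𝔪 ^ t`, so `1 ⊗ 1`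
may be sent to `1`. -/
theorem exists_tensor_hom_quotPow (t : ℕ) :
    ∃ ρ : tensorObj (quotPow 𝓡₁ t) (quotPow 𝓡₂ t) ⟶ quotPow (tensorGrading 𝓡₁ 𝓡₂) t,
      lin ρ (tmul (quotPowOne 𝓡₁ t) (quotPowOne 𝓡₂ t)) =
        quotPowOne (tensorGrading 𝓡₁ 𝓡₂) t := by
  obtain ⟨ρ, hρ⟩ := exists_desc_of_surjective
    (smulElement _ (tmul_quotPowOne_mem (𝓡₁ := 𝓡₁) (𝓡₂ := 𝓡₂) t t)) exists_smul_tmul_quotPowOne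
    (smulElement _ (quotPowOne_mem (𝓡 := tensorGrading 𝓡₁ 𝓡₂) t)) fun r hr =>
      smul_quotPowOne_eq_zero (irrelevantSup_le_irrelevant_pow t
        (mem_irrelevantSup_of_smul_eq_zero hr))
  refine ⟨ρ, ?_⟩
  have := LinearMap.congr_fun (congrArg lin hρ) (1 : R₁ ⊗[K] R₂)
  rw [lin_comp, LinearMap.comp_apply, lin_smulElement, lin_smulElement, one_smul, one_smul] at this
  exact this

end

end GrMod

namespace GrMod

section

variable {K R : Type u} [Field K] [CommRing R] [Algebra K R] {𝓡 : ℤ → Submodule K R}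
variable [GradedAlgebra 𝓡]

theorem gExtMap_left_comp_apply (i : ℕ) {N N' N'' : GrMod 𝓡} (M : GrMod 𝓡) (f : N' ⟶ N)
    (f' : N'' ⟶ N') (x : gExt i N M) :
    lin (gExtMap i f' (𝟙 M)) (lin (gExtMap i f (𝟙 M)) x) = lin (gExtMap i (f' ≫ f) (𝟙 M)) x := by
  have := LinearMap.congr_fun (congrArg lin (gExtMap_comp i f f' (𝟙 M) (𝟙 M))) x
  rw [Category.comp_id] at this
  exact this

/-! ### The Künneth isomorphism for local cohomology -/

/-- The morphisms `π` and `ρ` interleave the inverse system `Q` with the system of the `R / 𝔪 ^ t`.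
Both round trips are transition maps, so the two systems of `Ext` modules have the same colimit. -/
theorem isSeqColimit_localCohomology_of_interleaving (i : ℕ) (M : GrMod 𝓡) (Q : ℕ → GrMod 𝓡)
    (q : ∀ {s t}, s ≤ t → (Q t ⟶ Q s)) (π : ∀ t, quotPow 𝓡 (t + t) ⟶ Q t)
    (ρ : ∀ t, Q t ⟶ quotPow 𝓡 t)
    (hq : ∀ {r s t} (h : r ≤ s) (h' : s ≤ t), q h' ≫ q h = q (h.trans h'))
    (hπ : ∀ {s t} (h : s ≤ t), π t ≫ q h = quotPowMap 𝓡 (add_le_add h h) ≫ π s)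
    (hπρ : ∀ t, π t ≫ ρ t = quotPowMap 𝓡 (Nat.le_add_left t t))
    (hρπ : ∀ {s t} (h : s + s ≤ t), ρ t ≫ quotPowMap 𝓡 h ≫ π s =
      q ((Nat.le_add_left s s).trans h)) :
    IsSeqColimit (fun t => gExt i (Q t) M) (fun h => gExtMap i (q h) (𝟙 M))
      ((localCohomology 𝓡 i).obj M)
      (fun t => gExtMap i (π t) (𝟙 M) ≫ toLocalCohomology 𝓡 i (t + t) M) where
  map_comp h h' := by rw [gExtMap_comp, hq, Category.comp_id]
  w h := by
    rw [← Category.assoc, gExtMap_comp, hπ, ← gExtMap_comp, Category.assoc,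
      (isSeqColimit_localCohomology i M).w]
  surj x := by
    obtain ⟨t, y, rfl⟩ := (isSeqColimit_localCohomology i M).surj x
    -- Pulling back along `ρ t` and then `π t` is the transition from stage `t` to stage `t + t`,
    -- which leaves the class in the colimit unchanged.
    refine ⟨t, lin (gExtMap i (ρ t) (𝟙 M)) y, ?_⟩
    rw [lin_comp, LinearMap.comp_apply, gExtMap_left_comp_apply, hπρ]
    exact (isSeqColimit_localCohomology i M).w_apply _ y
  ker t y hy := by
    obtain ⟨r, hr, h0⟩ := (isSeqColimit_localCohomology i M).ker _
      (lin (gExtMap i (π t) (𝟙 M)) y) hy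
    refine ⟨r, (Nat.le_add_left t t).trans hr, ?_⟩
    -- The transition of `Q` from stage `t` to `r` factors through `R / 𝔪 ^ (t + t)`, where the
    -- class becomes zero on the way to stage `r`.
    rw [← hρπ hr, ← gExtMap_left_comp_apply, ← gExtMap_left_comp_apply, h0, map_zero]

theorem toLocalCohomology_naturality (i t : ℕ) {M M' : GrMod 𝓡} (g : M ⟶ M') :
    gExtMap i (𝟙 (quotPow 𝓡 t)) g ≫ toLocalCohomology 𝓡 i t M' =
      toLocalCohomology 𝓡 i t M ≫ (localCohomology 𝓡 i).map g :=
  (colimit.ι (quotPowSystem 𝓡 ⋙ gExtFunctor 𝓡 i) t).naturality g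

instance quotPow_finite (t : ℕ) : Module.Finite R (quotPow 𝓡 t) :=
  Module.Finite.of_surjective (irrelevant 𝓡 ^ t).mkQ (Submodule.mkQ_surjective _)

end

section

variable {K R₁ R₂ : Type u} [Field K] [CommRing R₁] [CommRing R₂] [Algebra K R₁] [Algebra K R₂]
variable {𝓡₁ : ℤ → Submodule K R₁} {𝓡₂ : ℤ → Submodule K R₂}
variable [GradedAlgebra 𝓡₁] [GradedAlgebra 𝓡₂]

variable (𝓡₁ 𝓡₂) in
/-- The morphism `R / 𝔪 ^ (t + t) ⟶ R₁ / 𝔪₁ ^ t ⊗ R₂ / 𝔪₂ ^ t` with `1 ↦ 1 ⊗ 1`. -/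
def quotPowToTensor (t : ℕ) :
    quotPow (tensorGrading 𝓡₁ 𝓡₂) (t + t) ⟶ tensorObj (quotPow 𝓡₁ t) (quotPow 𝓡₂ t) :=
  (exists_quotPow_hom_tensor 𝓡₁ 𝓡₂ t t).choose

theorem lin_quotPowToTensor (t : ℕ) :
    lin (quotPowToTensor 𝓡₁ 𝓡₂ t) (quotPowOne (tensorGrading 𝓡₁ 𝓡₂) (t + t)) =
      tmul (quotPowOne 𝓡₁ t) (quotPowOne 𝓡₂ t) :=
  (exists_quotPow_hom_tensor 𝓡₁ 𝓡₂ t t).choose_spec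

/-- All modules in the interleaving are cyclic and all morphisms send generator to generator, so
every required identity is checked on `1` or `1 ⊗ 1`. -/
theorem isSeqColimit_gExt_tensor_quotPow (k : ℕ) (M : GrMod (tensorGrading 𝓡₁ 𝓡₂)) :
    IsSeqColimit (fun t => gExt k (tensorObj (quotPow 𝓡₁ t) (quotPow 𝓡₂ t)) M)
      (fun h => gExtMap k (tensorMap (quotPowMap 𝓡₁ h) (quotPowMap 𝓡₂ h)) (𝟙 M))
      ((localCohomology (tensorGrading 𝓡₁ 𝓡₂) k).obj M)
      (fun t => gExtMap k (quotPowToTensor 𝓡₁ 𝓡₂ t) (𝟙 M) ≫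
        toLocalCohomology (tensorGrading 𝓡₁ 𝓡₂) k (t + t) M) := by
  choose ρ hρ using exists_tensor_hom_quotPow 𝓡₁ 𝓡₂
  refine isSeqColimit_localCohomology_of_interleaving k M _
    (fun h => tensorMap (quotPowMap 𝓡₁ h) (quotPowMap 𝓡₂ h)) (quotPowToTensor 𝓡₁ 𝓡₂) ρ
    ?_ ?_ ?_ ?_
  · intro r s t h h'
    exact tensor_quotPow_hom_ext rfl
  · intro s t h
    refine quotPow_hom_ext ?_
    rw [lin_comp, LinearMap.comp_apply, lin_comp, LinearMap.comp_apply, lin_quotPowToTensor,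
      lin_quotPowMap_quotPowOne, lin_quotPowToTensor]
    rfl
  · intro t
    refine quotPow_hom_ext ?_
    rw [lin_comp, LinearMap.comp_apply, lin_quotPowToTensor, hρ, lin_quotPowMap_quotPowOne]
  · intro s t h
    refine tensor_quotPow_hom_ext ?_
    rw [lin_comp, LinearMap.comp_apply, lin_comp, LinearMap.comp_apply, hρ,
      lin_quotPowMap_quotPowOne, lin_quotPowToTensor]
    rfl

/-- The exponent of `𝔪` does not matter: over `R / 𝔪 ^ max s s'` the two morphisms coincide, since
they agree on the generator. This passes from the projection chosen with exponent `t + t` to an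
arbitrary one. -/
theorem gExtMap_comp_toLocalCohomology_eq (k : ℕ) {s s' : ℕ} {Q M : GrMod (tensorGrading 𝓡₁ 𝓡₂)}
    (π : quotPow (tensorGrading 𝓡₁ 𝓡₂) s ⟶ Q) (π' : quotPow (tensorGrading 𝓡₁ 𝓡₂) s' ⟶ Q)
    (h : lin π (quotPowOne (tensorGrading 𝓡₁ 𝓡₂) s) =
      lin π' (quotPowOne (tensorGrading 𝓡₁ 𝓡₂) s')) :
    gExtMap k π (𝟙 M) ≫ toLocalCohomology (tensorGrading 𝓡₁ 𝓡₂) k s M =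
      gExtMap k π' (𝟙 M) ≫ toLocalCohomology (tensorGrading 𝓡₁ 𝓡₂) k s' M := by
  have hc := isSeqColimit_localCohomology (𝓡 := tensorGrading 𝓡₁ 𝓡₂) k M
  have e : quotPowMap (tensorGrading 𝓡₁ 𝓡₂) (le_max_left s s') ≫ π =
      quotPowMap (tensorGrading 𝓡₁ 𝓡₂) (le_max_right s s') ≫ π' := quotPow_hom_ext h
  rw [← hc.w (le_max_left s s'), ← hc.w (le_max_right s s'), ← Category.assoc, ← Category.assoc,
    gExtMap_comp, gExtMap_comp, e]

theorem extSumMap_extSumToLcSum (k t : ℕ) {M₁ M₁' : GrMod 𝓡₁} {M₂ M₂' : GrMod 𝓡₂} (g₁ : M₁ ⟶ M₁')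
    (g₂ : M₂ ⟶ M₂') :
    extSumMap k (𝟙 (quotPow 𝓡₁ t)) g₁ (𝟙 (quotPow 𝓡₂ t)) g₂ ≫ extSumToLcSum k t M₁' M₂' =
      extSumToLcSum k t M₁ M₂ ≫ lcSumMap k g₁ g₂ := by
  refine biproduct.hom_ext' _ _ fun ij => ?_
  rw [biproduct.ι_map_assoc, biproduct.ι_map_assoc, biproduct.ι_map, biproduct.ι_map,
    ← Category.assoc, ← Category.assoc, ← tensorMap_comp, ← tensorMap_comp,
    toLocalCohomology_naturality, toLocalCohomology_naturality]

/-- The Künneth isomorphism for local cohomology and its compatibility with the external product. -/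
theorem exists_lcSum_iso [IsNoetherianRing R₁] [IsNoetherianRing R₂] (k : ℕ) (M₁ : GrMod 𝓡₁)
    (M₂ : GrMod 𝓡₂) :
    ∃ σ : lcSum k M₁ M₂ ≅ (localCohomology (tensorGrading 𝓡₁ 𝓡₂) k).obj (tensorObj M₁ M₂),
      ∀ t, extSumToLcSum k t M₁ M₂ ≫ σ.hom =
        extSumProd k (quotPow 𝓡₁ t) M₁ (quotPow 𝓡₂ t) M₂ ≫
          gExtMap k (quotPowToTensor 𝓡₁ 𝓡₂ t) (𝟙 (tensorObj M₁ M₂)) ≫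
            toLocalCohomology (tensorGrading 𝓡₁ 𝓡₂) k (t + t) (tensorObj M₁ M₂) := by
  have hiso : ∀ t, IsIso (extSumProd k (quotPow 𝓡₁ t) M₁ (quotPow 𝓡₂ t) M₂) := fun t =>
    isIso_extSumProd _ _ _ _ k
  -- The modules `R₁ / 𝔪₁ ^ t` and `R₂ / 𝔪₂ ^ t` are cyclic, so the external products are
  -- isomorphisms at every stage and carry one sequence to the other; the colimits are therefore
  -- isomorphic.
  refine (isSeqColimit_lcSum k M₁ M₂).exists_iso
    ((isSeqColimit_gExt_tensor_quotPow k (tensorObj M₁ M₂)).of_isIso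
      (fun t => extSumProd k (quotPow 𝓡₁ t) M₁ (quotPow 𝓡₂ t) M₂) fun h => ?_)
  have := extSumProd_naturality k (quotPowMap 𝓡₁ h) (𝟙 M₁) (quotPowMap 𝓡₂ h) (𝟙 M₂)
  rw [tensorMap_id] at this
  exact this

end

end GrMod

end

/-! ### External products and the Künneth formula -/

theorem theorem3p4 {K R₁ R₂ : Type u} [Field K] [CommRing R₁] [CommRing R₂] [Algebra K R₁]
    [Algebra K R₂] (𝓡₁ : ℤ → Submodule K R₁) (𝓡₂ : ℤ → Submodule K R₂)
    [GradedAlgebra 𝓡₁] [GradedAlgebra 𝓡₂] :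
    ∃ τ : ∀ (k : ℕ) (N₁ M₁ : GrMod 𝓡₁) (N₂ M₂ : GrMod 𝓡₂),
        GrMod.extSum k N₁ M₁ N₂ M₂ ⟶
          GrMod.gExt k (GrMod.tensorObj N₁ N₂) (GrMod.tensorObj M₁ M₂),
      -- the homomorphisms `τ` are natural in all arguments
      (∀ (k : ℕ) {N₁ N₁' M₁ M₁' : GrMod 𝓡₁} {N₂ N₂' M₂ M₂' : GrMod 𝓡₂}
          (f₁ : N₁' ⟶ N₁) (g₁ : M₁ ⟶ M₁') (f₂ : N₂' ⟶ N₂) (g₂ : M₂ ⟶ M₂'),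
        GrMod.extSumMap k f₁ g₁ f₂ g₂ ≫ τ k N₁' M₁' N₂' M₂' =
          τ k N₁ M₁ N₂ M₂ ≫ GrMod.gExtMap k (GrMod.tensorMap f₁ f₂) (GrMod.tensorMap g₁ g₂)) ∧
      -- on homogeneous elements they are the external product
      (∀ (k : ℕ) (ij : GrMod.Bidegree k) (N₁ M₁ : GrMod 𝓡₁) (N₂ M₂ : GrMod 𝓡₂) (p q : ℤ)
          (x : GrMod.ExtPiece ij.1.1 N₁ M₁ p) (y : GrMod.ExtPiece ij.1.2 N₂ M₂ q),
        GrMod.lin (τ k N₁ M₁ N₂ M₂) (GrMod.extSumTmul ij x y) =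
          GrMod.extι k (GrMod.tensorObj N₁ N₂) (GrMod.tensorObj M₁ M₂) (p + q)
            (GrMod.extProd ij.2 x y)) ∧
      -- in degree zero they send `f ⊗ g` to the homomorphism `x ⊗ y ↦ f x ⊗ g y`
      (∀ (N₁ M₁ : GrMod 𝓡₁) (N₂ M₂ : GrMod 𝓡₂) (p q : ℤ)
          (f : N₁ ⟶ M₁.shift p) (g : N₂ ⟶ M₂.shift q),
        GrMod.lin (τ 0 N₁ M₁ N₂ M₂) (GrMod.extSumTmul (k := 0) ⟨(0, 0), rfl⟩
            (Abelian.Ext.mk₀ f) (Abelian.Ext.mk₀ g)) =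
          GrMod.extι 0 (GrMod.tensorObj N₁ N₂) (GrMod.tensorObj M₁ M₂) (p + q)
            (Abelian.Ext.mk₀ (GrMod.tensorMap f g ≫ GrMod.shiftTensor M₁ M₂ p q))) ∧
      -- the Künneth isomorphisms for local cohomology
      (IsConnectedGraded 𝓡₁ → IsConnectedGraded 𝓡₂ →
        ∃ σ : ∀ (k : ℕ) (M₁ : GrMod 𝓡₁) (M₂ : GrMod 𝓡₂),
            GrMod.lcSum k M₁ M₂ ≅
              (GrMod.localCohomology (tensorGrading 𝓡₁ 𝓡₂) k).obj (GrMod.tensorObj M₁ M₂),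
          -- the isomorphisms `σ` are natural
          (∀ (k : ℕ) {M₁ M₁' : GrMod 𝓡₁} {M₂ M₂' : GrMod 𝓡₂} (g₁ : M₁ ⟶ M₁') (g₂ : M₂ ⟶ M₂'),
            GrMod.lcSumMap k g₁ g₂ ≫ (σ k M₁' M₂').hom =
              (σ k M₁ M₂).hom ≫ (GrMod.localCohomology (tensorGrading 𝓡₁ 𝓡₂) k).map
                (GrMod.tensorMap g₁ g₂)) ∧
          -- they are induced by `τ` and the projections `R / 𝔪 ^ s → R₁ / 𝔪₁ ^ t ⊗ R₂ / 𝔪₂ ^ t`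
          (∀ (k s t : ℕ) (M₁ : GrMod 𝓡₁) (M₂ : GrMod 𝓡₂)
              (π : GrMod.quotPow (tensorGrading 𝓡₁ 𝓡₂) s ⟶
                GrMod.tensorObj (GrMod.quotPow 𝓡₁ t) (GrMod.quotPow 𝓡₂ t)),
            GrMod.lin π (GrMod.quotPowOne (tensorGrading 𝓡₁ 𝓡₂) s) =
              GrMod.tmul (GrMod.quotPowOne 𝓡₁ t) (GrMod.quotPowOne 𝓡₂ t) →
            GrMod.extSumToLcSum k t M₁ M₂ ≫ (σ k M₁ M₂).hom =
              τ k (GrMod.quotPow 𝓡₁ t) M₁ (GrMod.quotPow 𝓡₂ t) M₂ ≫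
                GrMod.gExtMap k π (𝟙 (GrMod.tensorObj M₁ M₂)) ≫
                  GrMod.toLocalCohomology (tensorGrading 𝓡₁ 𝓡₂) k s
                    (GrMod.tensorObj M₁ M₂))) := by
  refine ⟨GrMod.extSumProd, GrMod.extSumProd_naturality, GrMod.extSumProd_tmul,
    GrMod.extSumProd_zero, fun h₁ h₂ => ?_⟩
  have := h₁.finiteType
  have := h₂.finiteType
  -- Hilbert's basis theorem supplies the noetherian hypothesis of the dévissage.
  have := Algebra.FiniteType.isNoetherianRing K R₁
  have := Algebra.FiniteType.isNoetherianRing K R₂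
  choose σ hσ using GrMod.exists_lcSum_iso (𝓡₁ := 𝓡₁) (𝓡₂ := 𝓡₂)
  refine ⟨σ, fun k M₁ M₁' M₂ M₂' g₁ g₂ => ?_, fun k s t M₁ M₂ π hπ => ?_⟩
  -- Naturality of `σ` may be tested at each finite stage, where it reduces to naturality of `τ` and
  -- of the maps to local cohomology.
  · refine (GrMod.isSeqColimit_lcSum k M₁ M₂).hom_ext fun t => ?_
    rw [← Category.assoc, ← GrMod.extSumMap_extSumToLcSum, Category.assoc, hσ, ← Category.assoc,
      GrMod.extSumProd_naturality, ← Category.assoc (GrMod.extSumToLcSum k t M₁ M₂), hσ]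
    simp only [Category.assoc]
    rw [← GrMod.toLocalCohomology_naturality, ← Category.assoc (GrMod.gExtMap _ _ _),
      ← Category.assoc (GrMod.gExtMap _ _ _), GrMod.gExtMap_comp, GrMod.gExtMap_comp,
      GrMod.tensorMap_id, Category.comp_id, Category.comp_id, Category.id_comp, Category.id_comp]
  · rw [hσ]
    exact congrArg _ (GrMod.gExtMap_comp_toLocalCohomology_eq k _ _
      ((GrMod.lin_quotPowToTensor t).trans hπ.symm))
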